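/- All functions are real. Let $\rho,q\in C^\infty[0,\infty)$, $\rho>0$, $\int_0^\infty\rho^{1/2}(x)\,dx=\infty$. Put $\tau(x)=\int_0^x\rho^{1/2}(s)\,ds$, let $x(\cdot)$ be the inverse function of $\tau$, and extend functions of time by zero to $t<0$. There is a function $w$ (the regular part of the fundamental solution), smooth in $\{(x,t): x\ge 0,\ \tau(x)\le t\}$ and zero for $t<\tau(x)$, such that for every smooth control $f$ vanishing near $t=0$ the Duhamel formula $$u^f(x,t)=\Big[\tfrac{\rho(x)}{\rho(0)}\Big]^{-1/4}f(t-\tau(x))+\int_0^{t-\tau(x)}w(x,t-s)f(s)\,ds\qquad(\tau(x)\le t),\qquad u^f=0\quad (t<\tau(x)),$$ gives a classical smooth solution of $\rho u_{tt}-u_{xx}+qu=0$ $(x,t>0)$, $u|_{t=0}=u_t|_{t=0}=0$, $u|_{x=0}=f$. For $f\in L_2$ the generalized solution $u^f$ is defined by this formula. Let $T>0$. The control operator $W^T:L_2(0,T)\to L_{2,\rho}(0,x(T))$, $W^Tf=u^f(\cdot,T)$ (the target space carries the inner product $\int_0^{x(T)}uv\,\rho\,dx$), is an isomorphism (bounded,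 with bounded inverse). Let $C^T=(W^T)^*W^T$, let $R^T$ be the response operator in $L_2(0,T)$, $R^Tf=u^f_x(0,\cdot)$, with the dense domain $\{f\in H^1[0,T]: f(0)=0\}$, and let $\varkappa^T(t)=T-t$. Then $\varkappa^T$ lies in the domain of $(R^T)^*$, and for every solution $y$ of $-y''+qy=0$ on $(0,x(T))$ (with $y(0)$, $y'(0)$ the boundary values at $x=0$) the control $f=(W^T)^{-1}y$ is the unique solution in $L_2(0,T)$ of $$C^Tf=y'(0)\,\varkappa^T-y(0)\,(R^T)^*\varkappa^T .$$ Moreover, let $\rho\equiv1$, $y(0)=0$, $y'(0)=1$, and put $r(t)=w_x(0,t)$, $p(t)=\frac12\int_0^t r(\eta)\,d\eta$, $F(s,t)=p(t+s)-p(|t-s|)$. Then there is a function $\varphi\in C^1(\{0\le t\le\xi\le T\})$ such that for every $\xi\in(0,T]$ the control $f^\xi(t)=\varphi(\xi,\xi-t)$ satisfies $W^\xi f^\xi=y$ on $(0,\xi)$ and $C^\xi f^\xi=\varkappa^\xi$, and, whenever $\varphi(\xi,\xi)\neq0$, the function $L(\xi,t)=\varphi(\xi,\xi)^{-1}\varphi_\xi(\xi,t)$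 satisfies the Gelfand–Levitan equation $$F(\xi,t)+L(\xi,t)+\int_0^\xi F(s,t)L(\xi,s)\,ds=0,\qquad 0\le t\le\xi .$$ -/

import Mathlib

open MeasureTheory Set Filter Topology
open scoped ContDiff

namespace WaveControl

noncomputable section

/-- The eikonal `τ(x) = ∫₀ˣ ρ^{1/2}(s) ds`. -/
def eikonal (ρ : ℝ → ℝ) (x : ℝ) : ℝ := ∫ s in (0 : ℝ)..x, √(ρ s)

/-- `x(t)`: the inverse function of the eikonal on `[0, ∞)`. -/
def front (ρ : ℝ → ℝ) (t : ℝ) : ℝ := Function.invFunOn (eikonal ρ) (Ici 0) t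

/-- `u = u(x, t)` is a classical smooth solution of the problem
`ρ u_tt - u_xx + q u = 0` (`x > 0`, `t > 0`), `u = u_t = 0` at `t = 0`, `u = f` at `x = 0`. -/
structure IsClassicalWave (ρ q f : ℝ → ℝ) (u : ℝ → ℝ → ℝ) : Prop where
  smooth : ContDiffOn ℝ ∞ (Function.uncurry u) (Ici 0 ×ˢ Ici 0)
  pde : ∀ x t : ℝ, 0 < x → 0 < t →
    ρ x * iteratedDeriv 2 (fun s => u x s) t - iteratedDeriv 2 (fun z => u z t) x
      + q x * u x t = 0
  init : ∀ x : ℝ, 0 ≤ x → u x 0 = 0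
  init_deriv : ∀ x : ℝ, 0 ≤ x → HasDerivWithinAt (fun t => u x t) 0 (Ici 0) 0
  boundary : ∀ t : ℝ, 0 ≤ t → u 0 t = f t

/-- The Duhamel formula
`(ρ(x)/ρ(0))^{-1/4} f(t - τ(x)) + ∫₀^{t-τ(x)} w(x, t - s) f(s) ds`,
where functions of time are extended by zero to negative times. -/
def wave (ρ : ℝ → ℝ) (w : ℝ → ℝ → ℝ) (f : ℝ → ℝ) (x t : ℝ) : ℝ :=
  open Classical in
  if eikonal ρ x ≤ t then
    (ρ x / ρ 0) ^ (-(1 / 4) : ℝ) * f (t - eikonal ρ x)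
      + ∫ s in (0 : ℝ)..(t - eikonal ρ x), w x (t - s) * f s
  else 0

/-- `w` is the regular part of the fundamental solution
`(ρ(x)/ρ(0))^{-1/4} δ(t - τ(x)) + w(x, t)`: it is smooth in `0 ≤ τ(x) ≤ t`, it vanishes for
`t < τ(x)`, and convolution in time of the fundamental solution with a smooth control that
vanishes near `t = 0` is the classical solution for this control. -/
structure IsWaveKernel (ρ q : ℝ → ℝ) (w : ℝ → ℝ → ℝ) : Prop where
  smooth : ContDiffOn ℝ ∞ (Function.uncurry w) {p : ℝ × ℝ | 0 ≤ p.1 ∧ eikonal ρ p.1 ≤ p.2}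
  vanish : ∀ x t : ℝ, 0 ≤ x → t < eikonal ρ x → w x t = 0
  duhamel : ∀ f : ℝ → ℝ, ContDiff ℝ ∞ f → (∃ ε : ℝ, 0 < ε ∧ ∀ t : ℝ, t ≤ ε → f t = 0) →
    IsClassicalWave ρ q f (wave ρ w f)

/-- Lebesgue measure on the time interval `(0, T)`. -/
abbrev timeMeasure (T : ℝ) : Measure ℝ := volume.restrict (Ioo 0 T)

/-- The measure `ρ dx` on the space interval `(0, x(T))`. -/
abbrev spaceMeasure (ρ : ℝ → ℝ) (T : ℝ) : Measure ℝ :=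
  (volume.restrict (Ioo 0 (front ρ T))).withDensity (fun x => ENNReal.ofReal (ρ x))

/-- The outer space `L₂(0, T)`. -/
abbrev Outer (T : ℝ) : Type := Lp ℝ 2 (timeMeasure T)

/-- The inner space `L_{2,ρ}(0, x(T))`. -/
abbrev Inner (ρ : ℝ → ℝ) (T : ℝ) : Type := Lp ℝ 2 (spaceMeasure ρ T)

/-- `W` is the control operator `f ↦ u^f(·, T)`. -/
def IsControlOperator (ρ : ℝ → ℝ) (w : ℝ → ℝ → ℝ) (T : ℝ)
    (W : Outer T →L[ℝ] Inner ρ T) : Prop :=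
  ∀ f : Outer T, W f =ᵐ[spaceMeasure ρ T] fun x => wave ρ w f x T

/-- The connecting operator `W* W`. -/
def connectingOperator {ρ : ℝ → ℝ} {T : ℝ} (W : Outer T →L[ℝ] Inner ρ T) :
    Outer T →L[ℝ] Outer T :=
  (ContinuousLinearMap.adjoint W) ∘L W

/-- The absolutely continuous function with derivative `v` that vanishes at `0`. -/
def primitive (v : ℝ → ℝ) (t : ℝ) : ℝ := ∫ s in (0 : ℝ)..t, v s

/-- `R` is the response operator `f ↦ u^f_x(0, ·)`, an unbounded operator in `L₂(0, T)` with
domain `{f ∈ H¹[0, T] | f(0) = 0}`, that is, the set of primitives of functions of `L₂(0, T)`. -/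
structure IsResponseOperator (ρ : ℝ → ℝ) (w : ℝ → ℝ → ℝ) (T : ℝ)
    (R : Outer T →ₗ.[ℝ] Outer T) : Prop where
  mem_domain_iff : ∀ f : Outer T,
    f ∈ R.domain ↔ ∃ v : Outer T, f =ᵐ[timeMeasure T] primitive v
  apply_eq : ∀ (f : R.domain) (v : Outer T),
    (f : Outer T) =ᵐ[timeMeasure T] primitive v →
      ∀ᵐ t ∂(timeMeasure T),
        HasDerivWithinAt (fun x => wave ρ w (primitive v) x t) (R f t) (Ici 0) 0

lemma memLp_kappa (T : ℝ) : MemLp (fun t : ℝ => T - t) 2 (timeMeasure T) := by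
  refine MemLp.of_bound (C := |T|) (by fun_prop) ?_
  filter_upwards [ae_restrict_mem measurableSet_Ioo] with t ht
  rw [Real.norm_eq_abs, abs_of_nonneg (by linarith [ht.2])]
  linarith [ht.1, le_abs_self T]

/-- The function `ϰ^T(t) = T - t` as an element of `L₂(0, T)`. -/
def kappa (T : ℝ) : Outer T := (memLp_kappa T).toLp (fun t : ℝ => T - t)

/-- `y` solves `-y'' + q y = 0` on `(0, X)`, with derivative `y'`; `y 0` and `y' 0` are the values
at the end point `0`, that is, the right limits there. -/
structure IsStaticSolution (q : ℝ → ℝ) (X : ℝ) (y y' : ℝ → ℝ) : Prop where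
  hasDerivAt : ∀ x ∈ Ioo 0 X, HasDerivAt y (y' x) x
  hasDerivAt_deriv : ∀ x ∈ Ioo 0 X, HasDerivAt y' (q x * y x) x
  tendsto_zero : Tendsto y (𝓝[>] 0) (𝓝 (y 0))
  tendsto_deriv_zero : Tendsto y' (𝓝[>] 0) (𝓝 (y' 0))

/-- The response function `r(t) = w_x(0, t)`, `t > 0`. -/
def responseFunction (w : ℝ → ℝ → ℝ) (t : ℝ) : ℝ :=
  derivWithin (fun x => w x t) (Ici 0) 0

/-- `p(t) = ½ ∫₀ᵗ r(η) dη`. -/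
def responsePrimitive (w : ℝ → ℝ → ℝ) (t : ℝ) : ℝ :=
  (1 / 2 : ℝ) * ∫ η in (0 : ℝ)..t, responseFunction w η

/-- `F(s, t) = p(t + s) - p(|t - s|)`. -/
def glKernel (w : ℝ → ℝ → ℝ) (s t : ℝ) : ℝ :=
  responsePrimitive w (t + s) - responsePrimitive w |t - s|

/-- The triangle `{(ξ, t) | 0 ≤ t ≤ ξ ≤ T}`. -/
def triangle (T : ℝ) : Set (ℝ × ℝ) := {p | 0 ≤ p.2 ∧ p.2 ≤ p.1 ∧ p.1 ≤ T}

/-- `L(ξ, t) = φ(ξ, ξ)⁻¹ φ_ξ(ξ, t)`, the partial derivative being taken within the triangle. -/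
def glSolution (T : ℝ) (φ : ℝ → ℝ → ℝ) (ξ t : ℝ) : ℝ :=
  (φ ξ ξ)⁻¹ * fderivWithin ℝ (Function.uncurry φ) (triangle T) (ξ, t) (1, 0)

end

end WaveControl

/-!
**Reduction to a regular kernel.** With `τ` the eikonal and `a = (ρ / ρ(0))^{-1/4}`, the
substitution `u(x, t) = a(x) v(τ(x), t)` turns the wave equation into `v_tt - v_xx + Q v = 0`,
because `a` solves the transport equation that removes the first order terms. For unit density
Duhamel's formula is the convolution in time with `δ(t - x) + k(x, t - x)`, and it yields a
solution exactly when the kernel `k(x, η)`, `η = t - x`, satisfies `2 k_{xη} - k_{xx} + Q k = 0`,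
`k(0, ·) = 0`, `2 k_x(x, 0) = -Q(x)` (`IsGoursat`). Along the characteristics `2x + η = const` this
is a Volterra equation for `k_x`; successive approximations solve it, and each application of the
integral operator gains one derivative (`exists_isGoursat`, `exists_isWaveKernel`). Conversely the
conditions follow from Duhamel's formula by testing with controls (`straighten_zero`,
`isGoursat_straighten`), so that the arguments below apply to an arbitrary kernel with the Duhamel
property.

**The operators.** Apart from the change of variable `t = T - τ(x)` and the factor `a`, which
together form an isomorphism of the two `L₂` spaces, the control operator is `1 + K` with a
Volterra operator `K`, hence an isomorphism (`exists_controlOperator`). Since `k` vanishes on the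
axis, Hadamard's lemma `k = x m` gives `u_x(0, t)` for every continuous control differentiable
at `t`; the response operator therefore is a bounded operator applied to the derivative of the
control (`isResponseOperator_responseOp`). Integration by parts puts `T - t` into the domain of its
adjoint.

**The control equation.** Let `u` be the wave of a test control `f`. Twice integrating by parts in
time, `u(x, T) = ∫₀ᵀ (T - t) u_tt(x, t) dt`; and for a static solution `y` Green's formula in `x`
gives `∫ y ρ u_tt dx = y'(0) f(t) - y(0) u_x(0, t)`. Together, `(y, W f) = (ϰ, y'(0) f - y(0) R
f)`, that is, `W* y = y'(0) ϰ - y(0) R* ϰ` (`adjoint_control_static`). As `W` is an isomorphism,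
`W* W f = W* y` is equivalent to `W f = y`.

**The Gelfand–Levitan equation.** For unit density put `A(x, s) = w(x, s)`, `x ≤ s`. With the
control run backwards in time, `W^ξ f^ξ = y` reads `φ(ξ, x) + ∫_x^ξ A(x, s) φ(ξ, s) ds = y(x)`, so
that `φ(ξ, x) = y(x) - ∫_x^ξ Γ(x, s) y(s) ds` with the resolvent `Γ` of `A`. Therefore `φ_ξ(ξ, t) =
-Γ(t, ξ) y(ξ)` and `φ(ξ, ξ) = y(ξ)`, whence `L(ξ, t) = -Γ(t, ξ)`. The remaining ingredient is the
factorization `F(s, t) = A(t, s) + ∫₀ᵗ A(x, s) A(x, t) dx` for `t ≤ s`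
(`IsGoursat.integral_response`): both sides are differentiated along `s - t = const`, and the
result is a consequence of the equation for `k` (`IsGoursat.characteristic_invariant`). The
resolvent identity and Fubini's theorem then give the equation for `L`
(`IsResolvent.gelfandLevitan`).
-/

namespace WaveControl
noncomputable section

/-! ### Integrals with parameters and partial derivatives -/

theorem continuousOn_intervalIntegral_param {E F : Type*} [TopologicalSpace E]
    [NormedAddCommGroup F] [NormedSpace ℝ F] {S : Set E} {a b : ℝ} (hab : a ≤ b)
    {H : E → ℝ → F} (hH : ContinuousOn (Function.uncurry H) (S ×ˢ Icc a b)) :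
    ContinuousOn (fun p => ∫ s in a..b, H p s) S := by
  rw [continuousOn_iff_continuous_domRestrict]
  have h1 : Continuous (Function.uncurry fun (p : S) (s : ℝ) => H p (projIcc a b hab s)) :=
    hH.comp_continuous (f := fun z : S × ℝ => ((z.1 : E), (projIcc a b hab z.2 : ℝ)))
      (by fun_prop) (fun z => ⟨z.1.2, (projIcc a b hab z.2).2⟩)
  have h2 := intervalIntegral.continuous_parametric_intervalIntegral_of_continuous' (μ := volume)
    h1 a b
  convert h2 using 2 with p
  refine intervalIntegral.integral_congr fun s hs => ?_
  rw [uIcc_of_le hab] at hs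
  simp [projIcc_of_mem hab hs]

theorem hasFDerivWithinAt_intervalIntegral_param {E F : Type*} [NormedAddCommGroup E]
    [NormedSpace ℝ E] [NormedAddCommGroup F] [NormedSpace ℝ F] [CompleteSpace F]
    {S : Set E} (hS : Convex ℝ S) {a b : ℝ} (hab : a ≤ b) {H : E → ℝ → F} {D : E → ℝ → E →L[ℝ] F}
    (hH : ContinuousOn (Function.uncurry H) (S ×ˢ Icc a b))
    (hD : ContinuousOn (Function.uncurry D) (S ×ˢ Icc a b))
    (hHD : ∀ p ∈ S, ∀ s ∈ Icc a b, HasFDerivWithinAt (fun p => H p s) (D p s) S p)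
    {p : E} (hp : p ∈ S) :
    HasFDerivWithinAt (fun p => ∫ s in a..b, H p s) (∫ s in a..b, D p s) S p := by
  have secH : ∀ p ∈ S, ContinuousOn (H p) (Icc a b) := fun p hp =>
    hH.comp (f := fun s => (p, s)) (by fun_prop) fun s hs => ⟨hp, hs⟩
  have secD : ∀ p ∈ S, ContinuousOn (D p) (Icc a b) := fun p hp =>
    hD.comp (f := fun s => (p, s)) (by fun_prop) fun s hs => ⟨hp, hs⟩
  have intH : ∀ p ∈ S, IntervalIntegrable (H p) volume a b := fun p hp =>
    (secH p hp).intervalIntegrable_of_Icc hab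
  have intD : ∀ p ∈ S, IntervalIntegrable (D p) volume a b := fun p hp =>
    (secD p hp).intervalIntegrable_of_Icc hab
  rw [hasFDerivWithinAt_iff_isLittleO, Asymptotics.isLittleO_iff]
  intro c hc
  set ε := c / (b - a + 1) with hε
  have hba : 0 < b - a + 1 := by linarith
  have hεp : 0 < ε := div_pos hc hba
  obtain ⟨v, hv, hvD⟩ := isCompact_Icc.mem_uniformity_of_prod hD hp (Metric.dist_mem_uniformity hεp)
  obtain ⟨δ, hδ, hδv⟩ := Metric.mem_nhdsWithin_iff.1 hv
  have hmem : S ∩ Metric.ball p δ ∈ 𝓝[S] p :=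
    inter_mem self_mem_nhdsWithin (mem_nhdsWithin_of_mem_nhds (Metric.ball_mem_nhds p hδ))
  filter_upwards [hmem] with p' hp'
  have key : ∀ s ∈ Icc a b, ‖H p' s - H p s - D p s (p' - p)‖ ≤ ε * ‖p' - p‖ := by
    intro s hs
    refine (hS.inter (convex_ball p δ)).norm_image_sub_le_of_norm_hasFDerivWithin_le'
      (f := fun p => H p s) (f' := fun p => D p s)
      (fun x hx => (hHD x hx.1 s hs).mono inter_subset_left) (fun x hx => ?_)
      ⟨hp, Metric.mem_ball_self hδ⟩ hp'
    have := hvD x (hδv ⟨hx.2, hx.1⟩) s hs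
    rw [← dist_eq_norm]
    exact le_of_lt this
  have e1 : (∫ s in a..b, D p s) (p' - p) = ∫ s in a..b, D p s (p' - p) :=
    (ContinuousLinearMap.intervalIntegral_apply (intD p hp) _)
  have i3 : IntervalIntegrable (fun s => D p s (p' - p)) volume a b :=
    ContinuousOn.intervalIntegrable_of_Icc hab ((secD p hp).clm_apply continuousOn_const)
  rw [e1, ← intervalIntegral.integral_sub (intH _ hp'.1) (intH _ hp),
    ← intervalIntegral.integral_sub ((intH _ hp'.1).sub (intH _ hp)) i3]
  have h3 := intervalIntegral.norm_integral_le_of_norm_le_const (a := a) (b := b)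
    (f := fun s => H p' s - H p s - D p s (p' - p)) (C := ε * ‖p' - p‖)
    (fun s hs => key s (by rw [uIoc_of_le hab] at hs; exact ⟨hs.1.le, hs.2⟩))
  refine h3.trans ?_
  rw [abs_of_nonneg (by linarith), hε]
  have : c / (b - a + 1) * (b - a) ≤ c := by
    rw [div_mul_eq_mul_div, div_le_iff₀ hba]; nlinarith
  calc _ = c / (b - a + 1) * (b - a) * ‖p' - p‖ := by ring
    _ ≤ _ := by gcongr

/-- An integral over a parameter is as smooth as its integrand. The induction on `n` passes from
`F` to `E →L[ℝ] F`, which has to lie in the same universe; hence `Type`. -/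
theorem contDiffOn_nat_intervalIntegral_param {E : Type} [NormedAddCommGroup E]
    [NormedSpace ℝ E] {S : Set E} (hS : Convex ℝ S) (hSu : UniqueDiffOn ℝ S) {a b : ℝ} (hab : a < b)
    (n : ℕ) : ∀ {F : Type} [NormedAddCommGroup F] [NormedSpace ℝ F] [CompleteSpace F]
      {H : E → ℝ → F}, ContDiffOn ℝ n (Function.uncurry H) (S ×ˢ Icc a b) →
      ContDiffOn ℝ n (fun p => ∫ s in a..b, H p s) S := by
  have hu : UniqueDiffOn ℝ (S ×ˢ Icc a b) := hSu.prod (uniqueDiffOn_Icc hab)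
  induction n with
  | zero =>
    intro F _ _ _ H hH
    rw [Nat.cast_zero, contDiffOn_zero] at hH ⊢
    exact continuousOn_intervalIntegral_param hab.le hH
  | succ n ih =>
    intro F _ _ _ H hH
    rw [Nat.cast_succ] at hH ⊢
    rw [contDiffOn_succ_iff_hasFDerivWithinAt_of_uniqueDiffOn hSu]
    refine ⟨by simp, fun p => ∫ s in a..b,
      (fderivWithin ℝ (Function.uncurry H) (S ×ˢ Icc a b) (p, s)).comp (.inl ℝ E ℝ), ?_, ?_⟩
    · refine ih (H := fun p s =>
        (fderivWithin ℝ (Function.uncurry H) (S ×ˢ Icc a b) (p, s)).comp (.inl ℝ E ℝ)) ?_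
      exact (hH.fderivWithin hu le_rfl).clm_comp contDiffOn_const
    · intro p hp
      refine hasFDerivWithinAt_intervalIntegral_param hS hab.le (D := fun p s =>
        (fderivWithin ℝ (Function.uncurry H) (S ×ˢ Icc a b) (p, s)).comp (.inl ℝ E ℝ))
        hH.continuousOn ?_ ?_ hp
      · exact ((hH.fderivWithin hu le_rfl).clm_comp contDiffOn_const).continuousOn
      · intro p hp s hs
        have h1 : HasFDerivWithinAt (Function.uncurry H)
            (fderivWithin ℝ (Function.uncurry H) (S ×ˢ Icc a b) (p, s)) (S ×ˢ Icc a b) (p, s) :=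
          ((hH.differentiableOn (by simp)) (p, s) ⟨hp, hs⟩).hasFDerivWithinAt
        have h2 : HasFDerivWithinAt (fun p : E => (p, s)) (.inl ℝ E ℝ) S p :=
          (hasFDerivAt_prodMk_left p s).hasFDerivWithinAt
        exact h1.comp p h2 fun p' (hp' : p' ∈ S) => (⟨hp', hs⟩ : (p', s) ∈ S ×ˢ Icc a b)

theorem contDiffOn_intervalIntegral_param {E : Type} [NormedAddCommGroup E]
    [NormedSpace ℝ E] {S : Set E} (hS : Convex ℝ S) (hSu : UniqueDiffOn ℝ S) {a b : ℝ} (hab : a < b)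
    {H : E → ℝ → ℝ} (hH : ContDiffOn ℝ ∞ (Function.uncurry H) (S ×ˢ Icc a b)) :
    ContDiffOn ℝ ∞ (fun p => ∫ s in a..b, H p s) S :=
  contDiffOn_infty.2 fun n => contDiffOn_nat_intervalIntegral_param hS hSu hab n
    (contDiffOn_infty.1 hH n)

/-- Continuous partial derivatives give a total derivative within a convex set, provided that any
two of its points are joined by an L-shaped path through a corner in the set. One-sided derivatives
at the boundary are allowed. -/
theorem hasFDerivWithinAt_of_partial {S : Set (ℝ × ℝ)} (hS : Convex ℝ S)
    (hcorner : ∀ p ∈ S, ∀ p' ∈ S, (p'.1, p.2) ∈ S ∨ (p.1, p'.2) ∈ S)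
    {f fx fy : ℝ × ℝ → ℝ} (hfx : ContinuousOn fx S) (hfy : ContinuousOn fy S)
    (h1 : ∀ p ∈ S, HasDerivWithinAt (fun x => f (x, p.2)) (fx p) {x | (x, p.2) ∈ S} p.1)
    (h2 : ∀ p ∈ S, HasDerivWithinAt (fun y => f (p.1, y)) (fy p) {y | (p.1, y) ∈ S} p.2)
    {p : ℝ × ℝ} (hp : p ∈ S) :
    HasFDerivWithinAt f (fx p • ContinuousLinearMap.fst ℝ ℝ ℝ
      + fy p • ContinuousLinearMap.snd ℝ ℝ ℝ) S p := by
  rw [hasFDerivWithinAt_iff_isLittleO, Asymptotics.isLittleO_iff]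
  intro c hc
  have hc2 : 0 < c / 2 := by linarith
  obtain ⟨δ₁, hδ₁, H1⟩ := Metric.continuousOn_iff.1 hfx p hp _ hc2
  obtain ⟨δ₂, hδ₂, H2⟩ := Metric.continuousOn_iff.1 hfy p hp _ hc2
  set δ := min δ₁ δ₂
  have hδ : 0 < δ := lt_min hδ₁ hδ₂
  set B := S ∩ Metric.ball p δ with hB
  have hBc : Convex ℝ B := hS.inter (convex_ball p δ)
  have hmem : B ∈ 𝓝[S] p :=
    inter_mem self_mem_nhdsWithin (mem_nhdsWithin_of_mem_nhds (Metric.ball_mem_nhds p hδ))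
  -- the mean value inequality along horizontal and vertical segments of the small set `B`
  have horiz : ∀ x x' y, (x, y) ∈ B → (x', y) ∈ B →
      ‖f (x', y) - f (x, y) - fx p * (x' - x)‖ ≤ c / 2 * ‖x' - x‖ := by
    intro x x' y hx hx'
    have hconv : Convex ℝ {x | (x, y) ∈ B} := by
      intro u hu v hv α β hα hβ hαβ
      have := hBc hu hv hα hβ hαβ
      have e : α • (u, y) + β • (v, y) = ((α • u + β • v, y) : ℝ × ℝ) := by
        ext
        · simp
        · simp [← add_mul, hαβ]
      rwa [e] at this
    have := hconv.norm_image_sub_le_of_norm_hasDerivWithin_le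
      (f := fun z => f (z, y) - fx p * z) (f' := fun z => fx (z, y) - fx p * 1) (C := c / 2)
      (fun z hz => ((h1 (z, y) hz.1).mono (fun w hw => hw.1)).sub
        ((hasDerivWithinAt_id z _).const_mul _)) (fun z hz => ?_) hx hx'
    · refine le_trans (le_of_eq ?_) this
      congr 1; ring
    · rw [mul_one, ← dist_eq_norm]
      exact (H1 _ hz.1 (lt_of_lt_of_le hz.2 (min_le_left _ _))).le
  have vert : ∀ x y y', (x, y) ∈ B → (x, y') ∈ B →
      ‖f (x, y') - f (x, y) - fy p * (y' - y)‖ ≤ c / 2 * ‖y' - y‖ := by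
    intro x y y' hx hx'
    have hconv : Convex ℝ {y | (x, y) ∈ B} := by
      intro u hu v hv α β hα hβ hαβ
      have := hBc hu hv hα hβ hαβ
      have e : α • (x, u) + β • (x, v) = ((x, α • u + β • v) : ℝ × ℝ) := by
        ext
        · simp [← add_mul, hαβ]
        · simp
      rwa [e] at this
    have := hconv.norm_image_sub_le_of_norm_hasDerivWithin_le
      (f := fun z => f (x, z) - fy p * z) (f' := fun z => fy (x, z) - fy p * 1) (C := c / 2)
      (fun z hz => ((h2 (x, z) hz.1).mono (fun w hw => hw.1)).sub
        ((hasDerivWithinAt_id z _).const_mul _)) (fun z hz => ?_) hx hx'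
    · refine le_trans (le_of_eq ?_) this
      congr 1; ring
    · rw [mul_one, ← dist_eq_norm]
      exact (H2 _ hz.1 (lt_of_lt_of_le hz.2 (min_le_right _ _))).le
  filter_upwards [hmem] with p' hp'
  obtain ⟨x, y⟩ := p
  obtain ⟨x', y'⟩ := p'
  have hpB : (x, y) ∈ B := ⟨hp, Metric.mem_ball_self hδ⟩
  have hx : ‖x' - x‖ ≤ ‖(x', y') - (x, y)‖ := by
    exact norm_fst_le ((x', y') - (x, y))
  have hy : ‖y' - y‖ ≤ ‖(x', y') - (x, y)‖ := by
    exact norm_snd_le ((x', y') - (x, y))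
  have hball := hp'.2
  simp only [Metric.mem_ball, Prod.dist_eq, max_lt_iff] at hball
  simp only [add_apply, smul_apply,
    ContinuousLinearMap.coe_fst', ContinuousLinearMap.coe_snd', Prod.fst_sub, Prod.snd_sub,
    smul_eq_mul]
  rcases hcorner _ hp _ hp'.1 with h | h
  · have hq : (x', y) ∈ B := ⟨h, by simp [Prod.dist_eq, hball.1]⟩
    have a1 := horiz x x' y hpB hq
    have a2 := vert x' y y' hq hp'
    calc _ = ‖(f (x', y) - f (x, y) - fx (x, y) * (x' - x))
          + (f (x', y') - f (x', y) - fy (x, y) * (y' - y))‖ := by congr 1; ring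
      _ ≤ _ := norm_add_le _ _
      _ ≤ c / 2 * ‖x' - x‖ + c / 2 * ‖y' - y‖ := add_le_add a1 a2
      _ ≤ c / 2 * ‖(x', y') - (x, y)‖ + c / 2 * ‖(x', y') - (x, y)‖ := by gcongr
      _ = _ := by ring
  · have hq : (x, y') ∈ B := ⟨h, by simp [Prod.dist_eq, hball.2]⟩
    have a1 := horiz x x' y' hq hp'
    have a2 := vert x y y' hpB hq
    calc _ = ‖(f (x', y') - f (x, y') - fx (x, y) * (x' - x))
          + (f (x, y') - f (x, y) - fy (x, y) * (y' - y))‖ := by congr 1; ring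
      _ ≤ _ := norm_add_le _ _
      _ ≤ c / 2 * ‖x' - x‖ + c / 2 * ‖y' - y‖ := add_le_add a1 a2
      _ ≤ c / 2 * ‖(x', y') - (x, y)‖ + c / 2 * ‖(x', y') - (x, y)‖ := by gcongr
      _ = _ := by ring

/-! ### Volterra equations and integral identities -/

/-- The closed quadrant `x ≥ 0`, `η ≥ 0`. -/
def quadrant : Set (ℝ × ℝ) := Ici 0 ×ˢ Ici 0

theorem mem_quadrant {x y : ℝ} : (x, y) ∈ quadrant ↔ 0 ≤ x ∧ 0 ≤ y := Iff.rfl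

theorem convex_quadrant : Convex ℝ quadrant := (convex_Ici 0).prod (convex_Ici 0)

theorem uniqueDiffOn_quadrant : UniqueDiffOn ℝ quadrant :=
  (uniqueDiffOn_Ici 0).prod (uniqueDiffOn_Ici 0)

/-- The extension of a function on the quadrant to the plane by the nearest point of the quadrant;
it keeps continuity. -/
def clamp (f : ℝ → ℝ → ℝ) (x y : ℝ) : ℝ := f (max x 0) (max y 0)

theorem clamp_eq {f : ℝ → ℝ → ℝ} {x y : ℝ} (hx : 0 ≤ x) (hy : 0 ≤ y) : clamp f x y = f x y := by
  simp [clamp, hx, hy]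

theorem continuous_clamp {f : ℝ → ℝ → ℝ} (hf : ContinuousOn (Function.uncurry f) quadrant) :
    Continuous (Function.uncurry (clamp f)) :=
  hf.comp_continuous (f := fun z : ℝ × ℝ => (max z.1 0, max z.2 0)) (by fun_prop)
    fun _ => mem_quadrant.2 ⟨le_max_right _ _, le_max_right _ _⟩

/-- An abstract Volterra operator on continuous functions of `(x, η)`: it is additive, preserves
continuity, and on each triangle `x + η ≤ N` turns a bound `c ηⁿ` into `M c ηⁿ⁺¹ / (n + 1)`, so
that its iterates decay factorially. -/
structure IsVolterra (B : (ℝ → ℝ → ℝ) → ℝ → ℝ → ℝ) : Prop where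
  continuous : ∀ u, Continuous (Function.uncurry u) → Continuous (Function.uncurry (B u))
  sub : ∀ u v, Continuous (Function.uncurry u) → Continuous (Function.uncurry v) →
    ∀ x y, B (u - v) x y = B u x y - B v x y
  bound : ∀ N : ℝ, ∃ M : ℝ, 0 ≤ M ∧ ∀ u, Continuous (Function.uncurry u) → ∀ (n : ℕ) (c : ℝ),
    0 ≤ c → (∀ x y, 0 ≤ x → 0 ≤ y → x + y ≤ N → |u x y| ≤ c * y ^ n) →
    ∀ x y, 0 ≤ x → 0 ≤ y → x + y ≤ N → |B u x y| ≤ M * c * y ^ (n + 1) / (n + 1)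

theorem exists_bound_triangle {u : ℝ → ℝ → ℝ} (hu : Continuous (Function.uncurry u)) (N : ℝ) :
    ∃ C, 0 ≤ C ∧ ∀ x y, 0 ≤ x → 0 ≤ y → x + y ≤ N → |u x y| ≤ C := by
  obtain ⟨C, hC⟩ := (isCompact_Icc (a := ((0 : ℝ), (0 : ℝ)))
    (b := (N, N))).exists_bound_of_continuousOn hu.continuousOn
  refine ⟨max C 0, le_max_right _ _, fun x y hx hy hxy => (hC (x, y) ?_).trans (le_max_left _ _)⟩
  exact ⟨⟨hx, hy⟩, ⟨by simp; linarith, by simp; linarith⟩⟩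

namespace IsVolterra
variable {B : (ℝ → ℝ → ℝ) → ℝ → ℝ → ℝ}

/-- Factorial decay of the iterates. The recursion is required on the triangle only, which lets the
constant sequence of a fixed point be used as `d`. -/
theorem iterate_bound (hB : IsVolterra B) {d : ℕ → ℝ → ℝ → ℝ}
    (hd : ∀ n, Continuous (Function.uncurry (d n))) {N : ℝ}
    (hstep : ∀ n x y, 0 ≤ x → 0 ≤ y → x + y ≤ N → d (n + 1) x y = B (d n) x y) :
    ∃ C M : ℝ, 0 ≤ C ∧ 0 ≤ M ∧ ∀ n x y, 0 ≤ x → 0 ≤ y → x + y ≤ N →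
      |d n x y| ≤ C * ((M * N) ^ n / n.factorial) := by
  obtain ⟨C, hC0, hC⟩ := exists_bound_triangle (hd 0) N
  obtain ⟨M, hM0, hM⟩ := hB.bound N
  refine ⟨C, M, hC0, hM0, ?_⟩
  have key : ∀ n x y, 0 ≤ x → 0 ≤ y → x + y ≤ N →
      |d n x y| ≤ C * M ^ n / n.factorial * y ^ n := by
    intro n
    induction n with
    | zero => intro x y hx hy hxy; simpa using hC x y hx hy hxy
    | succ n ih =>
      intro x y hx hy hxy
      rw [hstep n x y hx hy hxy]
      refine (hM (d n) (hd n) n _ (by positivity) ih x y hx hy hxy).trans (le_of_eq ?_)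
      rw [Nat.factorial_succ]; push_cast; field_simp; ring
  intro n x y hx hy hxy
  refine (key n x y hx hy hxy).trans ?_
  have : y ^ n ≤ N ^ n := pow_le_pow_left₀ hy (by linarith) n
  calc _ ≤ C * M ^ n / n.factorial * N ^ n := by gcongr
    _ = _ := by rw [mul_pow]; ring

/-- Uniqueness for Volterra equations. -/
theorem eq_zero (hB : IsVolterra B) {u : ℝ → ℝ → ℝ} (hu : Continuous (Function.uncurry u)) {N : ℝ}
    (h : ∀ x y, 0 ≤ x → 0 ≤ y → x + y ≤ N → u x y = B u x y) {x y : ℝ} (hx : 0 ≤ x) (hy : 0 ≤ y)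
    (hxy : x + y ≤ N) : u x y = 0 := by
  obtain ⟨C, M, -, -, hb⟩ := hB.iterate_bound (d := fun _ => u) (fun _ => hu) (N := N)
    (fun _ => h)
  have h1 := (FloorSemiring.tendsto_pow_div_factorial_atTop (M * N)).const_mul C
  rw [mul_zero] at h1
  exact abs_nonpos_iff.1 (ge_of_tendsto' h1 fun n => hb n x y hx hy hxy)

/-- Volterra equations `u = u₀ + B u` are solvable by successive approximations. -/
theorem exists_solution (hB : IsVolterra B) {u₀ : ℝ → ℝ → ℝ}
    (hu₀ : Continuous (Function.uncurry u₀)) :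
    ∃ u : ℝ → ℝ → ℝ, Continuous (Function.uncurry u) ∧
      ∀ x y, 0 ≤ x → 0 ≤ y → u x y = u₀ x y + B u x y := by
  let S : ℕ → ℝ → ℝ → ℝ := fun n => Nat.rec u₀ (fun _ v => fun x y => u₀ x y + B v x y) n
  have hS0 : S 0 = u₀ := rfl
  have hSs : ∀ n, S (n + 1) = fun x y => u₀ x y + B (S n) x y := fun n => rfl
  have hSc : ∀ n, Continuous (Function.uncurry (S n)) := by
    intro n
    induction n with
    | zero => exact hu₀
    | succ n ih => rw [hSs]; exact hu₀.add (hB.continuous _ ih)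
  let d : ℕ → ℝ → ℝ → ℝ := fun n => S (n + 1) - S n
  have hdc : ∀ n, Continuous (Function.uncurry (d n)) := fun n => (hSc (n + 1)).sub (hSc n)
  have hdstep : ∀ n x y, d (n + 1) x y = B (d n) x y := by
    intro n x y
    have := hB.sub _ _ (hSc (n + 1)) (hSc n) x y
    simp only [d, Pi.sub_apply, hSs (n + 1)] at this ⊢
    rw [this, hSs n]
    simp
  have hsum : ∀ n x y, S n x y = u₀ x y + ∑ k ∈ Finset.range n, d k x y := by
    intro n x y
    have := Finset.sum_range_sub (fun k => S k x y) n
    simp only [d, Pi.sub_apply] at this ⊢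
    rw [this, hS0]; ring
  choose! C M hC0 hM0 hbd using fun N : ℝ =>
    hB.iterate_bound hdc (N := N) (fun n x y _ _ _ => hdstep n x y)
  have hsm : ∀ N : ℝ, Summable fun n : ℕ => C N * ((M N * N) ^ n / n.factorial) := fun N =>
    (Real.summable_pow_div_factorial _).mul_left _
  -- the series converges on the quadrant only; `clamp` makes the sum continuous on the plane
  let u : ℝ → ℝ → ℝ := clamp fun x y => u₀ x y + ∑' k, d k x y
  have huc : Continuous (Function.uncurry u) := by
    apply continuous_clamp
    refine hu₀.continuousOn.add ?_
    intro p hp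
    have hopen : IsOpen {z : ℝ × ℝ | z.1 + z.2 < p.1 + p.2 + 1} :=
      isOpen_lt (by fun_prop) (by fun_prop)
    have hcont : ContinuousOn (fun z : ℝ × ℝ => ∑' k, d k z.1 z.2)
        (quadrant ∩ {z : ℝ × ℝ | z.1 + z.2 < p.1 + p.2 + 1}) := by
      refine continuousOn_tsum (fun k => (hdc k).continuousOn) (hsm (p.1 + p.2 + 1)) ?_
      intro n z hz
      exact hbd _ n z.1 z.2 hz.1.1 hz.1.2 hz.2.le
    have := hcont p ⟨hp, by simp⟩
    exact (continuousWithinAt_inter (hopen.mem_nhds (by simp))).1 this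
  refine ⟨u, huc, fun x y hx hy => ?_⟩
  have hutail : ∀ n a b, 0 ≤ a → 0 ≤ b → a + b ≤ x + y →
      |(u - S n) a b| ≤
        ∑' k, C (x + y) * ((M (x + y) * (x + y)) ^ (k + n) / (k + n).factorial) := by
    intro n a b ha hb hab
    have hs : Summable fun k => d k a b :=
      Summable.of_norm_bounded (hsm (x + y)) fun k => hbd _ k a b ha hb hab
    have : (u - S n) a b = ∑' k, d (k + n) a b := by
      rw [Pi.sub_apply, Pi.sub_apply, hsum n a b]
      simp only [u, clamp_eq ha hb]
      rw [← hs.sum_add_tsum_nat_add n]; ring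
    rw [this]
    exact tsum_of_norm_bounded (f := fun k => d (k + n) a b)
      ((summable_nat_add_iff n).2 (hsm (x + y))).hasSum
      fun k => hbd _ (k + n) a b ha hb hab
  obtain ⟨K, hK0, hK⟩ := hB.bound (x + y)
  have ht0 := tendsto_sum_nat_add fun n => C (x + y) * ((M (x + y) * (x + y)) ^ n / n.factorial)
  have hlim1 : Tendsto (fun n => B (S n) x y) atTop (𝓝 (B u x y)) := by
    rw [tendsto_iff_norm_sub_tendsto_zero]
    have h2 := (ht0.const_mul K).mul_const y
    rw [mul_zero, zero_mul] at h2
    refine squeeze_zero (fun _ => norm_nonneg _) (fun n => ?_) h2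
    have h3 := hK (u - S n) (huc.sub (hSc n)) 0 _ ((abs_nonneg _).trans (hutail n x y hx hy le_rfl))
      (fun a b ha hb hab => by simpa using hutail n a b ha hb hab) x y hx hy le_rfl
    rw [hB.sub _ _ huc (hSc n)] at h3
    rw [norm_sub_rev, Real.norm_eq_abs]
    simpa using h3
  have hlim2 : Tendsto (fun n => S (n + 1) x y) atTop (𝓝 (u x y)) := by
    have h4 : Tendsto (fun n => S n x y) atTop (𝓝 (u x y)) := by
      rw [tendsto_iff_norm_sub_tendsto_zero]
      refine squeeze_zero (fun _ => norm_nonneg _) (fun n => ?_) ht0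
      rw [norm_sub_rev]
      exact hutail n x y hx hy le_rfl
    exact (tendsto_add_atTop_iff_nat 1).2 h4
  have hlim3 : Tendsto (fun n => S (n + 1) x y) atTop (𝓝 (u₀ x y + B u x y)) := by
    simp only [hSs]
    exact hlim1.const_add _
  exact tendsto_nhds_unique hlim2 hlim3

end IsVolterra

/-- Fubini's theorem on the triangle `0 ≤ s ≤ t ≤ T`. -/
theorem integral_triangle_swap {T : ℝ} (hT : 0 ≤ T) {f : ℝ → ℝ → ℝ}
    (hf : Integrable (Function.uncurry f)
      ((volume.restrict (Ioc 0 T)).prod (volume.restrict (Ioc 0 T)))) :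
    ∫ t in (0 : ℝ)..T, ∫ s in (0 : ℝ)..t, f t s = ∫ s in (0 : ℝ)..T, ∫ t in s..T, f t s := by
  have hm : MeasurableSet {z : ℝ × ℝ | z.2 ≤ z.1} := measurableSet_le measurable_snd measurable_fst
  have hg := hf.indicator hm
  have hsw := integral_integral_swap (f := fun t s => if s ≤ t then f t s else 0)
    (μ := volume.restrict (Ioc 0 T)) (ν := volume.restrict (Ioc 0 T)) (hg.congr
      (Eventually.of_forall fun z => by simp [indicator, Function.uncurry]))
  rw [intervalIntegral.integral_of_le hT, intervalIntegral.integral_of_le hT]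
  have e1 : ∀ t ∈ Ioc 0 T, ∫ s in (0 : ℝ)..t, f t s
      = ∫ s in Ioc 0 T, if s ≤ t then f t s else 0 := by
    intro t ht
    rw [intervalIntegral.integral_of_le ht.1.le]
    have : (fun s => if s ≤ t then f t s else 0) = (Iic t).indicator (f t) := by
      ext s; simp [indicator]
    rw [this, setIntegral_indicator measurableSet_Iic]
    congr 2
    ext s; simp only [mem_Ioc, mem_inter_iff, mem_Iic]
    constructor
    · rintro ⟨a, b⟩; exact ⟨⟨a, b.trans ht.2⟩, b⟩
    · rintro ⟨⟨a, _⟩, b⟩; exact ⟨a, b⟩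
  have e2 : ∀ s ∈ Ioc 0 T, ∫ t in s..T, f t s
      = ∫ t in Ioc 0 T, if s ≤ t then f t s else 0 := by
    intro s hs
    rw [intervalIntegral.integral_of_le hs.2, ← integral_Icc_eq_integral_Ioc]
    have : (fun t => if s ≤ t then f t s else 0) = (Ici s).indicator (fun t => f t s) := by
      ext t; simp [indicator]
    rw [this, setIntegral_indicator measurableSet_Ici]
    congr 2
    ext t; simp only [mem_Ioc, mem_Icc, mem_inter_iff, mem_Ici]
    constructor
    · rintro ⟨a, b⟩; exact ⟨⟨hs.1.trans_le a, b⟩, a⟩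
    · rintro ⟨⟨_, b⟩, a⟩; exact ⟨a, b⟩
  rw [setIntegral_congr_fun measurableSet_Ioc e1, setIntegral_congr_fun measurableSet_Ioc e2]
  exact hsw

theorem integrable_prod_of_continuous {f : ℝ → ℝ → ℝ} (hf : Continuous (Function.uncurry f))
    (T : ℝ) : Integrable (Function.uncurry f)
      ((volume.restrict (Ioc 0 T)).prod (volume.restrict (Ioc 0 T))) := by
  rw [Measure.prod_restrict]
  refine (hf.continuousOn.integrableOn_compact (K := Icc 0 T ×ˢ Icc 0 T)
    (isCompact_Icc.prod isCompact_Icc)).mono_set ?_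
  exact prod_mono Ioc_subset_Icc_self Ioc_subset_Icc_self

/-- Integrals of a continuous function depend continuously on parameters and both end points. -/
theorem continuous_integral_endpoints {E : Type*} [TopologicalSpace E]
    [FirstCountableTopology E] {f : E → ℝ → ℝ}
    (hf : Continuous (Function.uncurry f)) {a b : E → ℝ} (ha : Continuous a) (hb : Continuous b) :
    Continuous fun p => ∫ s in a p..b p, f p s := by
  have h1 := intervalIntegral.continuous_parametric_intervalIntegral_of_continuous (μ := volume)
    (a₀ := 0) hf hb
  have h2 := intervalIntegral.continuous_parametric_intervalIntegral_of_continuous (μ := volume)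
    (a₀ := 0) hf ha
  refine (h1.sub h2).congr fun p => ?_
  have hp : Continuous (f p) := by fun_prop
  exact intervalIntegral.integral_interval_sub_left (hp.intervalIntegrable _ _)
    (hp.intervalIntegrable _ _)

theorem integral_triangle_swap_of_continuous {f : ℝ → ℝ → ℝ} (hf : Continuous (Function.uncurry f))
    {a b : ℝ} (hab : a ≤ b) :
    ∫ t in a..b, ∫ s in a..t, f t s = ∫ s in a..b, ∫ t in s..b, f t s := by
  have hc : Continuous (Function.uncurry fun t s => f (t + a) (s + a)) := by
    unfold Function.uncurry; fun_prop
  have h := integral_triangle_swap (T := b - a) (by linarith) (integrable_prod_of_continuous hc _)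
  have e1 : ∀ t, ∫ s in (0 : ℝ)..t, f (t + a) (s + a) = ∫ s in a..t + a, f (t + a) s := fun t => by
    rw [intervalIntegral.integral_comp_add_right (fun s => f (t + a) s), zero_add]
  have e2 : ∀ s, ∫ t in s..b - a, f (t + a) (s + a) = ∫ t in s + a..b, f t (s + a) := fun s => by
    rw [intervalIntegral.integral_comp_add_right (fun t => f t (s + a)), sub_add_cancel]
  simp only [e1, e2] at h
  rw [intervalIntegral.integral_comp_add_right (fun t => ∫ s in a..t, f t s),
    intervalIntegral.integral_comp_add_right (fun s => ∫ t in s..b, f t s)] at h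
  simpa using h

theorem integral_rectangle_swap_of_continuous {f : ℝ → ℝ → ℝ}
    (hf : Continuous (Function.uncurry f)) {a b c d : ℝ} (hab : a ≤ b) (hcd : c ≤ d) :
    ∫ x in a..b, ∫ t in c..d, f x t = ∫ t in c..d, ∫ x in a..b, f x t := by
  have h : Integrable (Function.uncurry f)
      ((volume.restrict (Ioc a b)).prod (volume.restrict (Ioc c d))) := by
    rw [Measure.prod_restrict]
    refine (hf.continuousOn.integrableOn_compact (K := Icc a b ×ˢ Icc c d)
      (isCompact_Icc.prod isCompact_Icc)).mono_set ?_
    exact prod_mono Ioc_subset_Icc_self Ioc_subset_Icc_self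
  simp only [intervalIntegral.integral_of_le hab, intervalIntegral.integral_of_le hcd]
  exact integral_integral_swap h

theorem eq_add_integral_of_hasDerivAt {f f' : ℝ → ℝ} {a b : ℝ} (hab : a ≤ b)
    (hf : ContinuousOn f (Icc a b)) (hd : ∀ x ∈ Ioo a b, HasDerivAt f (f' x) x)
    (hf' : ContinuousOn f' (Icc a b)) : f b = f a + ∫ x in a..b, f' x := by
  rw [intervalIntegral.integral_eq_sub_of_hasDerivAt_of_le hab hf hd
    (hf'.intervalIntegrable_of_Icc hab)]
  ring

/-- Leibniz' rule for `∫₀ᵗ H(y, t) dy`, in integrated form: `d(y) = H(y, y)`, and `H'` is the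
derivative of `H` in the second variable. -/
theorem integral_leibniz {d : ℝ → ℝ} {H' H : ℝ → ℝ → ℝ} {t : ℝ} (ht : 0 ≤ t) (hd : Continuous d)
    (hH' : Continuous (Function.uncurry H'))
    (hH : ∀ y, 0 ≤ y → y ≤ t → H y t = d y + ∫ σ in y..t, H' y σ) :
    ∫ y in (0 : ℝ)..t, H y t = ∫ σ in (0 : ℝ)..t, (d σ + ∫ y in (0 : ℝ)..σ, H' y σ) := by
  have hc : Continuous fun σ => ∫ y in (0 : ℝ)..σ, H' y σ :=
    intervalIntegral.continuous_parametric_intervalIntegral_of_continuous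
      (f := fun σ y => H' y σ) (hH'.comp continuous_swap) continuous_id
  have hc2 : Continuous fun y => ∫ σ in y..t, H' y σ := by
    have : Continuous fun y => ∫ σ in t..y, H' y σ :=
      intervalIntegral.continuous_parametric_intervalIntegral_of_continuous
        (f := H') hH' continuous_id
    have h := this.neg
    refine h.congr fun y => ?_
    exact (intervalIntegral.integral_symm t y).symm
  rw [intervalIntegral.integral_add (hd.intervalIntegrable _ _) (hc.intervalIntegrable _ _),
    integral_triangle_swap (f := fun σ y => H' y σ) ht
      (integrable_prod_of_continuous (f := fun σ y => H' y σ) (hH'.comp continuous_swap) t),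
    ← intervalIntegral.integral_add (hd.intervalIntegrable _ _) (hc2.intervalIntegrable _ _)]
  refine intervalIntegral.integral_congr fun y hy => ?_
  rw [uIcc_of_le ht] at hy
  exact hH y hy.1 hy.2

/-- The fundamental lemma of the calculus of variations, for convolutions. -/
theorem eq_zero_of_forall_integral_conv {m : ℝ → ℝ} {z : ℝ} (hz : 0 < z)
    (hm : ContinuousOn m (Icc 0 z))
    (h : ∀ f : ℝ → ℝ, ContDiff ℝ ∞ f → HasCompactSupport f → tsupport f ⊆ Ioo 0 z →
      ∫ η in (0 : ℝ)..z, m η * f (z - η) = 0) : ∀ η ∈ Icc 0 z, m η = 0 := by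
  have hae : ∀ᵐ x ∂volume, x ∈ Ioo 0 z → m x = 0 := by
    refine isOpen_Ioo.ae_eq_zero_of_integral_contDiff_smul_eq_zero
      ((hm.mono Ioo_subset_Icc_self).locallyIntegrableOn measurableSet_Ioo) fun g hg hgc hgs => ?_
    have hg' := h (fun t => g (z - t)) (hg.comp (by fun_prop))
      (hgc.comp_homeomorph (Homeomorph.subLeft z)) ?_
    · simp only [sub_sub_cancel] at hg'
      rw [intervalIntegral.integral_of_le hz.le] at hg'
      rw [← setIntegral_eq_integral_of_forall_compl_eq_zero (s := Ioc 0 z)]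
      · simpa only [smul_eq_mul, mul_comm] using hg'
      · intro x hx
        have : x ∉ tsupport g := fun h' => hx (Ioo_subset_Ioc_self (hgs h'))
        simp [image_eq_zero_of_notMem_tsupport this]
    · intro t ht
      have h1 : z - t ∈ tsupport g := by
        have := tsupport_comp_subset_preimage g (f := fun t => z - t) (by fun_prop)
        exact this ht
      have := hgs h1
      exact ⟨by linarith [this.2], by linarith [this.1]⟩
  have hIoo : EqOn m 0 (Ioo 0 z) := by
    refine Measure.eqOn_open_of_ae_eq (μ := volume) ?_ isOpen_Ioo
      (hm.mono Ioo_subset_Icc_self) continuousOn_const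
    rw [EventuallyEq, ae_restrict_iff' measurableSet_Ioo]
    exact hae
  have := hIoo.of_subset_closure hm continuousOn_const Ioo_subset_Icc_self
    (by rw [closure_Ioo hz.ne])
  exact this

/-! ### Smooth functions on the quadrant and integrals along characteristics -/

theorem hasDerivWithinAt_intervalIntegral_param {S : Set ℝ} (hS : Convex ℝ S) {a b : ℝ}
    (hab : a ≤ b) {H D : ℝ → ℝ → ℝ}
    (hH : ContinuousOn (Function.uncurry H) (S ×ˢ Icc a b))
    (hD : ContinuousOn (Function.uncurry D) (S ×ˢ Icc a b))
    (hHD : ∀ p ∈ S, ∀ s ∈ Icc a b, HasDerivWithinAt (fun p => H p s) (D p s) S p)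
    {p : ℝ} (hp : p ∈ S) :
    HasDerivWithinAt (fun p => ∫ s in a..b, H p s) (∫ s in a..b, D p s) S p := by
  let L : ℝ →L[ℝ] ℝ →L[ℝ] ℝ := ContinuousLinearMap.smulRightL ℝ ℝ ℝ 1
  have h := hasFDerivWithinAt_intervalIntegral_param hS hab (D := fun p s => L (D p s)) hH
    (L.continuous.comp_continuousOn hD) (fun p hp s hs => (hHD p hp s hs).hasFDerivWithinAt) hp
  have hi : IntervalIntegrable (D p) volume a b := ContinuousOn.intervalIntegrable_of_Icc hab
    (hD.comp (f := fun s => (p, s)) (by fun_prop) fun s hs => ⟨hp, hs⟩)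
  rw [hasDerivWithinAt_iff_hasFDerivWithinAt]
  refine h.congr_fderiv ?_
  rw [ContinuousLinearMap.intervalIntegral_comp_comm L hi]
  ext; simp [L]

/-- The partial derivative in the first variable, one-sided at `0`. -/
def dx (f : ℝ → ℝ → ℝ) (x y : ℝ) : ℝ := derivWithin (fun z => f z y) (Ici 0) x

/-- The partial derivative in the second variable, one-sided at `0`. -/
def dy (f : ℝ → ℝ → ℝ) (x y : ℝ) : ℝ := derivWithin (fun z => f x z) (Ici 0) y

theorem hasDerivWithinAt_fst {f : ℝ → ℝ → ℝ} {f' : ℝ × ℝ →L[ℝ] ℝ} {x y : ℝ}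
    (hf : HasFDerivWithinAt (Function.uncurry f) f' quadrant (x, y)) (hy : 0 ≤ y) :
    HasDerivWithinAt (fun z => f z y) (f' (1, 0)) (Ici 0) x :=
  hf.comp_hasDerivWithinAt (f := fun z => (z, y)) x
    ((hasDerivAt_id x).prodMk (hasDerivAt_const x y)).hasDerivWithinAt fun _ hz => ⟨hz, hy⟩

theorem hasDerivWithinAt_snd {f : ℝ → ℝ → ℝ} {f' : ℝ × ℝ →L[ℝ] ℝ} {x y : ℝ}
    (hf : HasFDerivWithinAt (Function.uncurry f) f' quadrant (x, y)) (hx : 0 ≤ x) :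
    HasDerivWithinAt (fun z => f x z) (f' (0, 1)) (Ici 0) y :=
  hf.comp_hasDerivWithinAt (f := fun z => (x, z)) y
    ((hasDerivAt_const y x).prodMk (hasDerivAt_id y)).hasDerivWithinAt fun _ hz => ⟨hx, hz⟩

section Smooth
variable {f : ℝ → ℝ → ℝ} (hf : ContDiffOn ℝ ∞ (Function.uncurry f) quadrant)
include hf

theorem hasFDerivWithinAt_quadrant {p : ℝ × ℝ} (hp : p ∈ quadrant) :
    HasFDerivWithinAt (Function.uncurry f) (fderivWithin ℝ (Function.uncurry f) quadrant p)
      quadrant p :=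
  (hf.differentiableOn (by simp) p hp).hasFDerivWithinAt

theorem dx_eq {x y : ℝ} (hx : 0 ≤ x) (hy : 0 ≤ y) :
    dx f x y = fderivWithin ℝ (Function.uncurry f) quadrant (x, y) (1, 0) :=
  (hasDerivWithinAt_fst (hasFDerivWithinAt_quadrant hf ⟨hx, hy⟩) hy).derivWithin
    (uniqueDiffOn_Ici 0 x hx)

theorem dy_eq {x y : ℝ} (hx : 0 ≤ x) (hy : 0 ≤ y) :
    dy f x y = fderivWithin ℝ (Function.uncurry f) quadrant (x, y) (0, 1) :=
  (hasDerivWithinAt_snd (hasFDerivWithinAt_quadrant hf ⟨hx, hy⟩) hx).derivWithin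
    (uniqueDiffOn_Ici 0 y hy)

theorem hasDerivWithinAt_dx {x y : ℝ} (hx : 0 ≤ x) (hy : 0 ≤ y) :
    HasDerivWithinAt (fun z => f z y) (dx f x y) (Ici 0) x := by
  rw [dx_eq hf hx hy]
  exact hasDerivWithinAt_fst (hasFDerivWithinAt_quadrant hf ⟨hx, hy⟩) hy

theorem hasDerivWithinAt_dy {x y : ℝ} (hx : 0 ≤ x) (hy : 0 ≤ y) :
    HasDerivWithinAt (fun z => f x z) (dy f x y) (Ici 0) y := by
  rw [dy_eq hf hx hy]
  exact hasDerivWithinAt_snd (hasFDerivWithinAt_quadrant hf ⟨hx, hy⟩) hx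

theorem hasDerivAt_dx {x y : ℝ} (hx : 0 < x) (hy : 0 ≤ y) :
    HasDerivAt (fun z => f z y) (dx f x y) x :=
  (hasDerivWithinAt_dx hf hx.le hy).hasDerivAt (Ici_mem_nhds hx)

theorem hasDerivAt_dy {x y : ℝ} (hx : 0 ≤ x) (hy : 0 < y) :
    HasDerivAt (fun z => f x z) (dy f x y) y :=
  (hasDerivWithinAt_dy hf hx hy.le).hasDerivAt (Ici_mem_nhds hy)

theorem contDiffOn_dx : ContDiffOn ℝ ∞ (Function.uncurry (dx f)) quadrant :=
  ((hf.fderivWithin (m := ∞) uniqueDiffOn_quadrant (by simp)).clm_apply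
    (contDiffOn_const (c := ((1 : ℝ), (0 : ℝ))))).congr
    fun p hp => dx_eq hf hp.1 hp.2

theorem contDiffOn_dy : ContDiffOn ℝ ∞ (Function.uncurry (dy f)) quadrant :=
  ((hf.fderivWithin (m := ∞) uniqueDiffOn_quadrant (by simp)).clm_apply
    (contDiffOn_const (c := ((0 : ℝ), (1 : ℝ))))).congr
    fun p hp => dy_eq hf hp.1 hp.2

/-- The chain rule along a curve, at an interior point of the quadrant. -/
theorem hasDerivAt_comp_curve {α β : ℝ → ℝ} {α' β' s : ℝ} (hα : HasDerivAt α α' s)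
    (hβ : HasDerivAt β β' s) (hα0 : 0 < α s) (hβ0 : 0 < β s) :
    HasDerivAt (fun s => f (α s) (β s)) (dx f (α s) (β s) * α' + dy f (α s) (β s) * β') s := by
  have hmem : quadrant ∈ 𝓝 (α s, β s) := prod_mem_nhds (Ici_mem_nhds hα0) (Ici_mem_nhds hβ0)
  have h1 := (hasFDerivWithinAt_quadrant hf (p := (α s, β s)) ⟨hα0.le, hβ0.le⟩).hasFDerivAt hmem
  have h2 := h1.comp_hasDerivAt (f := fun s => (α s, β s)) s (hα.prodMk hβ)
  refine h2.congr_deriv ?_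
  rw [dx_eq hf hα0.le hβ0.le, dy_eq hf hα0.le hβ0.le]
  have : (α', β') = α' • ((1 : ℝ), (0 : ℝ)) + β' • ((0 : ℝ), (1 : ℝ)) := by ext <;> simp
  rw [this, map_add, map_smul, map_smul]
  simp [mul_comm]

end Smooth

theorem contDiffOn_succ_of_partial {n : ℕ} {f fx fy : ℝ → ℝ → ℝ}
    (hfx : ContDiffOn ℝ n (Function.uncurry fx) quadrant)
    (hfy : ContDiffOn ℝ n (Function.uncurry fy) quadrant)
    (h1 : ∀ x y, 0 ≤ x → 0 ≤ y → HasDerivWithinAt (fun z => f z y) (fx x y) (Ici 0) x)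
    (h2 : ∀ x y, 0 ≤ x → 0 ≤ y → HasDerivWithinAt (fun z => f x z) (fy x y) (Ici 0) y) :
    ContDiffOn ℝ (n + 1) (Function.uncurry f) quadrant := by
  rw [contDiffOn_succ_iff_hasFDerivWithinAt_of_uniqueDiffOn uniqueDiffOn_quadrant]
  refine ⟨by simp, fun p => Function.uncurry fx p • ContinuousLinearMap.fst ℝ ℝ ℝ
      + Function.uncurry fy p • ContinuousLinearMap.snd ℝ ℝ ℝ, ?_, ?_⟩
  · exact (hfx.smul contDiffOn_const).add (hfy.smul contDiffOn_const)
  · intro p hp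
    refine hasFDerivWithinAt_of_partial convex_quadrant
      (fun p hp p' hp' => Or.inl ⟨hp'.1, hp.2⟩) hfx.continuousOn hfy.continuousOn
      (fun p hp => ?_) (fun p hp => ?_) hp
    · exact (h1 p.1 p.2 hp.1 hp.2).mono fun z hz => hz.1
    · exact (h2 p.1 p.2 hp.1 hp.2).mono fun z hz => hz.2

/-- The integral along the characteristic `2x + η = const` down to the axis `η = 0`. -/
def charIntegral (h : ℝ → ℝ → ℝ) (x y : ℝ) : ℝ := ∫ θ in (0 : ℝ)..y, h (x + (y - θ) / 2) θ

/-- The integral over a fixed interval, for differentiation in the parameters. -/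
theorem charIntegral_eq_smul (h : ℝ → ℝ → ℝ) (x y : ℝ) :
    charIntegral h x y = y * ∫ s in (0 : ℝ)..1, h (x + (y - y * s) / 2) (y * s) := by
  rw [charIntegral, intervalIntegral.mul_integral_comp_mul_left
    (f := fun θ => h (x + (y - θ) / 2) θ)]
  simp

theorem contDiffOn_charIntegral {n : ℕ} {h : ℝ → ℝ → ℝ}
    (hh : ContDiffOn ℝ n (Function.uncurry h) quadrant) :
    ContDiffOn ℝ n (Function.uncurry (charIntegral h)) quadrant := by
  have h1 : ContDiffOn ℝ n
      (Function.uncurry fun (p : ℝ × ℝ) (s : ℝ) => h (p.1 + (p.2 - p.2 * s) / 2) (p.2 * s))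
      (quadrant ×ˢ Icc (0 : ℝ) 1) := by
    refine hh.comp (f := fun z : (ℝ × ℝ) × ℝ =>
      (z.1.1 + (z.1.2 - z.1.2 * z.2) / 2, z.1.2 * z.2)) (by fun_prop) ?_
    rintro ⟨⟨x, y⟩, s⟩ ⟨⟨hx, hy⟩, hs0, hs1⟩
    simp only [mem_Ici] at hx hy hs0 hs1
    refine mem_quadrant.2 ⟨?_, by positivity⟩
    have : y * s ≤ y := mul_le_of_le_one_right hy hs1
    simp only; linarith
  refine (contDiffOn_snd.mul (contDiffOn_nat_intervalIntegral_param convex_quadrant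
    uniqueDiffOn_quadrant zero_lt_one n h1)).congr fun p _ => charIntegral_eq_smul h p.1 p.2

theorem contDiffOn_integral_fst {n : ℕ} {g : ℝ → ℝ → ℝ}
    (hg : ContDiffOn ℝ n (Function.uncurry g) quadrant) :
    ContDiffOn ℝ n (Function.uncurry fun x y => ∫ a in (0 : ℝ)..x, g a y) quadrant := by
  have h1 : ContDiffOn ℝ n
      (Function.uncurry fun (p : ℝ × ℝ) (s : ℝ) => g (p.1 * s) p.2)
      (quadrant ×ˢ Icc (0 : ℝ) 1) := by
    refine hg.comp (f := fun z : (ℝ × ℝ) × ℝ => (z.1.1 * z.2, z.1.2)) (by fun_prop) ?_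
    rintro ⟨⟨x, y⟩, s⟩ ⟨⟨hx, hy⟩, hs0, hs1⟩
    simp only [mem_Ici] at hx hy hs0 hs1
    exact mem_quadrant.2 ⟨by positivity, hy⟩
  refine (contDiffOn_fst.mul (contDiffOn_nat_intervalIntegral_param convex_quadrant
    uniqueDiffOn_quadrant zero_lt_one n h1)).congr fun p _ => ?_
  simp only [Function.uncurry]
  rw [intervalIntegral.mul_integral_comp_mul_left (f := fun a => g a p.2)]
  simp

theorem continuousOn_comp_char {h : ℝ → ℝ → ℝ} (hh : ContinuousOn (Function.uncurry h) quadrant)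
    (y : ℝ) : ContinuousOn (Function.uncurry fun p s => h (p + (y - s) / 2) s)
      (Ici 0 ×ˢ Icc 0 y) := by
  refine hh.comp (f := fun z : ℝ × ℝ => (z.1 + (y - z.2) / 2, z.2)) (by fun_prop) ?_
  rintro ⟨x, s⟩ ⟨hx, hs0, hs1⟩
  simp only [mem_Ici] at hx hs0 hs1
  exact mem_quadrant.2 ⟨by simp only; linarith, hs0⟩

theorem hasDerivWithinAt_charIntegral_fst {h hx : ℝ → ℝ → ℝ}
    (hh : ContinuousOn (Function.uncurry h) quadrant)
    (hhx : ContinuousOn (Function.uncurry hx) quadrant)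
    (hd : ∀ x y, 0 ≤ x → 0 ≤ y → HasDerivWithinAt (fun z => h z y) (hx x y) (Ici 0) x)
    {x y : ℝ} (hx0 : 0 ≤ x) (hy0 : 0 ≤ y) :
    HasDerivWithinAt (fun z => charIntegral h z y) (charIntegral hx x y) (Ici 0) x := by
  refine hasDerivWithinAt_intervalIntegral_param (convex_Ici 0) hy0
    (continuousOn_comp_char hh y) (continuousOn_comp_char hhx y) (fun p hp s hs => ?_) hx0
  have h1 : 0 ≤ (y - s) / 2 := by linarith [hs.2]
  have h2 : 0 ≤ p := hp
  have := (hd (p + (y - s) / 2) s (by linarith) hs.1).comp p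
    ((hasDerivWithinAt_id p (Ici 0)).add_const ((y - s) / 2))
    (fun z (hz : 0 ≤ z) => (by simp only [id, mem_Ici]; linarith))
  exact this.congr_deriv (mul_one _)

theorem hasDerivWithinAt_charIntegral_snd {h hx : ℝ → ℝ → ℝ}
    (hh : ContinuousOn (Function.uncurry h) quadrant)
    (hhx : ContinuousOn (Function.uncurry hx) quadrant)
    (hd : ∀ x y, 0 ≤ x → 0 ≤ y → HasDerivWithinAt (fun z => h z y) (hx x y) (Ici 0) x)
    {x y : ℝ} (hx0 : 0 ≤ x) (hy0 : 0 ≤ y) :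
    HasDerivWithinAt (fun z => charIntegral h x z) (h x y + charIntegral hx x y / 2) (Ici 0) y := by
  have hc := continuous_clamp hh
  -- `clamp` provides continuity on the line, without changing values for `y ≥ 0`
  have hcx := continuous_clamp hhx
  set D : ℝ → ℝ := fun σ => clamp h x σ
    + ∫ θ in (0 : ℝ)..σ, clamp hx (x + (σ - θ) / 2) θ / 2 with hD
  have hDc : Continuous D := by
    refine Continuous.add (hc.comp (f := fun σ => (x, σ)) (by fun_prop)) ?_
    refine intervalIntegral.continuous_parametric_intervalIntegral_of_continuous
      (f := fun σ θ => clamp hx (x + (σ - θ) / 2) θ / 2) ?_ continuous_id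
    exact (hcx.comp (f := fun z : ℝ × ℝ => (x + (z.1 - z.2) / 2, z.2)) (by fun_prop)).div_const 2
  have hint : ∀ t, 0 ≤ t → charIntegral h x t = ∫ σ in (0 : ℝ)..t, D σ := by
    intro t ht
    refine integral_leibniz (H := fun θ t => h (x + (t - θ) / 2) θ)
      (H' := fun θ σ => clamp hx (x + (σ - θ) / 2) θ / 2) ht
      (hc.comp (f := fun σ => (x, σ)) (by fun_prop))
      ((hcx.comp (f := fun z : ℝ × ℝ => (x + (z.2 - z.1) / 2, z.1)) (by fun_prop)).div_const 2) ?_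
    intro θ hθ hθt
    have := intervalIntegral.integral_eq_sub_of_hasDerivAt_of_le hθt
      (f := fun σ => h (x + (σ - θ) / 2) θ)
      (f' := fun σ => clamp hx (x + (σ - θ) / 2) θ / 2) ?_ ?_ ?_
    · rw [this, clamp_eq hx0 hθ]; simp
    · refine hh.comp (f := fun σ => (x + (σ - θ) / 2, θ)) (by fun_prop) fun σ hσ => ?_
      exact mem_quadrant.2 ⟨by linarith [hσ.1], hθ⟩
    · intro σ hσ
      have hp : 0 < x + (σ - θ) / 2 := by linarith [hσ.1]
      have h1 := (hd (x + (σ - θ) / 2) θ hp.le hθ).hasDerivAt (Ici_mem_nhds hp)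
      have h2 : HasDerivAt (fun σ => x + (σ - θ) / 2) (1 / 2) σ :=
        (((hasDerivAt_id σ).sub_const θ).div_const 2).const_add x
      have := h1.comp σ h2
      rw [clamp_eq hp.le hθ]
      exact this.congr_deriv (by ring)
    · exact ((hcx.comp (f := fun σ : ℝ => (x + (σ - θ) / 2, θ))
        (by fun_prop)).div_const 2).intervalIntegrable _ _
  have hder : HasDerivWithinAt (fun z => ∫ σ in (0 : ℝ)..z, D σ) (D y) (Ici 0) y :=
    (hDc.integral_hasStrictDerivAt 0 y).hasDerivAt.hasDerivWithinAt
  refine (hder.congr (fun z hz => hint z hz) (hint y hy0)).congr_deriv ?_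
  simp only [hD, clamp_eq hx0 hy0, charIntegral]
  rw [← intervalIntegral.integral_div]
  congr 1
  refine intervalIntegral.integral_congr fun θ hθ => ?_
  rw [uIcc_of_le hy0] at hθ
  rw [clamp_eq (by linarith [hθ.2]) hθ.1]

/-- Integration along characteristics gains one derivative: by `hasDerivWithinAt_charIntegral_snd`,
both partial derivatives are expressed by `h` and the integral of `h_x`. -/
theorem contDiffOn_succ_charIntegral {n : ℕ} {h hx : ℝ → ℝ → ℝ}
    (hh : ContDiffOn ℝ n (Function.uncurry h) quadrant)
    (hhx : ContDiffOn ℝ n (Function.uncurry hx) quadrant)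
    (hd : ∀ x y, 0 ≤ x → 0 ≤ y → HasDerivWithinAt (fun z => h z y) (hx x y) (Ici 0) x) :
    ContDiffOn ℝ (n + 1) (Function.uncurry (charIntegral h)) quadrant :=
  contDiffOn_succ_of_partial (contDiffOn_charIntegral hhx)
    (fy := fun x y => h x y + charIntegral hx x y / 2)
    (hh.add ((contDiffOn_charIntegral hhx).div_const 2))
    (fun _ _ => hasDerivWithinAt_charIntegral_fst hh.continuousOn hhx.continuousOn hd)
    (fun _ _ => hasDerivWithinAt_charIntegral_snd hh.continuousOn hhx.continuousOn hd)

/-! ### The characteristic problem for the regular part -/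

/-- The characteristic problem for the regular part of the fundamental solution of `u_tt - u_xx + Q
u = 0`, in the coordinates `(x, η)`, `η = t - x`, on the closed quadrant. -/
structure IsGoursat (Q : ℝ → ℝ) (k : ℝ → ℝ → ℝ) : Prop where
  smooth : ContDiffOn ℝ ∞ (Function.uncurry k) quadrant
  boundary : ∀ y, 0 ≤ y → k 0 y = 0
  initial : ∀ x, 0 < x → 2 * dx k x 0 = -Q x
  pde : ∀ x y, 0 < x → 0 < y → 2 * dy (dx k) x y - dx (dx k) x y + Q x * k x y = 0

theorem abs_integral_le_of_le_pow {F : ℝ → ℝ} {C y : ℝ} {n : ℕ} (hy : 0 ≤ y)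
    (h : ∀ θ, 0 ≤ θ → θ ≤ y → |F θ| ≤ C * θ ^ n) :
    |∫ θ in (0 : ℝ)..y, F θ| ≤ C * y ^ (n + 1) / (n + 1) := by
  have h1 := intervalIntegral.norm_integral_le_of_norm_le (f := F) (g := fun θ => C * θ ^ n)
    (μ := volume) hy (Eventually.of_forall fun θ hθ => h θ hθ.1.le hθ.2)
    ((by fun_prop : Continuous fun θ : ℝ => C * θ ^ n).intervalIntegrable _ _)
  rw [intervalIntegral.integral_const_mul, integral_pow] at h1
  refine h1.trans (le_of_eq ?_)
  simp; ring

theorem continuous_integral_fst {u : ℝ → ℝ → ℝ} (hu : Continuous (Function.uncurry u)) :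
    Continuous (Function.uncurry fun x y => ∫ a in (0 : ℝ)..x, u a y) :=
  intervalIntegral.continuous_parametric_intervalIntegral_of_continuous
    (f := fun (p : ℝ × ℝ) a => u a p.2)
    (hu.comp (f := fun z : (ℝ × ℝ) × ℝ => (z.2, z.1.2)) (by fun_prop)) continuous_fst

theorem continuous_charIntegral {h : ℝ → ℝ → ℝ} (hh : Continuous (Function.uncurry h)) :
    Continuous (Function.uncurry (charIntegral h)) :=
  intervalIntegral.continuous_parametric_intervalIntegral_of_continuous
    (f := fun (p : ℝ × ℝ) θ => h (p.1 + (p.2 - θ) / 2) θ)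
    (hh.comp (f := fun z : (ℝ × ℝ) × ℝ => (z.1.1 + (z.1.2 - z.2) / 2, z.2)) (by fun_prop))
    continuous_snd

/-- The operator of the integral equation for `g = k_x`: the equation `2 g_η - g_x = -Q k` is
integrated along the characteristics, with `P = -Q / 2` and `k(x, η) = ∫₀ˣ g(·, η)`. -/
def goursatOp (P : ℝ → ℝ) (u : ℝ → ℝ → ℝ) : ℝ → ℝ → ℝ :=
  charIntegral fun x y => P x * ∫ a in (0 : ℝ)..x, u a y

theorem isVolterra_goursatOp {P : ℝ → ℝ} (hP : Continuous P) : IsVolterra (goursatOp P) where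
  continuous u hu := continuous_charIntegral
    ((hP.comp continuous_fst).mul (continuous_integral_fst hu))
  sub u v hu hv x y := by
    have hcont : ∀ w : ℝ → ℝ → ℝ, Continuous (Function.uncurry w) → IntervalIntegrable
        (fun θ => P (x + (y - θ) / 2) * ∫ a in (0 : ℝ)..(x + (y - θ) / 2), w a θ) volume 0 y :=
      fun w hw => (((hP.comp continuous_fst).mul (continuous_integral_fst hw)).comp
        (f := fun θ : ℝ => (x + (y - θ) / 2, θ)) (by fun_prop)).intervalIntegrable _ _
    simp only [goursatOp, charIntegral]
    rw [← intervalIntegral.integral_sub (hcont u hu) (hcont v hv)]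
    refine intervalIntegral.integral_congr fun θ _ => ?_
    simp only [Pi.sub_apply]
    rw [intervalIntegral.integral_sub (f := fun a => u a θ) (g := fun a => v a θ)
      ((hu.comp (f := fun a => (a, θ)) (by fun_prop)).intervalIntegrable _ _)
      ((hv.comp (f := fun a => (a, θ)) (by fun_prop)).intervalIntegrable _ _)]
    ring
  bound N := by
    obtain ⟨C, hC⟩ := (isCompact_Icc (a := (0 : ℝ)) (b := N)).exists_bound_of_continuousOn
      hP.continuousOn
    refine ⟨max C 0 * |N|, by positivity, fun u hu n c hc hb x y hx hy hxy => ?_⟩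
    refine abs_integral_le_of_le_pow hy fun θ hθ0 hθy => ?_
    have hx' : 0 ≤ x + (y - θ) / 2 := by linarith
    have hx'N : x + (y - θ) / 2 + θ ≤ N := by linarith
    rw [abs_mul]
    have h1 : |P (x + (y - θ) / 2)| ≤ max C 0 :=
      (hC _ ⟨hx', by linarith⟩).trans (le_max_left _ _)
    have h2 : |∫ a in (0 : ℝ)..(x + (y - θ) / 2), u a θ| ≤ |N| * (c * θ ^ n) := by
      have := intervalIntegral.norm_integral_le_of_norm_le_const (a := 0)
        (b := x + (y - θ) / 2) (f := fun a => u a θ) (C := c * θ ^ n) (fun a ha => by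
          rw [uIoc_of_le hx'] at ha
          exact hb a θ ha.1.le hθ0 (by linarith [ha.2]))
      rw [sub_zero, abs_of_nonneg hx', mul_comm] at this
      refine this.trans ?_
      have : x + (y - θ) / 2 ≤ |N| := le_trans (by linarith) (le_abs_self N)
      gcongr
    calc _ ≤ max C 0 * (|N| * (c * θ ^ n)) := by gcongr
      _ = _ := by ring

theorem contDiffOn_derivWithin_Ici {Q : ℝ → ℝ} (hQ : ContDiffOn ℝ ∞ Q (Ici 0)) :
    ContDiffOn ℝ ∞ (derivWithin Q (Ici 0)) (Ici 0) :=
  hQ.derivWithin (uniqueDiffOn_Ici 0) (by simp)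

theorem hasDerivWithinAt_Ici {Q : ℝ → ℝ} (hQ : ContDiffOn ℝ ∞ Q (Ici 0)) {x : ℝ} (hx : 0 ≤ x) :
    HasDerivWithinAt Q (derivWithin Q (Ici 0) x) (Ici 0) x :=
  (hQ.differentiableOn (by simp) x hx).hasDerivWithinAt

theorem hasDerivAt_Ici {Q : ℝ → ℝ} (hQ : ContDiffOn ℝ ∞ Q (Ici 0)) {x : ℝ} (hx : 0 < x) :
    HasDerivAt Q (derivWithin Q (Ici 0) x) x :=
  (hasDerivWithinAt_Ici hQ hx.le).hasDerivAt (Ici_mem_nhds hx)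

/-- Solvability of the characteristic problem. The derivative `g = k_x` solves the Volterra
equation `g = P(x + η / 2) + goursatOp P g` with `P = -Q / 2`, where the free term carries the data
on `η = 0`. -/
theorem exists_isGoursat {Q : ℝ → ℝ} (hQ : ContDiffOn ℝ ∞ Q (Ici 0)) :
    ∃ k : ℝ → ℝ → ℝ, IsGoursat Q k := by
  set P : ℝ → ℝ := fun x => -Q (max x 0) / 2 with hPdef
  have hPc : Continuous P := by
    have : Continuous fun x => Q (max x 0) :=
      hQ.continuousOn.comp_continuous (by fun_prop) fun x => mem_Ici.2 (le_max_right x 0)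
    exact this.neg.div_const 2
  have hPQ : ∀ x, 0 ≤ x → P x = -Q x / 2 := fun x hx => by simp [hPdef, hx]
  have hPs : ContDiffOn ℝ ∞ P (Ici 0) := (hQ.neg.div_const 2).congr fun x hx => hPQ x hx
  set P' := derivWithin P (Ici 0) with hP'
  have hP's : ContDiffOn ℝ ∞ P' (Ici 0) := contDiffOn_derivWithin_Ici hPs
  obtain ⟨g, hgc, hg⟩ := (isVolterra_goursatOp hPc).exists_solution
    (u₀ := fun x y => P (x + y / 2)) (hPc.comp (f := fun z : ℝ × ℝ => z.1 + z.2 / 2) (by fun_prop))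
  set k : ℝ → ℝ → ℝ := fun x y => ∫ a in (0 : ℝ)..x, g a y with hk
  set h : ℝ → ℝ → ℝ := fun x y => P x * k x y with hh
  set hx : ℝ → ℝ → ℝ := fun x y => P' x * k x y + P x * g x y with hhx
  have hkc : Continuous (Function.uncurry k) := continuous_integral_fst hgc
  have hkx : ∀ x y, HasDerivAt (fun z => k z y) (g x y) x := fun x y =>
    ((hgc.comp (f := fun a => (a, y)) (by fun_prop)).integral_hasStrictDerivAt 0 x).hasDerivAt
  have hhd : ∀ x y, 0 ≤ x → 0 ≤ y → HasDerivWithinAt (fun z => h z y) (hx x y) (Ici 0) x :=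
    fun x y hx hy => (hasDerivWithinAt_Ici hPs hx).mul (hkx x y).hasDerivWithinAt
  have hPq : ∀ n : ℕ, ContDiffOn ℝ n (fun p : ℝ × ℝ => P p.1) quadrant := fun n =>
    (contDiffOn_infty.1 hPs n).comp contDiffOn_fst fun p hp => hp.1
  have hP'q : ∀ n : ℕ, ContDiffOn ℝ n (fun p : ℝ × ℝ => P' p.1) quadrant := fun n =>
    (contDiffOn_infty.1 hP's n).comp contDiffOn_fst fun p hp => hp.1
  have hP0q : ContDiffOn ℝ ∞ (fun p : ℝ × ℝ => P (p.1 + p.2 / 2)) quadrant :=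
    hPs.comp (f := fun p : ℝ × ℝ => p.1 + p.2 / 2) (by fun_prop) fun p hp => by
      have h1 : 0 ≤ p.1 := hp.1
      have h2 : 0 ≤ p.2 := hp.2
      exact add_nonneg h1 (by linarith)
  have hhs : ∀ n : ℕ, ContDiffOn ℝ n (Function.uncurry g) quadrant →
      ContDiffOn ℝ n (Function.uncurry h) quadrant ∧
        ContDiffOn ℝ n (Function.uncurry hx) quadrant := by
    intro n ih
    have hks := contDiffOn_integral_fst ih
    exact ⟨(hPq n).mul hks, ((hP'q n).mul hks).add ((hPq n).mul ih)⟩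
  -- each application of the integral operator gains one derivative
  have hgn : ∀ n : ℕ, ContDiffOn ℝ n (Function.uncurry g) quadrant := by
    intro n
    induction n with
    | zero =>
      rw [Nat.cast_zero, contDiffOn_zero]
      exact hgc.continuousOn
    | succ n ih =>
      have := contDiffOn_succ_charIntegral (hhs n ih).1 (hhs n ih).2 hhd
      rw [Nat.cast_succ]
      exact ((contDiffOn_infty.1 hP0q (n + 1)).add this).congr fun p hp => hg p.1 p.2 hp.1 hp.2
  have hgs : ContDiffOn ℝ ∞ (Function.uncurry g) quadrant := contDiffOn_infty.2 hgn
  have hks : ContDiffOn ℝ ∞ (Function.uncurry k) quadrant :=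
    contDiffOn_infty.2 fun n => contDiffOn_integral_fst (hgn n)
  have hdxk : ∀ x y, 0 ≤ x → dx k x y = g x y := fun x y hx =>
    (hkx x y).hasDerivWithinAt.derivWithin (uniqueDiffOn_Ici 0 x hx)
  have hhc : ContinuousOn (Function.uncurry h) quadrant := (hhs 0 (hgn 0)).1.continuousOn
  have hhxc : ContinuousOn (Function.uncurry hx) quadrant := (hhs 0 (hgn 0)).2.continuousOn
  have hBg : ∀ x y, 0 ≤ x → 0 ≤ y → g x y = P (x + y / 2) + charIntegral h x y := hg
  refine ⟨k, hks, fun y hy => by simp [hk], fun x hx0 => ?_, fun x y hx0 hy0 => ?_⟩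
  · rw [hdxk x 0 hx0.le, hBg x 0 hx0.le le_rfl]
    simp [charIntegral, hPQ x hx0.le]; ring
  · have hchar : 0 < x + y / 2 := by linarith
    have e1 : dx (dx k) x y = P' (x + y / 2) + charIntegral hx x y := by
      have h1 : HasDerivAt (fun z => P (z + y / 2)) (P' (x + y / 2)) x :=
        (hasDerivAt_Ici hPs hchar).comp_add_const x (y / 2)
      have h2 := hasDerivWithinAt_charIntegral_fst hhc hhxc hhd hx0.le hy0.le
      have h3 := (h1.hasDerivWithinAt (s := Ici 0)).add h2
      have h4 : ∀ z ∈ Ici (0 : ℝ), dx k z y = P (z + y / 2) + charIntegral h z y :=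
        fun z hz => (hdxk z y hz).trans (hBg z y hz hy0.le)
      exact (h3.congr h4 (h4 x hx0.le)).derivWithin (uniqueDiffOn_Ici 0 x hx0.le)
    have e2 : dy (dx k) x y = P' (x + y / 2) / 2 + (h x y + charIntegral hx x y / 2) := by
      have h1 : HasDerivAt (fun z => P (x + z / 2)) (P' (x + y / 2) * (1 / 2)) y :=
        HasDerivAt.comp (h₂ := P) (h := fun z => x + z / 2) y (hasDerivAt_Ici hPs hchar)
          (((hasDerivAt_id y).div_const 2).const_add x)
      have h2 := hasDerivWithinAt_charIntegral_snd hhc hhxc hhd hx0.le hy0.le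
      have h3 := (h1.hasDerivWithinAt (s := Ici 0)).add h2
      have h4 : ∀ z ∈ Ici (0 : ℝ), dx k x z = P (x + z / 2) + charIntegral h x z :=
        fun z hz => (hdxk x z hx0.le).trans (hBg x z hx0.le hz)
      rw [dy, (h3.congr h4 (h4 y hy0.le)).derivWithin (uniqueDiffOn_Ici 0 y hy0.le)]
      ring
    rw [e1, e2]
    simp only [hh, hPQ x hx0.le]
    ring

/-! ### Duhamel's formula for unit density -/

theorem iteratedDeriv_two_eq {u u₁ : ℝ → ℝ} {u₂ x : ℝ}
    (h1 : ∀ᶠ y in 𝓝 x, HasDerivAt u (u₁ y) y) (h2 : HasDerivAt u₁ u₂ x) :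
    iteratedDeriv 2 u x = u₂ := by
  rw [iteratedDeriv_succ, iteratedDeriv_one]
  have : deriv u =ᶠ[𝓝 x] u₁ := h1.mono fun y hy => hy.deriv
  rw [this.deriv_eq]
  exact h2.deriv

/-- The convolution `∫₀ᴹ k(x, η) f(z - η) dη` in the second variable. The upper limit is fixed for
differentiation; as soon as `z ≤ M` it is immaterial for functions `f` that vanish for `t ≤ 0`. -/
def conv (k : ℝ → ℝ → ℝ) (f : ℝ → ℝ) (M x z : ℝ) : ℝ := ∫ η in (0 : ℝ)..M, k x η * f (z - η)

/-- Duhamel's formula for unit density: convolution with `δ(t - x) + k(x, t - x)`, the upper limit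
of integration being `M` as in `conv`. -/
def duhamel (k : ℝ → ℝ → ℝ) (f : ℝ → ℝ) (M x t : ℝ) : ℝ := f (t - x) + conv k f M x (t - x)

theorem continuousOn_section {k : ℝ → ℝ → ℝ} (hk : ContinuousOn (Function.uncurry k) quadrant)
    {x : ℝ} (hx : 0 ≤ x) : ContinuousOn (k x) (Ici 0) :=
  hk.comp (f := fun s => (x, s)) (by fun_prop) fun _ hs => ⟨hx, hs⟩

theorem conv_add {k l : ℝ → ℝ → ℝ} {f : ℝ → ℝ} {M x : ℝ} (hM : 0 ≤ M) (hx : 0 ≤ x)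
    (hk : ContinuousOn (Function.uncurry k) quadrant)
    (hl : ContinuousOn (Function.uncurry l) quadrant) (hf : Continuous f) (a b z : ℝ) :
    conv (fun x y => a * k x y + b * l x y) f M x z = a * conv k f M x z + b * conv l f M x z := by
  have hi : ∀ {k : ℝ → ℝ → ℝ}, ContinuousOn (Function.uncurry k) quadrant →
      IntervalIntegrable (fun η => k x η * f (z - η)) volume 0 M := fun hk =>
    (((continuousOn_section hk hx).mono Icc_subset_Ici_self).mul
      (by fun_prop)).intervalIntegrable_of_Icc hM
  simp only [conv]
  rw [← intervalIntegral.integral_const_mul, ← intervalIntegral.integral_const_mul,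
    ← intervalIntegral.integral_add ((hi hk).const_mul a) ((hi hl).const_mul b)]
  refine intervalIntegral.integral_congr fun η _ => ?_
  ring

theorem hasDerivAt_conv_time {k : ℝ → ℝ → ℝ} {f : ℝ → ℝ}
    (hk : ContinuousOn (Function.uncurry k) quadrant) (hf : ContDiff ℝ ∞ f) {M x : ℝ} (hM : 0 ≤ M)
    (hx : 0 ≤ x) (t : ℝ) :
    HasDerivAt (fun t => conv k f M x (t - x)) (conv k (deriv f) M x (t - x)) t := by
  have hkx : ContinuousOn (fun z : ℝ × ℝ => k x z.2) (univ ×ˢ Icc 0 M) :=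
    (continuousOn_section hk hx).comp continuousOn_snd fun z hz => hz.2.1
  have hf' : Continuous (deriv f) := hf.continuous_deriv (by simp)
  have := hasDerivWithinAt_intervalIntegral_param convex_univ hM
    (H := fun t η => k x η * f (t - x - η)) (D := fun t η => k x η * deriv f (t - x - η))
    (hkx.mul (hf.continuous.comp (f := fun z : ℝ × ℝ => z.1 - x - z.2) (by fun_prop)).continuousOn)
    (hkx.mul (hf'.comp (f := fun z : ℝ × ℝ => z.1 - x - z.2) (by fun_prop)).continuousOn)
    (fun p _ s _ => ?_) (mem_univ t)
  · rwa [hasDerivWithinAt_univ] at this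
  · have h1 : HasDerivAt (fun p => f (p - x - s)) (deriv f (p - x - s)) p := by
      have := ((hf.differentiable (by simp)) (p - x - s)).hasDerivAt
      simp only [sub_sub] at this ⊢
      exact this.comp_sub_const p (x + s)
    exact (h1.const_mul _).hasDerivWithinAt

theorem hasDerivWithinAt_conv_space {k : ℝ → ℝ → ℝ} {f : ℝ → ℝ}
    (hk : ContDiffOn ℝ ∞ (Function.uncurry k) quadrant) (hf : ContDiff ℝ ∞ f) {M x : ℝ}
    (hM : 0 ≤ M) (hx : 0 ≤ x) (t : ℝ) :
    HasDerivWithinAt (fun x => conv k f M x (t - x))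
      (conv (dx k) f M x (t - x) - conv k (deriv f) M x (t - x)) (Ici 0) x := by
  have hsub : Ici (0 : ℝ) ×ˢ Icc 0 M ⊆ quadrant := prod_mono le_rfl Icc_subset_Ici_self
  have hk1 := (hk.continuousOn).mono hsub
  have hk2 := ((contDiffOn_dx hk).continuousOn).mono hsub
  have hf' : Continuous (deriv f) := hf.continuous_deriv (by simp)
  have hg1 : ContinuousOn (fun z : ℝ × ℝ => f (t - z.1 - z.2)) (Ici 0 ×ˢ Icc 0 M) :=
    (hf.continuous.comp (f := fun z : ℝ × ℝ => t - z.1 - z.2) (by fun_prop)).continuousOn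
  have hg2 : ContinuousOn (fun z : ℝ × ℝ => deriv f (t - z.1 - z.2)) (Ici 0 ×ˢ Icc 0 M) :=
    (hf'.comp (f := fun z : ℝ × ℝ => t - z.1 - z.2) (by fun_prop)).continuousOn
  have := hasDerivWithinAt_intervalIntegral_param (convex_Ici 0) hM
    (H := fun x η => k x η * f (t - x - η))
    (D := fun x η => dx k x η * f (t - x - η) - k x η * deriv f (t - x - η))
    (hk1.mul hg1) ((hk2.mul hg1).sub (hk1.mul hg2)) (fun p hp s hs => ?_) hx
  · refine this.congr_deriv ?_
    have hfc := hf.continuous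
    exact intervalIntegral.integral_sub
      (((continuousOn_section (contDiffOn_dx hk).continuousOn hx).mono Icc_subset_Ici_self).mul
        (by fun_prop) |>.intervalIntegrable_of_Icc hM)
      (((continuousOn_section hk.continuousOn hx).mono Icc_subset_Ici_self).mul
        (by fun_prop) |>.intervalIntegrable_of_Icc hM)
  · have h1 : HasDerivAt (fun p => f (t - p - s)) (-deriv f (t - p - s)) p := by
      have := ((hf.differentiable (by simp)) (t - p - s)).hasDerivAt
      have h2 : HasDerivAt (fun p => t - p - s) (-1) p :=
        ((hasDerivAt_id p).const_sub t).sub_const s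
      exact (HasDerivAt.comp (h₂ := f) (h := fun p => t - p - s) p this h2).congr_deriv (by ring)
    exact ((hasDerivWithinAt_dx hk hp hs.1).mul h1.hasDerivWithinAt).congr_deriv (by ring)

section Duhamel
variable {k : ℝ → ℝ → ℝ} {f : ℝ → ℝ}

/-- The first space derivative of `duhamel` at fixed time. -/
def duhamelDx (k : ℝ → ℝ → ℝ) (f : ℝ → ℝ) (M x t : ℝ) : ℝ :=
  -deriv f (t - x) + (conv (dx k) f M x (t - x) - conv k (deriv f) M x (t - x))

/-- The second space derivative of `duhamel` at fixed time. -/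
def duhamelDxx (k : ℝ → ℝ → ℝ) (f : ℝ → ℝ) (M x t : ℝ) : ℝ :=
  deriv (deriv f) (t - x) + (conv (dx (dx k)) f M x (t - x)
    - 2 * conv (dx k) (deriv f) M x (t - x) + conv k (deriv (deriv f)) M x (t - x))

theorem hasDerivAt_sub_left {f : ℝ → ℝ} (hf : ContDiff ℝ ∞ f) (t x : ℝ) :
    HasDerivAt (fun x => f (t - x)) (-deriv f (t - x)) x :=
  ((hf.differentiable (by simp) (t - x)).hasDerivAt).comp_const_sub t x

theorem contDiff_deriv {f : ℝ → ℝ} (hf : ContDiff ℝ ∞ f) : ContDiff ℝ ∞ (deriv f) :=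
  (contDiff_infty_iff_deriv.1 hf).2

variable (hk : ContDiffOn ℝ ∞ (Function.uncurry k) quadrant) (hf : ContDiff ℝ ∞ f)
include hk hf

theorem hasDerivAt_duhamel {M x : ℝ} (hM : 0 ≤ M) (hx : 0 < x) (t : ℝ) :
    HasDerivAt (fun x => duhamel k f M x t) (duhamelDx k f M x t) x :=
  (hasDerivAt_sub_left hf t x).add
    ((hasDerivWithinAt_conv_space hk hf hM hx.le t).hasDerivAt (Ici_mem_nhds hx))

theorem hasDerivAt_duhamelDx {M x : ℝ} (hM : 0 ≤ M) (hx : 0 < x) (t : ℝ) :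
    HasDerivAt (fun x => duhamelDx k f M x t) (duhamelDxx k f M x t) x := by
  have h1 := (hasDerivAt_sub_left (contDiff_deriv hf) t x).neg
  have h2 := (hasDerivWithinAt_conv_space (contDiffOn_dx hk) hf hM hx.le t).hasDerivAt
    (Ici_mem_nhds hx)
  have h3 := (hasDerivWithinAt_conv_space hk (contDiff_deriv hf) hM hx.le t).hasDerivAt
    (Ici_mem_nhds hx)
  exact (h1.add (h2.sub h3)).congr_deriv (by rw [duhamelDxx]; ring)

theorem iteratedDeriv_duhamel_time {M x : ℝ} (hM : 0 ≤ M) (hx : 0 ≤ x) (t : ℝ) :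
    iteratedDeriv 2 (fun s => duhamel k f M x s) t = duhamel k (deriv (deriv f)) M x t := by
  have h : ∀ {f : ℝ → ℝ}, ContDiff ℝ ∞ f → ∀ t,
      HasDerivAt (fun s => duhamel k f M x s) (duhamel k (deriv f) M x t) t := fun hf t =>
    (((hf.differentiable (by simp) (t - x)).hasDerivAt).comp_sub_const t x).add
      (hasDerivAt_conv_time hk.continuousOn hf hM hx t)
  exact iteratedDeriv_two_eq (Eventually.of_forall (h hf)) (h (contDiff_deriv hf) t)

/-- Integration by parts; the boundary term at `η = M` vanishes because `f` vanishes for `t ≤ 0`. -/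
theorem conv_deriv_eq (hf0 : ∀ t ≤ 0, f t = 0) {M x z : ℝ} (hM : 0 ≤ M) (hx : 0 ≤ x) (hz : z ≤ M) :
    conv k (deriv f) M x z = k x 0 * f z + conv (dy k) f M x z := by
  have hfc := hf.continuous
  have hf'c : Continuous (deriv f) := (contDiff_deriv hf).continuous
  have c1 : ContinuousOn (k x) (Icc 0 M) :=
    (continuousOn_section hk.continuousOn hx).mono Icc_subset_Ici_self
  have c2 : ContinuousOn (dy k x) (Icc 0 M) :=
    (continuousOn_section (contDiffOn_dy hk).continuousOn hx).mono Icc_subset_Ici_self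
  have i1 : IntervalIntegrable (fun η => dy k x η * f (z - η)) volume 0 M :=
    (c2.mul (by fun_prop)).intervalIntegrable_of_Icc hM
  have i2 : IntervalIntegrable (fun η => k x η * deriv f (z - η)) volume 0 M :=
    (c1.mul (by fun_prop)).intervalIntegrable_of_Icc hM
  have := intervalIntegral.integral_eq_sub_of_hasDerivAt_of_le hM
    (f := fun η => k x η * f (z - η))
    (f' := fun η => dy k x η * f (z - η) - k x η * deriv f (z - η))
    (c1.mul (by fun_prop)) (fun η hη => ?_) (i1.sub i2)
  · rw [intervalIntegral.integral_sub i1 i2, hf0 (z - M) (by linarith), sub_zero] at this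
    simp only [conv]
    linarith
  · exact ((hasDerivAt_dy hk hx hη.1).mul (hasDerivAt_sub_left hf z η)).congr_deriv (by ring)

/-- The operator `∂_t² - ∂_x² + c` applied to Duhamel's formula. The terms with `f''` and `f'`
cancel; what remains is the control with the coefficient `2 k_x(x, 0) + c`, and the convolution
with the equation of the characteristic problem. -/
theorem duhamel_wave_operator (hf0 : ∀ t ≤ 0, f t = 0) {M x t : ℝ} (hM : 0 ≤ M) (hx : 0 < x)
    (ht : t - x ≤ M) (c : ℝ) :
    duhamel k (deriv (deriv f)) M x t - duhamelDxx k f M x t + c * duhamel k f M x t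
      = (2 * dx k x 0 + c) * f (t - x)
        + conv (fun x y => 2 * dy (dx k) x y + (-1) * dx (dx k) x y + c * k x y) f M x (t - x) := by
  have hkx := contDiffOn_dx hk
  have e1 := conv_deriv_eq hkx hf hf0 hM hx.le ht
  have e2 := conv_add hM hx.le (((contDiffOn_dy hkx).continuousOn.const_smul (2 : ℝ)).add
    ((contDiffOn_dx hkx).continuousOn.const_smul (-1 : ℝ))) hk.continuousOn hf.continuous
    1 c (t - x)
    (k := fun x y => 2 * dy (dx k) x y + (-1) * dx (dx k) x y)
  have e3 := conv_add hM hx.le (contDiffOn_dy hkx).continuousOn (contDiffOn_dx hkx).continuousOn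
    hf.continuous 2 (-1) (t - x)
  simp only [one_mul] at e2
  rw [e2, e3, duhamelDxx, duhamel, duhamel, e1]
  ring

theorem contDiffOn_duhamel {M : ℝ} (hM : 0 < M) :
    ContDiffOn ℝ ∞ (Function.uncurry (duhamel k f M)) (Ici 0 ×ˢ univ) := by
  refine (hf.comp (f := fun p : ℝ × ℝ => p.2 - p.1) (by fun_prop)).contDiffOn.add ?_
  refine contDiffOn_intervalIntegral_param ((convex_Ici 0).prod convex_univ)
    ((uniqueDiffOn_Ici 0).prod uniqueDiffOn_univ) hM
    (H := fun (p : ℝ × ℝ) η => k p.1 η * f (p.2 - p.1 - η)) ?_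
  refine ContDiffOn.mul (hk.comp (f := fun z : (ℝ × ℝ) × ℝ => (z.1.1, z.2)) (by fun_prop) ?_)
    (hf.comp (f := fun z : (ℝ × ℝ) × ℝ => z.1.2 - z.1.1 - z.2) (by fun_prop)).contDiffOn
  exact fun z hz => ⟨hz.1.1, hz.2.1⟩

end Duhamel

theorem conv_eq_of_le {k : ℝ → ℝ → ℝ} {f : ℝ → ℝ} (hf0 : ∀ t ≤ 0, f t = 0) (hf : Continuous f)
    {M x z : ℝ} (hk : ContinuousOn (k x) (Ici 0)) (hz : 0 ≤ z) (hzM : z ≤ M) :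
    conv k f M x z = conv k f z x z := by
  have hi : ∀ a b, 0 ≤ a → a ≤ b →
      IntervalIntegrable (fun η => k x η * f (z - η)) volume a b := fun a b ha hab =>
    ((hk.mono fun s hs => mem_Ici.2 (ha.trans hs.1)).mul
      (by fun_prop)).intervalIntegrable_of_Icc hab
  have h2 : ∫ η in z..M, k x η * f (z - η) = 0 := by
    refine (intervalIntegral.integral_congr (g := fun _ => 0) fun η hη => ?_).trans (by simp)
    rw [uIcc_of_le hzM] at hη
    simp [hf0 (z - η) (by linarith [hη.1])]
  rw [conv, conv, ← intervalIntegral.integral_add_adjacent_intervals (hi 0 z le_rfl hz)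
    (hi z M hz hzM), h2, add_zero]

/-- Duhamel's formula in the coordinates `(x, t - τ(x))`. -/
theorem wave_eq_conv {ρ : ℝ → ℝ} {w : ℝ → ℝ → ℝ} {f : ℝ → ℝ} (hf0 : ∀ t ≤ 0, f t = 0)
    (hf : Continuous f) {M x t : ℝ}
    (hw : ContinuousOn (fun η => w x (eikonal ρ x + η)) (Ici 0)) (hM : 0 ≤ M)
    (ht : t - eikonal ρ x ≤ M) :
    wave ρ w f x t = (ρ x / ρ 0) ^ (-(1 / 4) : ℝ) * f (t - eikonal ρ x)
      + conv (fun x η => w x (eikonal ρ x + η)) f M x (t - eikonal ρ x) := by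
  rw [wave]
  split_ifs with h
  · rw [conv_eq_of_le hf0 hf hw (sub_nonneg.2 h) ht, conv]
    congr 1
    have := intervalIntegral.integral_comp_sub_left (a := 0) (b := t - eikonal ρ x)
      (fun s => w x (t - s) * f s) (t - eikonal ρ x)
    rw [sub_self, sub_zero] at this
    rw [← this]
    refine intervalIntegral.integral_congr fun η _ => ?_
    congr 2; ring
  · rw [hf0 _ (by linarith), conv]
    rw [intervalIntegral.integral_congr (g := fun _ => 0) fun η hη => ?_]
    · simp
    · rw [uIcc_of_le hM] at hη
      simp only
      rw [hf0 _ (by linarith [hη.1]), mul_zero]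

/-! ### Densities, the Liouville transformation, and the fundamental solution -/

/-- Admissible densities: smooth and positive on `[0, ∞)`, of infinite optical length. -/
structure IsDensity (ρ : ℝ → ℝ) : Prop where
  smooth : ContDiffOn ℝ ∞ ρ (Ici 0)
  pos : ∀ x, 0 ≤ x → 0 < ρ x
  tendsto : Tendsto (eikonal ρ) atTop atTop

/-- The amplitude `(ρ(x)/ρ(0))^{-1/4}` of the singular part of the fundamental solution. -/
def amp (ρ : ℝ → ℝ) (x : ℝ) : ℝ := (ρ x / ρ 0) ^ (-(1 / 4) : ℝ)

@[simp] theorem eikonal_zero (ρ : ℝ → ℝ) : eikonal ρ 0 = 0 := by simp [eikonal]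

/-- The values of `ρ` at negative arguments are irrelevant. -/
theorem eikonal_eq (ρ : ℝ → ℝ) {x : ℝ} (hx : 0 ≤ x) :
    eikonal ρ x = ∫ s in (0 : ℝ)..x, √(ρ (max s 0)) := by
  refine intervalIntegral.integral_congr fun s hs => ?_
  rw [uIcc_of_le hx] at hs
  simp [hs.1]

namespace IsDensity
variable {ρ : ℝ → ℝ} (hρ : IsDensity ρ)
include hρ

theorem sqrt_pos {x : ℝ} (hx : 0 ≤ x) : 0 < √(ρ x) := Real.sqrt_pos.2 (hρ.pos x hx)

theorem contDiffOn_sqrt : ContDiffOn ℝ ∞ (fun x => √(ρ x)) (Ici 0) :=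
  hρ.smooth.sqrt fun x hx => (hρ.pos x hx).ne'

theorem continuous_sqrt_max : Continuous fun x => √(ρ (max x 0)) :=
  hρ.contDiffOn_sqrt.continuousOn.comp_continuous (f := fun x => max x 0) (by fun_prop)
    fun x => mem_Ici.2 (le_max_right x 0)

theorem hasDerivWithinAt_eikonal {x : ℝ} (hx : 0 ≤ x) :
    HasDerivWithinAt (eikonal ρ) (√(ρ x)) (Ici 0) x := by
  have := (hρ.continuous_sqrt_max.integral_hasStrictDerivAt 0 x).hasDerivAt.hasDerivWithinAt
    (s := Ici 0)
  rw [max_eq_left hx] at this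
  exact this.congr (fun y hy => eikonal_eq ρ hy) (eikonal_eq ρ hx)

theorem contDiffOn_eikonal : ContDiffOn ℝ ∞ (eikonal ρ) (Ici 0) := by
  rw [contDiffOn_infty_iff_derivWithin (uniqueDiffOn_Ici 0)]
  exact ⟨fun x hx => (hρ.hasDerivWithinAt_eikonal hx).differentiableWithinAt,
    hρ.contDiffOn_sqrt.congr fun x hx =>
      (hρ.hasDerivWithinAt_eikonal hx).derivWithin (uniqueDiffOn_Ici 0 x hx)⟩

theorem strictMonoOn_eikonal : StrictMonoOn (eikonal ρ) (Ici 0) := by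
  refine strictMonoOn_of_deriv_pos (convex_Ici 0) hρ.contDiffOn_eikonal.continuousOn fun x hx => ?_
  rw [interior_Ici] at hx
  have hx0 : 0 < x := hx
  rw [((hρ.hasDerivWithinAt_eikonal hx0.le).hasDerivAt (Ici_mem_nhds hx0)).deriv]
  exact hρ.sqrt_pos hx0.le

theorem eikonal_nonneg {x : ℝ} (hx : 0 ≤ x) : 0 ≤ eikonal ρ x := by
  have := hρ.strictMonoOn_eikonal.monotoneOn (mem_Ici.2 le_rfl) hx hx
  simpa using this

theorem eikonal_pos {x : ℝ} (hx : 0 < x) : 0 < eikonal ρ x := by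
  have := hρ.strictMonoOn_eikonal (mem_Ici.2 le_rfl) hx.le hx
  simpa using this

theorem surjOn_eikonal {t : ℝ} (ht : 0 ≤ t) : t ∈ eikonal ρ '' Ici 0 := by
  obtain ⟨b, hb, hb0⟩ := ((hρ.tendsto.eventually_ge_atTop t).and (eventually_ge_atTop 0)).exists
  have := intermediate_value_Icc hb0
    (hρ.contDiffOn_eikonal.continuousOn.mono Icc_subset_Ici_self)
  obtain ⟨x, hx, hxt⟩ := this ⟨by simpa using ht, hb⟩
  exact ⟨x, hx.1, hxt⟩

theorem front_nonneg {t : ℝ} (ht : 0 ≤ t) : 0 ≤ front ρ t :=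
  Function.invFunOn_mem (hρ.surjOn_eikonal ht)

theorem eikonal_front {t : ℝ} (ht : 0 ≤ t) : eikonal ρ (front ρ t) = t :=
  Function.invFunOn_eq (hρ.surjOn_eikonal ht)

theorem front_eikonal {x : ℝ} (hx : 0 ≤ x) : front ρ (eikonal ρ x) = x :=
  hρ.strictMonoOn_eikonal.injOn (hρ.front_nonneg (hρ.eikonal_nonneg hx)) hx
    (hρ.eikonal_front (hρ.eikonal_nonneg hx))

theorem eikonal_lt_iff {x t : ℝ} (hx : 0 ≤ x) (ht : 0 ≤ t) : eikonal ρ x < t ↔ x < front ρ t := by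
  conv_lhs => rw [← hρ.eikonal_front ht]
  exact hρ.strictMonoOn_eikonal.lt_iff_lt hx (hρ.front_nonneg ht)

theorem front_le_front {s t : ℝ} (hs : 0 ≤ s) (hst : s ≤ t) : front ρ s ≤ front ρ t := by
  by_contra! h
  have := (hρ.eikonal_lt_iff (hρ.front_nonneg (hs.trans hst)) hs).2 h
  rw [hρ.eikonal_front (hs.trans hst)] at this
  linarith

theorem front_pos {t : ℝ} (ht : 0 < t) : 0 < front ρ t := by
  rw [← hρ.eikonal_lt_iff le_rfl ht.le]; simpa using ht

theorem continuousOn_front : ContinuousOn (front ρ) (Ici 0) := by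
  let e : Ici (0 : ℝ) ≃o Ici (0 : ℝ) :=
    { toFun := fun x => ⟨eikonal ρ x, hρ.eikonal_nonneg x.2⟩
      invFun := fun t => ⟨front ρ t, hρ.front_nonneg t.2⟩
      left_inv := fun x => Subtype.ext (hρ.front_eikonal x.2)
      right_inv := fun t => Subtype.ext (hρ.eikonal_front t.2)
      map_rel_iff' := fun {x y} => hρ.strictMonoOn_eikonal.le_iff_le x.2 y.2 }
  rw [continuousOn_iff_continuous_domRestrict]
  exact continuous_subtype_val.comp e.symm.continuous

theorem hasDerivWithinAt_front {t : ℝ} (ht : 0 ≤ t) :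
    HasDerivWithinAt (front ρ) (√(ρ (front ρ t)))⁻¹ (Ici 0) t := by
  have h0 := (hρ.sqrt_pos (hρ.front_nonneg ht)).ne'
  have h1 : HasFDerivWithinAt (eikonal ρ)
      ((ContinuousLinearEquiv.unitsEquivAut ℝ (Units.mk0 _ h0) : ℝ ≃L[ℝ] ℝ) : ℝ →L[ℝ] ℝ) (Ici 0)
      (front ρ t) :=
    ((hρ.hasDerivWithinAt_eikonal (hρ.front_nonneg ht)).hasFDerivWithinAt).congr_fderiv
      (by ext; simp)
  have h2 : Tendsto (front ρ) (𝓝[Ici 0] t) (𝓝[Ici 0] (front ρ t)) :=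
    tendsto_nhdsWithin_iff.2 ⟨hρ.continuousOn_front t ht,
      eventually_nhdsWithin_of_forall fun s hs => hρ.front_nonneg hs⟩
  have h3 := h1.of_local_left_inverse h2 (mem_Ici.2 ht)
    (eventually_nhdsWithin_of_forall fun s hs => hρ.eikonal_front hs)
  refine h3.hasDerivWithinAt.congr_deriv ?_
  simp

theorem contDiffOn_front : ContDiffOn ℝ ∞ (front ρ) (Ici 0) := by
  refine contDiffOn_infty.2 fun n => ?_
  induction n with
  | zero => rw [Nat.cast_zero, contDiffOn_zero]; exact hρ.continuousOn_front
  | succ n ih =>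
    rw [Nat.cast_succ, contDiffOn_succ_iff_derivWithin (uniqueDiffOn_Ici 0)]
    refine ⟨fun t ht => (hρ.hasDerivWithinAt_front ht).differentiableWithinAt, by simp, ?_⟩
    have h1 : ContDiffOn ℝ n (fun t => √(ρ (front ρ t))) (Ici 0) :=
      (contDiffOn_infty.1 hρ.contDiffOn_sqrt n).comp ih fun t ht => hρ.front_nonneg ht
    exact (h1.inv fun t ht => (hρ.sqrt_pos (hρ.front_nonneg ht)).ne').congr fun t ht =>
      (hρ.hasDerivWithinAt_front ht).derivWithin (uniqueDiffOn_Ici 0 t ht)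

theorem amp_pos {x : ℝ} (hx : 0 ≤ x) : 0 < amp ρ x :=
  Real.rpow_pos_of_pos (div_pos (hρ.pos x hx) (hρ.pos 0 le_rfl)) _

theorem amp_zero : amp ρ 0 = 1 := by
  rw [amp, div_self (hρ.pos 0 le_rfl).ne', Real.one_rpow]

theorem contDiffOn_amp : ContDiffOn ℝ ∞ (amp ρ) (Ici 0) :=
  (hρ.smooth.div_const (ρ 0)).rpow_const_of_ne fun x hx =>
    (div_pos (hρ.pos x hx) (hρ.pos 0 le_rfl)).ne'

theorem amp_sq_mul {x : ℝ} (hx : 0 ≤ x) : amp ρ x ^ 2 * √(ρ x) = √(ρ 0) := by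
  have h0 := hρ.pos 0 le_rfl
  have hr : 0 < ρ x / ρ 0 := div_pos (hρ.pos x hx) h0
  have : amp ρ x ^ 2 = (√(ρ x / ρ 0))⁻¹ := by
    rw [amp, ← Real.rpow_natCast, ← Real.rpow_mul hr.le, Real.sqrt_eq_rpow, ← Real.rpow_neg hr.le]
    norm_num
  rw [this, Real.sqrt_div (hρ.pos x hx).le, inv_div,
    div_mul_cancel₀ _ (hρ.sqrt_pos hx).ne']

/-- The transport equation of the amplitude, obtained by differentiating `amp_sq_mul`. -/
theorem amp_transport {x : ℝ} (hx : 0 < x) :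
    2 * derivWithin (amp ρ) (Ici 0) x * √(ρ x)
      + amp ρ x * derivWithin (fun x => √(ρ x)) (Ici 0) x = 0 := by
  have h1 := hasDerivAt_Ici hρ.contDiffOn_amp hx
  have h2 := hasDerivAt_Ici hρ.contDiffOn_sqrt hx
  have h3 := (h1.pow 2).mul h2
  have h4 : (amp ρ ^ 2 * fun x => √(ρ x)) =ᶠ[𝓝 x] fun _ => √(ρ 0) := by
    filter_upwards [Ici_mem_nhds hx] with y hy using hρ.amp_sq_mul hy
  have h5 := h3.unique ((hasDerivAt_const x (√(ρ 0))).congr_of_eventuallyEq h4)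
  have h6 := (hρ.amp_pos hx.le).ne'
  apply mul_left_cancel₀ h6
  simp at h5
  linarith

end IsDensity

/-- The potential `Q` of the Liouville normal form, as a function of the optical length: for `u(x,
t) = a(x) v(τ(x), t)` with the amplitude `a`, the equation for `u` becomes `v_tt - v_xx + Q v = 0`.
-/
def liouvillePotential (ρ q : ℝ → ℝ) (t : ℝ) : ℝ :=
  (q (front ρ t) - derivWithin (derivWithin (amp ρ) (Ici 0)) (Ici 0) (front ρ t)
    / amp ρ (front ρ t)) / ρ (front ρ t)

theorem contDiffOn_liouvillePotential {ρ q : ℝ → ℝ} (hρ : IsDensity ρ)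
    (hq : ContDiffOn ℝ ∞ q (Ici 0)) : ContDiffOn ℝ ∞ (liouvillePotential ρ q) (Ici 0) := by
  have h1 : ContDiffOn ℝ ∞ (fun x => (q x - derivWithin (derivWithin (amp ρ) (Ici 0)) (Ici 0) x
      / amp ρ x) / ρ x) (Ici 0) :=
    (hq.sub ((contDiffOn_derivWithin_Ici (contDiffOn_derivWithin_Ici hρ.contDiffOn_amp)).div
      hρ.contDiffOn_amp fun x hx => (hρ.amp_pos hx).ne')).div hρ.smooth
      fun x hx => (hρ.pos x hx).ne'
  exact h1.comp hρ.contDiffOn_front fun t ht => hρ.front_nonneg ht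

/-- The regular part of the fundamental solution built from the kernel of the normal form. -/
def liouvilleKernel (ρ : ℝ → ℝ) (k : ℝ → ℝ → ℝ) (x t : ℝ) : ℝ :=
  open Classical in
  if eikonal ρ x ≤ t then amp ρ x * k (eikonal ρ x) (t - eikonal ρ x) else 0

section Existence
variable {ρ q : ℝ → ℝ} {k : ℝ → ℝ → ℝ} (hρ : IsDensity ρ)
  (hk : IsGoursat (liouvillePotential ρ q) k)
include hρ hk

/-- Duhamel's formula for `ρ` is the one for the normal form in the variable `τ(x)`, times the
amplitude. -/
theorem wave_liouvilleKernel {f : ℝ → ℝ} (hf : Continuous f) (hf0 : ∀ t ≤ 0, f t = 0) {M x t : ℝ}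
    (hM : 0 ≤ M) (hx : 0 ≤ x) (ht : t ≤ M) :
    wave ρ (liouvilleKernel ρ k) f x t = amp ρ x * duhamel k f M (eikonal ρ x) t := by
  have hτ := hρ.eikonal_nonneg hx
  have hw : ∀ η, 0 ≤ η →
      liouvilleKernel ρ k x (eikonal ρ x + η) = amp ρ x * k (eikonal ρ x) η := fun η hη => by
    simp [liouvilleKernel, hη]
  rw [wave_eq_conv hf0 hf (M := M) ?_ hM (by linarith), duhamel, mul_add]
  · congr 1
    rw [conv, conv, ← intervalIntegral.integral_const_mul]
    refine intervalIntegral.integral_congr fun η hη => ?_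
    rw [uIcc_of_le hM] at hη
    simp only [hw η hη.1]
    ring
  · exact (((continuousOn_section hk.smooth.continuousOn hτ)).const_smul (amp ρ x)).congr
      fun η hη => hw η hη

/-- The wave equation. The first order terms produced by the change of variable cancel by the
transport equation of the amplitude. -/
theorem liouvilleKernel_pde {f : ℝ → ℝ} (hf : ContDiff ℝ ∞ f) (hf0 : ∀ t ≤ 0, f t = 0) {x t : ℝ}
    (hx : 0 < x) (ht : 0 < t) :
    ρ x * iteratedDeriv 2 (fun s => wave ρ (liouvilleKernel ρ k) f x s) t
      - iteratedDeriv 2 (fun z => wave ρ (liouvilleKernel ρ k) f z t) x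
      + q x * wave ρ (liouvilleKernel ρ k) f x t = 0 := by
  -- any `M` greater than the time under consideration serves for all nearby times
  have hM : 0 ≤ t + 1 := by linarith
  set τ := eikonal ρ x with hτdef
  have hτ : 0 < τ := hρ.eikonal_pos hx
  have e1 : iteratedDeriv 2 (fun s => wave ρ (liouvilleKernel ρ k) f x s) t
      = amp ρ x * duhamel k (deriv (deriv f)) (t + 1) τ t := by
    have : (fun s => wave ρ (liouvilleKernel ρ k) f x s)
        =ᶠ[𝓝 t] fun s => amp ρ x * duhamel k f (t + 1) τ s := by
      filter_upwards [Iio_mem_nhds (show t < t + 1 by linarith)] with s hs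
      exact wave_liouvilleKernel hρ hk hf.continuous hf0 hM hx.le (le_of_lt hs)
    rw [this.iteratedDeriv_eq, ← iteratedDeriv_duhamel_time hk.smooth hf hM hτ.le]
    exact iteratedDeriv_const_mul_field (amp ρ x) _
  set a' := derivWithin (amp ρ) (Ici 0) with ha'
  set a'' := derivWithin a' (Ici 0) with ha''
  set σ' := derivWithin (fun x => √(ρ x)) (Ici 0) with hσ'
  have hda : ∀ z, 0 < z → HasDerivAt (amp ρ) (a' z) z := fun z hz =>
    hasDerivAt_Ici hρ.contDiffOn_amp hz
  have hdτ : ∀ z, 0 < z → HasDerivAt (eikonal ρ) (√(ρ z)) z := fun z hz =>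
    (hρ.hasDerivWithinAt_eikonal hz.le).hasDerivAt (Ici_mem_nhds hz)
  have hdu : ∀ z, 0 < z → HasDerivAt (fun z => duhamel k f (t + 1) (eikonal ρ z) t)
      (duhamelDx k f (t + 1) (eikonal ρ z) t * √(ρ z)) z := fun z hz =>
    HasDerivAt.comp (h₂ := fun y => duhamel k f (t + 1) y t) (h := eikonal ρ) z
      (hasDerivAt_duhamel hk.smooth hf hM (hρ.eikonal_pos hz) t) (hdτ z hz)
  have hdu1 : HasDerivAt (fun z => duhamelDx k f (t + 1) (eikonal ρ z) t)
      (duhamelDxx k f (t + 1) τ t * √(ρ x)) x :=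
    HasDerivAt.comp (h₂ := fun y => duhamelDx k f (t + 1) y t) (h := eikonal ρ) x
      (hasDerivAt_duhamelDx hk.smooth hf hM hτ t) (hdτ x hx)
  have e2 : iteratedDeriv 2 (fun z => wave ρ (liouvilleKernel ρ k) f z t) x
      = a'' x * duhamel k f (t + 1) τ t + a' x * (duhamelDx k f (t + 1) τ t * √(ρ x))
        + (a' x * (duhamelDx k f (t + 1) τ t * √(ρ x))
          + amp ρ x * (duhamelDxx k f (t + 1) τ t * √(ρ x) * √(ρ x)
            + duhamelDx k f (t + 1) τ t * σ' x)) := by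
    refine iteratedDeriv_two_eq (u₁ := fun z => a' z * duhamel k f (t + 1) (eikonal ρ z) t
      + amp ρ z * (duhamelDx k f (t + 1) (eikonal ρ z) t * √(ρ z))) ?_ ?_
    · filter_upwards [Ioi_mem_nhds hx] with z hz
      refine ((hda z hz).mul (hdu z hz)).congr_of_eventuallyEq ?_
      filter_upwards [Ioi_mem_nhds hz] with y hy
      exact wave_liouvilleKernel hρ hk hf.continuous hf0 hM (le_of_lt hy) (by linarith)
    · have h1 := (hasDerivAt_Ici (contDiffOn_derivWithin_Ici hρ.contDiffOn_amp) hx).mul (hdu x hx)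
      have h2 := (hda x hx).mul (hdu1.mul (hasDerivAt_Ici hρ.contDiffOn_sqrt hx))
      exact h1.add h2
  have e3 := wave_liouvilleKernel hρ hk hf.continuous hf0 hM hx.le (show t ≤ t + 1 by linarith)
  have hwo := duhamel_wave_operator hk.smooth hf hf0 hM hτ (show t - τ ≤ t + 1 by linarith)
    (liouvillePotential ρ q τ)
  have hz : conv (fun x y => 2 * dy (dx k) x y + (-1) * dx (dx k) x y
      + liouvillePotential ρ q τ * k x y) f (t + 1) τ (t - τ) = 0 := by
    rw [conv, intervalIntegral.integral_of_le hM]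
    refine setIntegral_eq_zero_of_forall_eq_zero fun η hη => ?_
    have := hk.pde τ η hτ hη.1
    have h' : 2 * dy (dx k) τ η + (-1) * dx (dx k) τ η + liouvillePotential ρ q τ * k τ η = 0 := by
      linarith
    simp only [h', zero_mul]
  rw [hz, hk.initial τ hτ] at hwo
  have hQ : liouvillePotential ρ q τ * ρ x * amp ρ x = q x * amp ρ x - a'' x := by
    have h1 := (hρ.pos x hx.le).ne'
    have h2 := (hρ.amp_pos hx.le).ne'
    simp only [liouvillePotential, hτdef, hρ.front_eikonal hx.le]
    field_simp
    rfl
  have htr := hρ.amp_transport hx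
  have hsq : √(ρ x) * √(ρ x) = ρ x := Real.mul_self_sqrt (hρ.pos x hx.le).le
  rw [e1, e2, e3]
  -- `htr` cancels the terms with the first space derivative
  linear_combination (ρ x * amp ρ x) * hwo - duhamelDx k f (t + 1) τ t * htr
    - (duhamel k f (t + 1) τ t) * hQ - amp ρ x * duhamelDxx k f (t + 1) τ t * hsq

theorem isWaveKernel_liouvilleKernel : IsWaveKernel ρ q (liouvilleKernel ρ k) where
  smooth := by
    have h1 : ContDiffOn ℝ ∞ (fun p : ℝ × ℝ => eikonal ρ p.1)
        {p : ℝ × ℝ | 0 ≤ p.1 ∧ eikonal ρ p.1 ≤ p.2} :=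
      hρ.contDiffOn_eikonal.comp contDiffOn_fst fun p hp => hp.1
    have h2 : ContDiffOn ℝ ∞ (fun p : ℝ × ℝ => amp ρ p.1)
        {p : ℝ × ℝ | 0 ≤ p.1 ∧ eikonal ρ p.1 ≤ p.2} :=
      hρ.contDiffOn_amp.comp contDiffOn_fst fun p hp => hp.1
    refine (h2.mul (hk.smooth.comp (h1.prodMk (contDiffOn_snd.sub h1)) ?_)).congr ?_
    · exact fun p hp => mem_quadrant.2 ⟨hρ.eikonal_nonneg hp.1, sub_nonneg.2 hp.2⟩
    · intro p hp
      simp [Function.uncurry, liouvilleKernel, hp.2]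
  vanish x t _ ht := by simp [liouvilleKernel, not_le.2 ht]
  duhamel f hf hf0 := by
    obtain ⟨ε, hε, hfε⟩ := hf0
    have hf0 : ∀ t ≤ 0, f t = 0 := fun t ht => hfε t (ht.trans hε.le)
    have hvan : ∀ x t, 0 ≤ x → t ≤ ε → wave ρ (liouvilleKernel ρ k) f x t = 0 := by
      intro x t hx ht
      have hτ := hρ.eikonal_nonneg hx
      rw [wave_liouvilleKernel hρ hk hf.continuous hf0 hε.le hx ht, duhamel, conv,
        hfε _ (by linarith)]
      rw [intervalIntegral.integral_congr (g := fun _ => 0) fun η hη => ?_]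
      · simp
      · rw [uIcc_of_le hε.le] at hη
        simp only
        rw [hfε _ (by linarith [hη.1]), mul_zero]
    refine ⟨?_, fun x t hx ht => liouvilleKernel_pde hρ hk hf hf0 hx ht,
      fun x hx => hvan x 0 hx hε.le, fun x hx => ?_, fun t ht => ?_⟩
    · intro p hp
      have hM : 0 < p.2 + 1 := by have : 0 ≤ p.2 := hp.2; linarith
      have h1 : ContDiffOn ℝ ∞ (fun p : ℝ × ℝ => eikonal ρ p.1) (Ici 0 ×ˢ Ici 0) :=
        hρ.contDiffOn_eikonal.comp contDiffOn_fst fun p hp => hp.1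
      have h2 : ContDiffOn ℝ ∞ (fun p : ℝ × ℝ => amp ρ p.1) (Ici 0 ×ˢ Ici 0) :=
        hρ.contDiffOn_amp.comp contDiffOn_fst fun p hp => hp.1
      have h3 : ContDiffOn ℝ ∞ (fun z : ℝ × ℝ =>
          amp ρ z.1 * duhamel k f (p.2 + 1) (eikonal ρ z.1) z.2) (Ici 0 ×ˢ Ici 0) :=
        h2.mul ((contDiffOn_duhamel hk.smooth hf hM).comp (h1.prodMk contDiffOn_snd)
          fun z hz => ⟨hρ.eikonal_nonneg hz.1, mem_univ _⟩)
      refine (h3 p hp).congr_of_eventuallyEq ?_ ?_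
      · have : ∀ᶠ z : ℝ × ℝ in 𝓝[Ici 0 ×ˢ Ici 0] p, z.2 < p.2 + 1 :=
          mem_nhdsWithin_of_mem_nhds ((isOpen_lt continuous_snd continuous_const).mem_nhds
            (by simp))
        filter_upwards [this, self_mem_nhdsWithin] with z hz hz0
        exact wave_liouvilleKernel hρ hk hf.continuous hf0 hM.le hz0.1 hz.le
      · exact wave_liouvilleKernel hρ hk hf.continuous hf0 hM.le hp.1 (by linarith)
    · refine (hasDerivWithinAt_const 0 (Ici 0) (0 : ℝ)).congr_of_eventuallyEq ?_
        (hvan x 0 hx hε.le)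
      filter_upwards [mem_nhdsWithin_of_mem_nhds (Iio_mem_nhds hε)] with t ht
      exact hvan x t hx (le_of_lt ht)
    · rw [wave_liouvilleKernel hρ hk hf.continuous hf0 (M := t) ht le_rfl le_rfl, hρ.amp_zero,
        eikonal_zero, duhamel, conv]
      rw [intervalIntegral.integral_congr (g := fun _ => 0) fun η hη => ?_]
      · simp
      · rw [uIcc_of_le ht] at hη
        simp [hk.boundary η hη.1]

end Existence

/-- Existence of the regular part of the fundamental solution. -/
theorem exists_isWaveKernel {ρ q : ℝ → ℝ} (hρ : IsDensity ρ) (hq : ContDiffOn ℝ ∞ q (Ici 0)) :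
    ∃ w : ℝ → ℝ → ℝ, IsWaveKernel ρ q w := by
  obtain ⟨k, hk⟩ := exists_isGoursat (contDiffOn_liouvillePotential hρ hq)
  exact ⟨_, isWaveKernel_liouvilleKernel hρ hk⟩

/-! ### The regular part in straightened coordinates -/

/-- The regular part in the coordinates `(x, η)`, `η = t - τ(x)`. -/
def straighten (ρ : ℝ → ℝ) (w : ℝ → ℝ → ℝ) (x η : ℝ) : ℝ := w x (eikonal ρ x + η)

theorem exists_pos_forall_le_eq_zero {f : ℝ → ℝ} {z : ℝ} (hf : tsupport f ⊆ Ioo 0 z) :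
    ∃ ε : ℝ, 0 < ε ∧ ∀ t : ℝ, t ≤ ε → f t = 0 := by
  have h0 : (tsupport f)ᶜ ∈ 𝓝 (0 : ℝ) :=
    (isClosed_tsupport f).isOpen_compl.mem_nhds fun h => lt_irrefl _ (hf h).1
  obtain ⟨δ, hδ, hball⟩ := Metric.mem_nhds_iff.1 h0
  refine ⟨δ / 2, by linarith, fun t ht => image_eq_zero_of_notMem_tsupport fun h => ?_⟩
  have h1 := (hf h).1
  exact hball (by rw [Metric.mem_ball, Real.dist_eq, sub_zero, abs_of_pos h1]; linarith) h

namespace IsWaveKernel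
variable {ρ q : ℝ → ℝ} {w : ℝ → ℝ → ℝ} (hw : IsWaveKernel ρ q w) (hρ : IsDensity ρ)
include hw hρ

theorem contDiffOn_straighten : ContDiffOn ℝ ∞ (Function.uncurry (straighten ρ w)) quadrant := by
  have h1 : ContDiffOn ℝ ∞ (fun p : ℝ × ℝ => eikonal ρ p.1) quadrant :=
    hρ.contDiffOn_eikonal.comp contDiffOn_fst fun p hp => hp.1
  exact hw.smooth.comp (contDiffOn_fst.prodMk (h1.add contDiffOn_snd)) fun p hp =>
    ⟨hp.1, le_add_of_nonneg_right hp.2⟩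

theorem wave_eq {f : ℝ → ℝ} (hf : Continuous f) (hf0 : ∀ t ≤ 0, f t = 0) {M x t : ℝ}
    (hM : 0 ≤ M) (hx : 0 ≤ x) (ht : t - eikonal ρ x ≤ M) :
    wave ρ w f x t = amp ρ x * f (t - eikonal ρ x)
      + conv (straighten ρ w) f M x (t - eikonal ρ x) :=
  wave_eq_conv hf0 hf
    (continuousOn_section (hw.contDiffOn_straighten hρ).continuousOn hx) hM ht

/-- The regular part vanishes at `x = 0`, because the boundary condition `u = f` is met by the
singular part alone. -/
theorem straighten_zero {η : ℝ} (hη : 0 ≤ η) : straighten ρ w 0 η = 0 := by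
  have hs := (hw.contDiffOn_straighten hρ).continuousOn
  have hz : 0 < η + 1 := by linarith
  refine eq_zero_of_forall_integral_conv hz
    ((continuousOn_section hs le_rfl).mono Icc_subset_Ici_self) (fun f hf _ hfs => ?_) η
    ⟨hη, by linarith⟩
  obtain ⟨ε, hε, hfε⟩ := exists_pos_forall_le_eq_zero hfs
  have h1 := (hw.duhamel f hf ⟨ε, hε, hfε⟩).boundary (η + 1) hz.le
  rw [hw.wave_eq hρ hf.continuous (fun t ht => hfε t (ht.trans hε.le)) hz.le le_rfl (by simp),
    hρ.amp_zero, eikonal_zero, sub_zero] at h1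
  simpa [conv] using h1

end IsWaveKernel

section UnitDensity
variable {ρ q : ℝ → ℝ} {w : ℝ → ℝ → ℝ}

theorem eikonal_of_one (h1 : ∀ x, 0 ≤ x → ρ x = 1) {x : ℝ} (hx : 0 ≤ x) : eikonal ρ x = x := by
  rw [eikonal, intervalIntegral.integral_congr (g := fun _ => (1 : ℝ)) fun s hs => ?_]
  · simp
  · rw [uIcc_of_le hx] at hs
    simp [h1 s hs.1]

theorem amp_of_one (h1 : ∀ x, 0 ≤ x → ρ x = 1) {x : ℝ} (hx : 0 ≤ x) : amp ρ x = 1 := by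
  simp [amp, h1 x hx, h1 0 le_rfl]

theorem front_of_one (hρ : IsDensity ρ) (h1 : ∀ x, 0 ≤ x → ρ x = 1) {t : ℝ} (ht : 0 ≤ t) :
    front ρ t = t := by
  rw [← eikonal_of_one h1 (hρ.front_nonneg ht), hρ.eikonal_front ht]

/-- For unit density, the Duhamel property of a kernel forces the characteristic problem: the
expression of `duhamel_wave_operator` vanishes for all controls. -/
theorem isGoursat_straighten (hw : IsWaveKernel ρ q w) (hρ : IsDensity ρ)
    (h1 : ∀ x, 0 ≤ x → ρ x = 1) :
    IsGoursat q (straighten ρ w) := by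
  have hs := hw.contDiffOn_straighten hρ
  have key : ∀ (f : ℝ → ℝ), ContDiff ℝ ∞ f → (∃ ε : ℝ, 0 < ε ∧ ∀ t : ℝ, t ≤ ε → f t = 0) →
      ∀ x z, 0 < x → 0 < z → (2 * dx (straighten ρ w) x 0 + q x) * f z
        + conv (fun x y => 2 * dy (dx (straighten ρ w)) x y + (-1) * dx (dx (straighten ρ w)) x y
          + q x * straighten ρ w x y) f z x z = 0 := by
    intro f hf hfε x z hx hz
    have hu := hw.duhamel f hf hfε
    obtain ⟨ε, hε, hfε⟩ := hfε
    have hf0 : ∀ t ≤ 0, f t = 0 := fun t ht => hfε t (ht.trans hε.le)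
    set t := z + x with ht
    have hM : 0 ≤ t + 1 := by linarith
    have hwd : ∀ y s, 0 ≤ y → s ≤ t + 1 →
        wave ρ w f y s = duhamel (straighten ρ w) f (t + 1) y s := by
      intro y s hy hs
      rw [hw.wave_eq hρ hf.continuous hf0 hM hy (by rw [eikonal_of_one h1 hy]; linarith),
        amp_of_one h1 hy, eikonal_of_one h1 hy, one_mul, duhamel]
    have hp := hu.pde x t hx (by linarith)
    have e1 : (fun s => wave ρ w f x s) =ᶠ[𝓝 t]
        fun s => duhamel (straighten ρ w) f (t + 1) x s := by
      filter_upwards [Iio_mem_nhds (show t < t + 1 by linarith)] with s hs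
      exact hwd x s hx.le (le_of_lt hs)
    have e2 : (fun y => wave ρ w f y t) =ᶠ[𝓝 x]
        fun y => duhamel (straighten ρ w) f (t + 1) y t := by
      filter_upwards [Ioi_mem_nhds hx] with y hy
      exact hwd y t (le_of_lt hy) (by linarith)
    have e3 : iteratedDeriv 2 (fun y => duhamel (straighten ρ w) f (t + 1) y t) x
        = duhamelDxx (straighten ρ w) f (t + 1) x t :=
      iteratedDeriv_two_eq (by
        filter_upwards [Ioi_mem_nhds hx] with y hy using hasDerivAt_duhamel hs hf hM hy t)
        (hasDerivAt_duhamelDx hs hf hM hx t)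
    rw [e1.iteratedDeriv_eq, e2.iteratedDeriv_eq, e3,
      iteratedDeriv_duhamel_time hs hf hM hx.le, hwd x t hx.le (by linarith), h1 x hx.le, one_mul,
      duhamel_wave_operator hs hf hf0 hM hx (by linarith), ht, add_sub_cancel_right] at hp
    refine Eq.trans ?_ hp
    congr 1
    refine (conv_eq_of_le hf0 hf.continuous ?_ hz.le (by linarith : z ≤ z + x + 1)).symm
    have hkx := contDiffOn_dx hs
    exact (((continuousOn_section (contDiffOn_dy hkx).continuousOn hx.le).const_smul (2 : ℝ)).add
      ((continuousOn_section (contDiffOn_dx hkx).continuousOn hx.le).const_smul (-1 : ℝ))).add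
      ((continuousOn_section hs.continuousOn hx.le).const_smul (q x))
  have hm : ∀ x, 0 < x → ContinuousOn (fun η => 2 * dy (dx (straighten ρ w)) x η
      + (-1) * dx (dx (straighten ρ w)) x η + q x * straighten ρ w x η) (Ici 0) := by
    intro x hx
    have hkx := contDiffOn_dx hs
    exact (((continuousOn_section (contDiffOn_dy hkx).continuousOn hx.le).const_smul (2 : ℝ)).add
      ((continuousOn_section (contDiffOn_dx hkx).continuousOn hx.le).const_smul (-1 : ℝ))).add
      ((continuousOn_section hs.continuousOn hx.le).const_smul (q x))
  -- controls supported inside `(0, z)` see only the integral term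
  have hpde : ∀ x z, 0 < x → 0 < z → ∀ η ∈ Icc 0 z, 2 * dy (dx (straighten ρ w)) x η
      + (-1) * dx (dx (straighten ρ w)) x η + q x * straighten ρ w x η = 0 := by
    intro x z hx hz
    refine eq_zero_of_forall_integral_conv hz ((hm x hx).mono Icc_subset_Ici_self)
      fun f hf _ hfs => ?_
    have := key f hf (exists_pos_forall_le_eq_zero hfs) x z hx hz
    rw [image_eq_zero_of_notMem_tsupport fun h => lt_irrefl _ (hfs h).2, mul_zero, zero_add] at this
    exact this
  refine ⟨hs, fun η hη => hw.straighten_zero hρ hη, fun x hx => ?_, fun x y hx hy => ?_⟩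
  -- a control equal to `1` at time `2`; the integral term is already known to vanish
  · have h2 := key (fun t => Real.smoothTransition (t - 1)) (Real.smoothTransition.contDiff.comp
      (by fun_prop)) ⟨1, one_pos, fun t ht => Real.smoothTransition.zero_of_nonpos (by linarith)⟩
      x 2 hx two_pos
    have h3 : ∀ f : ℝ → ℝ, conv (fun x y => 2 * dy (dx (straighten ρ w)) x y
        + (-1) * dx (dx (straighten ρ w)) x y + q x * straighten ρ w x y) f 2 x 2 = 0 := by
      intro f
      rw [conv, intervalIntegral.integral_congr (g := fun _ => 0) fun η hη => ?_]
      · simp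
      · rw [uIcc_of_le two_pos.le] at hη
        simp only [hpde x 2 hx two_pos η hη, zero_mul]
    rw [h3, Real.smoothTransition.one_of_one_le (by norm_num)] at h2
    linarith
  · have := hpde x y hx hy y ⟨hy.le, le_rfl⟩
    linarith

end UnitDensity

/-! ### Volterra operators in `L₂(0, T)` -/

/-- The Volterra integral `∫₀ᵗ k(t, s) f(s) ds`. -/
def volt (k : ℝ → ℝ → ℝ) (f : ℝ → ℝ) (t : ℝ) : ℝ := ∫ s in (0 : ℝ)..t, k t s * f s

section Volterra
variable {T : ℝ}

theorem intervalIntegrable_of_timeMeasure {f : ℝ → ℝ} (hf : Integrable f (timeMeasure T)) {a b : ℝ}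
    (ha : 0 ≤ a) (hab : a ≤ b) (hb : b ≤ T) : IntervalIntegrable f volume a b := by
  rw [intervalIntegrable_iff_integrableOn_Ioo_of_le hab]
  exact IntegrableOn.mono_set (t := Ioo 0 T) hf (Ioo_subset_Ioo ha hb)

theorem integrable_of_outer (f : Outer T) : Integrable f (timeMeasure T) :=
  (Lp.memLp f).integrable one_le_two

theorem ae_mem_uIoc {p : ℝ → Prop} (h : ∀ᵐ s ∂(timeMeasure T), p s) {t : ℝ} (ht : t ∈ Icc 0 T) :
    ∀ᵐ s ∂volume, s ∈ uIoc 0 t → p s := by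
  rw [ae_restrict_iff' measurableSet_Ioo] at h
  have hT : ∀ᵐ s ∂(volume : Measure ℝ), s ≠ T := by simp [ae_iff]
  filter_upwards [h, hT] with s hs hsT hmem
  rw [uIoc_of_le ht.1] at hmem
  exact hs ⟨hmem.1, lt_of_le_of_ne (hmem.2.trans ht.2) hsT⟩

theorem volt_congr_ae {k : ℝ → ℝ → ℝ} {f g : ℝ → ℝ} (h : f =ᵐ[timeMeasure T] g) {t : ℝ}
    (ht : t ∈ Icc 0 T) : volt k f t = volt k g t := by
  refine intervalIntegral.integral_congr_ae ?_
  filter_upwards [ae_mem_uIoc h ht] with s hs hmem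
  rw [hs hmem]

theorem intervalIntegrable_volt {k : ℝ → ℝ → ℝ} (hk : Continuous (Function.uncurry k)) {f : ℝ → ℝ}
    (hf : Integrable f (timeMeasure T)) {t : ℝ} (ht : t ∈ Icc 0 T) :
    IntervalIntegrable (fun s => k t s * f s) volume 0 t :=
  (intervalIntegrable_of_timeMeasure hf le_rfl ht.1 ht.2).continuousOn_mul
    (hk.comp (f := fun s => (t, s)) (by fun_prop)).continuousOn

theorem volt_add {k : ℝ → ℝ → ℝ} (hk : Continuous (Function.uncurry k)) {f g : ℝ → ℝ}
    (hf : Integrable f (timeMeasure T)) (hg : Integrable g (timeMeasure T)) {t : ℝ}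
    (ht : t ∈ Icc 0 T) : volt k (f + g) t = volt k f t + volt k g t := by
  rw [volt, volt, volt, ← intervalIntegral.integral_add (intervalIntegrable_volt hk hf ht)
    (intervalIntegrable_volt hk hg ht)]
  simp only [Pi.add_apply, mul_add]

theorem volt_smul (k : ℝ → ℝ → ℝ) (c : ℝ) (f : ℝ → ℝ) (t : ℝ) :
    volt k (c • f) t = c * volt k f t := by
  rw [volt, volt, ← intervalIntegral.integral_const_mul]
  simp only [Pi.smul_apply, smul_eq_mul, mul_left_comm]

theorem exists_bound_square {k : ℝ → ℝ → ℝ} (hk : Continuous (Function.uncurry k)) (T : ℝ) :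
    ∃ C, 0 ≤ C ∧ ∀ t s, 0 ≤ t → t ≤ T → 0 ≤ s → s ≤ T → |k t s| ≤ C := by
  obtain ⟨C, hC⟩ := (isCompact_Icc (a := ((0 : ℝ), (0 : ℝ)))
    (b := (T, T))).exists_bound_of_continuousOn hk.continuousOn
  exact ⟨max C 0, le_max_right _ _, fun t s ht htT hs hsT =>
    (hC (t, s) ⟨⟨ht, hs⟩, ⟨htT, hsT⟩⟩).trans (le_max_left _ _)⟩

/-- The Volterra integral over a domain that does not depend on `t`. -/
theorem volt_eq_setIntegral (k : ℝ → ℝ → ℝ) (f : ℝ → ℝ) {t : ℝ} (ht : t ∈ Icc 0 T) :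
    volt k f t = ∫ s, (Iio t).indicator (fun s => k t s * f s) s ∂(timeMeasure T) := by
  rw [volt, intervalIntegral.integral_of_le ht.1, integral_Ioc_eq_integral_Ioo,
    setIntegral_indicator measurableSet_Iio]
  congr 2
  ext s
  simp only [mem_Ioo, mem_inter_iff, mem_Iio]
  constructor
  · rintro ⟨a, b⟩; exact ⟨⟨a, b.trans_le ht.2⟩, b⟩
  · rintro ⟨⟨a, _⟩, b⟩; exact ⟨a, b⟩

theorem abs_volt_le {k : ℝ → ℝ → ℝ} {C : ℝ}
    (hC : ∀ t s, 0 ≤ t → t ≤ T → 0 ≤ s → s ≤ T → |k t s| ≤ C) {f : ℝ → ℝ}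
    (hf : Integrable f (timeMeasure T)) {t : ℝ} (ht : t ∈ Icc 0 T) :
    |volt k f t| ≤ C * ∫ s, |f s| ∂(timeMeasure T) := by
  rw [volt_eq_setIntegral k f ht, ← integral_const_mul]
  refine norm_integral_le_of_norm_le (G := ℝ) (f := (Iio t).indicator fun s => k t s * f s)
    (hf.abs.const_mul C) ?_
  filter_upwards [ae_restrict_mem measurableSet_Ioo] with s hs
  have h1 := hC t s ht.1 ht.2 hs.1.le hs.2.le
  by_cases hst : s ∈ Iio t
  · rw [indicator_of_mem hst, Real.norm_eq_abs, abs_mul]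
    gcongr
  · rw [indicator_of_notMem hst, norm_zero]
    have := (abs_nonneg _).trans h1
    positivity

theorem continuousOn_volt {k : ℝ → ℝ → ℝ} (hk : Continuous (Function.uncurry k)) {f : ℝ → ℝ}
    (hf : Integrable f (timeMeasure T)) : ContinuousOn (volt k f) (Icc 0 T) := by
  obtain ⟨C, hC0, hC⟩ := exists_bound_square hk T
  intro t₀ ht₀
  have hkt : ∀ t, Continuous fun s => k t s := fun t => hk.comp (f := fun s => (t, s)) (by fun_prop)
  have h1 : ContinuousWithinAt
      (fun t => ∫ s, (Iio t).indicator (fun s => k t s * f s) s ∂(timeMeasure T)) (Icc 0 T) t₀ := by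
    refine continuousWithinAt_of_dominated (bound := fun s => C * |f s|) ?_ ?_
      (hf.abs.const_mul C) ?_
    · refine Eventually.of_forall fun t => ?_
      exact ((hkt t).aestronglyMeasurable.mul hf.aestronglyMeasurable).indicator measurableSet_Iio
    · filter_upwards [self_mem_nhdsWithin] with t ht
      filter_upwards [ae_restrict_mem measurableSet_Ioo] with s hs
      have h1 := hC t s ht.1 ht.2 hs.1.le hs.2.le
      by_cases hst : s ∈ Iio t
      · rw [indicator_of_mem hst, Real.norm_eq_abs, abs_mul]
        gcongr
      · rw [indicator_of_notMem hst, norm_zero]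
        positivity
    -- for `s ≠ t₀` the integrand is continuous in `t` at `t₀`
    · have hne : ∀ᵐ s ∂(timeMeasure T), s ≠ t₀ :=
        ae_restrict_of_ae (by simp [ae_iff])
      filter_upwards [hne] with s hs
      have hks : Continuous fun t => k t s * f s :=
        (hk.comp (f := fun t => (t, s)) (by fun_prop)).mul continuous_const
      rcases lt_or_gt_of_ne hs with h | h
      · refine (hks.continuousAt.congr ?_).continuousWithinAt
        filter_upwards [Ioi_mem_nhds h] with t ht
        exact (indicator_of_mem (show s ∈ Iio t from ht) fun s => k t s * f s).symm
      · refine (continuousAt_const (y := (0 : ℝ)).congr ?_).continuousWithinAt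
        filter_upwards [Iio_mem_nhds h] with t ht
        exact (indicator_of_notMem
          (show s ∉ Iio t from fun h' => lt_asymm (mem_Iio.1 h') (mem_Iio.1 ht))
          fun s => k t s * f s).symm
  exact h1.congr (fun t ht => volt_eq_setIntegral k f ht) (volt_eq_setIntegral k f ht₀)

theorem memLp_of_continuousOn {f : ℝ → ℝ} (hf : ContinuousOn f (Icc 0 T)) :
    MemLp f 2 (timeMeasure T) := by
  obtain ⟨C, hC⟩ := isCompact_Icc.exists_bound_of_continuousOn hf
  refine MemLp.of_bound ((hf.mono Ioo_subset_Icc_self).aestronglyMeasurable measurableSet_Ioo) C ?_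
  filter_upwards [ae_restrict_mem measurableSet_Ioo] with s hs
  exact hC s (Ioo_subset_Icc_self hs)

/-- The embedding of `L₂(0, T)` into `L₁(0, T)`. -/
theorem exists_integral_abs_le (T : ℝ) :
    ∃ C, 0 ≤ C ∧ ∀ f : Outer T, ∫ s, |f s| ∂(timeMeasure T) ≤ C * ‖f‖ := by
  refine ⟨(timeMeasure T univ ^ (1 / (1 : ENNReal).toReal - 1 / (2 : ENNReal).toReal)).toReal,
    by positivity, fun f => ?_⟩
  have h1 := eLpNorm_le_eLpNorm_mul_rpow_measure_univ (μ := timeMeasure T) (p := 1) (q := 2)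
    one_le_two (Lp.aestronglyMeasurable f)
  have h2 : ∫ s, |f s| ∂(timeMeasure T) = (eLpNorm f 1 (timeMeasure T)).toReal := by
    rw [eLpNorm_one_eq_lintegral_enorm, ← integral_norm_eq_lintegral_enorm
      (Lp.aestronglyMeasurable f)]
    rfl
  rw [h2, Lp.norm_def, mul_comm, ← ENNReal.toReal_mul]
  refine ENNReal.toReal_mono (ENNReal.mul_ne_top (Lp.eLpNorm_ne_top f) ?_) h1
  refine ENNReal.rpow_ne_top_of_nonneg (by norm_num) ?_
  exact measure_ne_top _ _

theorem memLp_volt {k : ℝ → ℝ → ℝ} (hk : Continuous (Function.uncurry k)) (f : Outer T) :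
    MemLp (volt k f) 2 (timeMeasure T) :=
  memLp_of_continuousOn (continuousOn_volt hk (integrable_of_outer f))

/-- A Volterra operator with continuous kernel, as a bounded operator of `L₂(0, T)`. -/
def voltL (T : ℝ) (k : ℝ → ℝ → ℝ) (hk : Continuous (Function.uncurry k)) : Outer T →L[ℝ] Outer T :=
  LinearMap.mkContinuousOfExistsBound
    { toFun := fun f => (memLp_volt hk f).toLp _
      map_add' := fun f g => by
        rw [← MemLp.toLp_add]
        refine MemLp.toLp_congr _ _ ?_
        filter_upwards [ae_restrict_mem measurableSet_Ioo] with t ht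
        have ht' := Ioo_subset_Icc_self ht
        rw [volt_congr_ae (Lp.coeFn_add f g) ht',
          volt_add hk (integrable_of_outer f) (integrable_of_outer g) ht']
        rfl
      map_smul' := fun c f => by
        rw [RingHom.id_apply, ← MemLp.toLp_const_smul]
        refine MemLp.toLp_congr _ _ ?_
        filter_upwards [ae_restrict_mem measurableSet_Ioo] with t ht
        rw [volt_congr_ae (Lp.coeFn_smul c f) (Ioo_subset_Icc_self ht), volt_smul]
        rfl } <| by
    obtain ⟨C, hC0, hC⟩ := exists_bound_square hk T
    obtain ⟨D, hD0, hD⟩ := exists_integral_abs_le T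
    refine ⟨measureUnivNNReal (timeMeasure T) ^ (2 : ENNReal).toReal⁻¹ * (C * D), fun f => ?_⟩
    have h1 : ∀ᵐ t ∂(timeMeasure T), ‖(memLp_volt hk f).toLp _ t‖ ≤ C * (D * ‖f‖) := by
      filter_upwards [ae_restrict_mem measurableSet_Ioo, (memLp_volt hk f).coeFn_toLp] with t ht he
      rw [he]
      refine (abs_volt_le hC (integrable_of_outer f) (Ioo_subset_Icc_self ht)).trans ?_
      gcongr
      exact hD f
    have h2 := Lp.norm_le_of_ae_bound (by positivity) h1
    calc _ ≤ _ := h2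
      _ = _ := by ring

theorem voltL_ae {k : ℝ → ℝ → ℝ} (hk : Continuous (Function.uncurry k)) (f : Outer T) :
    voltL T k hk f =ᵐ[timeMeasure T] volt k f := (memLp_volt hk f).coeFn_toLp

theorem isVolterra_volt {k : ℝ → ℝ → ℝ} (hk : Continuous (Function.uncurry k)) :
    IsVolterra fun u x η => -volt k (u x) η where
  continuous u hu := by
    refine Continuous.neg ?_
    exact intervalIntegral.continuous_parametric_intervalIntegral_of_continuous
      (f := fun (p : ℝ × ℝ) s => k p.2 s * u p.1 s)
      ((hk.comp (f := fun z : (ℝ × ℝ) × ℝ => (z.1.2, z.2)) (by fun_prop)).mul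
        (hu.comp (f := fun z : (ℝ × ℝ) × ℝ => (z.1.1, z.2)) (by fun_prop))) continuous_snd
  sub u v hu hv x y := by
    have hi : ∀ u : ℝ → ℝ → ℝ, Continuous (Function.uncurry u) →
        IntervalIntegrable (fun s => k y s * u x s) volume 0 y := fun u hu =>
      ((hk.comp (f := fun s => (y, s)) (by fun_prop)).mul
        (hu.comp (f := fun s => (x, s)) (by fun_prop))).intervalIntegrable _ _
    simp only [volt, Pi.sub_apply, mul_sub]
    rw [intervalIntegral.integral_sub (hi u hu) (hi v hv)]
    ring
  bound N := by
    obtain ⟨C, hC0, hC⟩ := exists_bound_square hk N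
    refine ⟨C, hC0, fun u _ n c hc hb x y hx hy hxy => ?_⟩
    rw [abs_neg]
    refine abs_integral_le_of_le_pow hy fun θ hθ0 hθy => ?_
    rw [abs_mul, mul_assoc]
    gcongr
    · exact hC y θ hy (by linarith) hθ0 (by linarith)
    · exact hb x θ hx hθ0 (by linarith)

/-- The extension of a function on `[0, T]` to the line by its values at the end points. -/
def clampIcc (T : ℝ) (f : ℝ → ℝ) (t : ℝ) : ℝ := f (max 0 (min t T))

theorem clampIcc_eq {f : ℝ → ℝ} {t : ℝ} (ht : t ∈ Icc 0 T) : clampIcc T f t = f t := by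
  simp [clampIcc, ht.1, ht.2]

theorem continuous_clampIcc {f : ℝ → ℝ} (hT : 0 ≤ T) (hf : ContinuousOn f (Icc 0 T)) :
    Continuous (clampIcc T f) :=
  hf.comp_continuous (f := fun t => max 0 (min t T)) (by fun_prop)
    fun t => mem_Icc.2 ⟨le_max_left _ _, max_le hT (min_le_right _ _)⟩

/-- `1 + K` is bijective for a Volterra operator `K` with continuous kernel. Elements of `L₂`
reduce to continuous functions, because `K` maps into them. -/
theorem bijective_one_add_voltL (hT : 0 ≤ T) {k : ℝ → ℝ → ℝ}
    (hk : Continuous (Function.uncurry k)) :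
    Function.Bijective (1 + voltL T k hk : Outer T →L[ℝ] Outer T) := by
  have hB := isVolterra_volt hk
  constructor
  · rw [injective_iff_map_eq_zero]
    intro f hf
    have h1 : f =ᵐ[timeMeasure T] fun t => -volt k f t := by
      have h2 : f = -voltL T k hk f := eq_neg_of_add_eq_zero_left hf
      have h3 : (f : ℝ → ℝ) =ᵐ[timeMeasure T] (-voltL T k hk f : Outer T) := by rw [← h2]
      filter_upwards [h3, Lp.coeFn_neg (voltL T k hk f), voltL_ae hk f] with t e1 e2 e3
      rw [e1, e2, Pi.neg_apply, e3]
    set b : ℝ → ℝ := fun t => -volt k f t with hb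
    have hbc : ContinuousOn b (Icc 0 T) := (continuousOn_volt hk (integrable_of_outer f)).neg
    have hbb : ∀ t ∈ Icc 0 T, b t = -volt k b t := fun t ht => by
      rw [← volt_congr_ae h1 ht]
    have hz : ∀ t ∈ Icc 0 T, b t = 0 := by
      intro t ht
      have := hB.eq_zero (u := fun _ => clampIcc T b) (N := T)
        ((continuous_clampIcc hT hbc).comp continuous_snd) (fun x y hx hy hxy => ?_)
        (x := 0) (y := t) le_rfl ht.1 (by linarith [ht.2])
      · rwa [clampIcc_eq ht] at this
      · have hy' : y ∈ Icc 0 T := ⟨hy, by linarith⟩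
        rw [clampIcc_eq hy', hbb y hy']
        congr 1
        refine intervalIntegral.integral_congr fun s hs => ?_
        rw [uIcc_of_le hy] at hs
        rw [clampIcc_eq ⟨hs.1, hs.2.trans hy'.2⟩]
    apply Lp.ext
    filter_upwards [h1, Lp.coeFn_zero ℝ 2 (timeMeasure T), ae_restrict_mem measurableSet_Ioo]
      with t e1 e2 ht
    rw [e1, e2, hz t (Ioo_subset_Icc_self ht), Pi.zero_apply]
  · intro g
    have hgc := continuousOn_volt hk (integrable_of_outer g)
    obtain ⟨u, hu, hue⟩ := hB.exists_solution
      (u₀ := fun _ => clampIcc T (volt k g)) ((continuous_clampIcc hT hgc).comp continuous_snd)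
    set h : ℝ → ℝ := u 0 with hh
    have hhc : Continuous h := hu.comp (f := fun s => ((0 : ℝ), s)) (by fun_prop)
    have hhe : ∀ t ∈ Icc 0 T, h t = volt k g t - volt k h t := fun t ht => by
      have := hue 0 t le_rfl ht.1
      rw [clampIcc_eq ht] at this
      rw [hh, this]; ring
    have hhm : MemLp h 2 (timeMeasure T) := memLp_of_continuousOn hhc.continuousOn
    -- `h` solves `h + K h = K g`, hence `(1 + K)(g - h) = g`
    refine ⟨g - hhm.toLp h, ?_⟩
    apply Lp.ext
    have hint : Integrable h (timeMeasure T) := hhm.integrable one_le_two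
    have e0 : (g - hhm.toLp h : Outer T) =ᵐ[timeMeasure T] (g + (-1 : ℝ) • h : ℝ → ℝ) := by
      filter_upwards [Lp.coeFn_sub g (hhm.toLp h), hhm.coeFn_toLp] with t e1 e2
      rw [e1, Pi.sub_apply, e2]; simp [sub_eq_add_neg]
    filter_upwards [Lp.coeFn_add (g - hhm.toLp h) (voltL T k hk (g - hhm.toLp h)), e0,
      voltL_ae hk (g - hhm.toLp h), ae_restrict_mem measurableSet_Ioo] with t e1 e2 e3 ht
    have ht' := Ioo_subset_Icc_self ht
    have e4 : (1 + voltL T k hk : Outer T →L[ℝ] Outer T) (g - hhm.toLp h)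
        = (g - hhm.toLp h) + voltL T k hk (g - hhm.toLp h) := rfl
    rw [e4, e1, Pi.add_apply, e2, e3, volt_congr_ae e0 ht',
      volt_add hk (integrable_of_outer g) (hint.smul (-1 : ℝ)) ht', volt_smul, Pi.add_apply,
      Pi.smul_apply, hhe t ht', smul_eq_mul]
    ring

end Volterra
/-! ### The control operator -/

/-- The measure `√ρ dx` on `(0, x(T))`, which the eikonal carries to Lebesgue measure. -/
def eikonalMeasure (ρ : ℝ → ℝ) (T : ℝ) : Measure ℝ :=
  (volume.restrict (Ioo 0 (front ρ T))).withDensity fun x => ENNReal.ofReal √(ρ x)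

/-- The delay `T - τ(x)`, extended to negative `x` by a constant, which makes it continuous on the
line. -/
def delay (ρ : ℝ → ℝ) (T x : ℝ) : ℝ := T - eikonal ρ (max x 0)

/-- The inverse `x(T - t)` of the delay, extended by a constant to `t > T`. -/
def place (ρ : ℝ → ℝ) (T t : ℝ) : ℝ := front ρ (max (T - t) 0)

theorem withDensity_le_smul_of_le {μ : Measure ℝ} {s : Set ℝ} (hs : MeasurableSet s) {f g : ℝ → ℝ}
    {c : ℝ} (hc : 0 ≤ c) (hfg : ∀ x ∈ s, f x ≤ c * g x) :
    (μ.restrict s).withDensity (fun x => ENNReal.ofReal (f x))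
      ≤ ENNReal.ofReal c • (μ.restrict s).withDensity (fun x => ENNReal.ofReal (g x)) := by
  rw [← withDensity_smul' _ _ ENNReal.ofReal_ne_top]
  refine withDensity_mono ?_
  filter_upwards [ae_restrict_mem hs] with x hx
  rw [Pi.smul_apply, smul_eq_mul, ← ENNReal.ofReal_mul hc]
  exact ENNReal.ofReal_le_ofReal (hfg x hx)

theorem ae_mem_Ioo_eikonalMeasure (ρ : ℝ → ℝ) (T : ℝ) :
    ∀ᵐ x ∂(eikonalMeasure ρ T), x ∈ Ioo 0 (front ρ T) :=
  (withDensity_absolutelyContinuous _ _).ae_le (ae_restrict_mem measurableSet_Ioo)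

theorem ae_mem_Ioo_spaceMeasure (ρ : ℝ → ℝ) (T : ℝ) :
    ∀ᵐ x ∂(spaceMeasure ρ T), x ∈ Ioo 0 (front ρ T) :=
  (withDensity_absolutelyContinuous _ _).ae_le (ae_restrict_mem measurableSet_Ioo)

section
variable {ρ : ℝ → ℝ} (hρ : IsDensity ρ) {T : ℝ}
include hρ

theorem continuous_delay (T : ℝ) : Continuous (delay ρ T) :=
  continuous_const.sub (hρ.contDiffOn_eikonal.continuousOn.comp_continuous
    (f := fun x => max x 0) (by fun_prop) fun x => mem_Ici.2 (le_max_right x 0))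

theorem continuous_place (T : ℝ) : Continuous (place ρ T) :=
  hρ.continuousOn_front.comp_continuous (f := fun t => max (T - t) 0) (by fun_prop)
    fun t => mem_Ici.2 (le_max_right _ 0)

theorem place_nonneg (T t : ℝ) : 0 ≤ place ρ T t := hρ.front_nonneg (le_max_right _ _)

theorem delay_mem_Ioo (hT : 0 < T) {x : ℝ} (hx : x ∈ Ioo 0 (front ρ T)) :
    delay ρ T x ∈ Ioo 0 T := by
  have h1 := (hρ.eikonal_lt_iff hx.1.le hT.le).2 hx.2
  have h2 := hρ.eikonal_pos hx.1
  rw [delay, max_eq_left hx.1.le]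
  exact ⟨by linarith, by linarith⟩

theorem place_delay {x : ℝ} (hx : x ∈ Ioo 0 (front ρ T)) :
    place ρ T (delay ρ T x) = x := by
  rw [place, delay, max_eq_left hx.1.le, sub_sub_cancel, max_eq_left (hρ.eikonal_nonneg hx.1.le),
    hρ.front_eikonal hx.1.le]

theorem image_delay (hT : 0 < T) : delay ρ T '' Ioo 0 (front ρ T) = Ioo 0 T := by
  ext t
  constructor
  · rintro ⟨x, hx, rfl⟩
    exact delay_mem_Ioo hρ hT hx
  · intro ht
    have h0 : 0 < T - t := by linarith [ht.2]
    refine ⟨front ρ (T - t), ⟨hρ.front_pos h0, ?_⟩, ?_⟩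
    · rw [← hρ.eikonal_lt_iff (hρ.front_nonneg h0.le) hT.le, hρ.eikonal_front h0.le]
      linarith [ht.1]
    · rw [delay, max_eq_left (hρ.front_nonneg h0.le), hρ.eikonal_front h0.le]; ring

/-- Change of variable `t = T - τ(x)`. -/
theorem measurePreserving_delay (hT : 0 < T) :
    MeasurePreserving (delay ρ T) (eikonalMeasure ρ T) (timeMeasure T) := by
  refine ⟨(continuous_delay hρ T).measurable, ?_⟩
  have hd : ∀ x ∈ Ioo 0 (front ρ T), HasFDerivWithinAt (delay ρ T)
      (ContinuousLinearMap.toSpanSingleton ℝ (-√(ρ x))) (Ioo 0 (front ρ T)) x := by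
    intro x hx
    have h1 := ((hρ.hasDerivWithinAt_eikonal hx.1.le).mono
      (Ioo_subset_Ioi_self.trans Ioi_subset_Ici_self : Ioo 0 (front ρ T) ⊆ Ici 0)).const_sub T
    refine (h1.congr (fun y hy => ?_) ?_).hasFDerivWithinAt
    · rw [delay, max_eq_left hy.1.le]
    · rw [delay, max_eq_left hx.1.le]
  have hinj : InjOn (delay ρ T) (Ioo 0 (front ρ T)) := fun x hx y hy h => by
    rw [← place_delay hρ hx, h, place_delay hρ hy]
  have h := map_withDensity_abs_det_fderiv_eq_addHaar volume
    (measurableSet_Ioo (a := (0 : ℝ)) (b := front ρ T)).nullMeasurableSet hd hinj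
  rw [image_delay hρ hT] at h
  refine Eq.trans ?_ h
  rw [eikonalMeasure]
  congr 2
  ext x
  simp [abs_of_nonneg (Real.sqrt_nonneg _)]

theorem measurePreserving_place (hT : 0 < T) :
    MeasurePreserving (place ρ T) (timeMeasure T) (eikonalMeasure ρ T) := by
  have hm := (continuous_place hρ T).measurable
  refine ⟨hm, ?_⟩
  rw [← (measurePreserving_delay hρ hT).map_eq,
    Measure.map_map hm (continuous_delay hρ T).measurable]
  have : place ρ T ∘ delay ρ T =ᵐ[eikonalMeasure ρ T] id := by
    filter_upwards [ae_mem_Ioo_eikonalMeasure ρ T] with x hx using place_delay hρ hx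
  rw [Measure.map_congr this, Measure.map_id]

/-- On `(0, x(T))` the densities `ρ` and `√ρ` are comparable, so that the corresponding `L₂` spaces
coincide. -/
theorem exists_spaceMeasure_le : ∃ c : ENNReal, c ≠ ⊤ ∧
    spaceMeasure ρ T ≤ c • eikonalMeasure ρ T ∧ eikonalMeasure ρ T ≤ c • spaceMeasure ρ T := by
  have hsub : Icc 0 (front ρ T) ⊆ Ici 0 := Icc_subset_Ici_self
  obtain ⟨C, hC⟩ := (isCompact_Icc (a := (0 : ℝ)) (b := front ρ T)).exists_bound_of_continuousOn
    (hρ.contDiffOn_sqrt.continuousOn.mono hsub)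
  obtain ⟨D, hD⟩ := (isCompact_Icc (a := (0 : ℝ)) (b := front ρ T)).exists_bound_of_continuousOn
    ((hρ.contDiffOn_sqrt.continuousOn.inv₀ fun x hx => (hρ.sqrt_pos hx).ne').mono hsub)
  have hc : 0 ≤ max 0 (max C D) := le_max_left _ _
  refine ⟨ENNReal.ofReal (max 0 (max C D)), ENNReal.ofReal_ne_top,
    withDensity_le_smul_of_le measurableSet_Ioo hc fun x hx => ?_,
    withDensity_le_smul_of_le measurableSet_Ioo hc fun x hx => ?_⟩
  · have h1 : √(ρ x) ≤ max 0 (max C D) := (le_abs_self _).trans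
      ((hC x (Ioo_subset_Icc_self hx)).trans ((le_max_left _ _).trans (le_max_right _ _)))
    calc ρ x = √(ρ x) * √(ρ x) := (Real.mul_self_sqrt (hρ.pos x hx.1.le).le).symm
      _ ≤ _ := by gcongr
  · have h1 : (√(ρ x))⁻¹ ≤ max 0 (max C D) := (le_abs_self _).trans
      ((hD x (Ioo_subset_Icc_self hx)).trans ((le_max_right _ _).trans (le_max_right _ _)))
    have h2 := hρ.sqrt_pos hx.1.le
    calc √(ρ x) = (√(ρ x))⁻¹ * ρ x := by
          rw [inv_mul_eq_div, eq_div_iff h2.ne', Real.mul_self_sqrt (hρ.pos x hx.1.le).le]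
      _ ≤ _ := by gcongr; exact (hρ.pos x hx.1.le).le

theorem continuous_amp_max : Continuous fun x => amp ρ (max x 0) :=
  hρ.contDiffOn_amp.continuousOn.comp_continuous (f := fun x => max x 0) (by fun_prop)
    fun x => mem_Ici.2 (le_max_right x 0)

/-- The singular part of the control operator, `a(x) f(T - τ(x))`. -/
def transportFun (ρ : ℝ → ℝ) (T : ℝ) (f : ℝ → ℝ) (x : ℝ) : ℝ :=
  amp ρ (max x 0) * f (delay ρ T x)

/-- The singular part of the control operator is bounded from `L₂(0, T)` to `L_{2,ρ}(0, x(T))`. -/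
theorem exists_transportFun_bound (hT : 0 < T) : ∃ c : ENNReal, c ≠ ⊤ ∧ ∀ f : ℝ → ℝ,
    MemLp f 2 (timeMeasure T) → MemLp (transportFun ρ T f) 2 (spaceMeasure ρ T) ∧
      eLpNorm (transportFun ρ T f) 2 (spaceMeasure ρ T) ≤ c * eLpNorm f 2 (timeMeasure T) := by
  obtain ⟨c, hc, hle, -⟩ := exists_spaceMeasure_le hρ (T := T)
  obtain ⟨A, hA⟩ := (isCompact_Icc (a := (0 : ℝ)) (b := front ρ T)).exists_bound_of_continuousOn
    (continuous_amp_max hρ).continuousOn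
  refine ⟨ENNReal.ofReal A * c ^ (1 / 2 : ENNReal).toReal, ?_, fun f hf => ?_⟩
  · exact ENNReal.mul_ne_top ENNReal.ofReal_ne_top
      (ENNReal.rpow_ne_top_of_nonneg ENNReal.toReal_nonneg hc)
  have h1 : MemLp (f ∘ delay ρ T) 2 (eikonalMeasure ρ T) :=
    hf.comp_measurePreserving (measurePreserving_delay hρ hT)
  have h2 : MemLp (f ∘ delay ρ T) 2 (spaceMeasure ρ T) := h1.of_measure_le_smul hc hle
  have hb : ∀ᵐ x ∂(spaceMeasure ρ T), ‖transportFun ρ T f x‖ ≤ A * ‖(f ∘ delay ρ T) x‖ := by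
    filter_upwards [ae_mem_Ioo_spaceMeasure ρ T] with x hx
    rw [transportFun, norm_mul]
    exact mul_le_mul_of_nonneg_right (hA x (Ioo_subset_Icc_self hx)) (norm_nonneg _)
  refine ⟨h2.of_le_mul ((continuous_amp_max hρ).aestronglyMeasurable.mul h2.1) hb, ?_⟩
  refine (eLpNorm_le_mul_eLpNorm_of_ae_le_mul hb 2).trans ?_
  rw [mul_assoc]
  gcongr
  refine (eLpNorm_le_of_measure_le_smul hle).trans ?_
  rw [eLpNorm_comp_measurePreserving hf.1 (measurePreserving_delay hρ hT), smul_eq_mul]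

/-- Null sets of times pull back to null sets of places. -/
theorem ae_delay (hT : 0 < T) {p : ℝ → Prop} (hp : ∀ᵐ t ∂(timeMeasure T), p t) :
    ∀ᵐ x ∂(spaceMeasure ρ T), p (delay ρ T x) := by
  obtain ⟨c, hc, hle, -⟩ := exists_spaceMeasure_le hρ (T := T)
  exact (Measure.absolutelyContinuous_of_le_smul hle).ae_le
    ((measurePreserving_delay hρ hT).quasiMeasurePreserving.ae hp)

theorem ae_place (hT : 0 < T) {p : ℝ → Prop} (hp : ∀ᵐ x ∂(spaceMeasure ρ T), p x) :
    ∀ᵐ t ∂(timeMeasure T), p (place ρ T t) := by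
  obtain ⟨c, hc, -, hle⟩ := exists_spaceMeasure_le hρ (T := T)
  exact (measurePreserving_place hρ hT).quasiMeasurePreserving.ae
    ((Measure.absolutelyContinuous_of_le_smul hle).ae_le hp)

theorem delay_place {t : ℝ} (ht : t ∈ Ioo 0 T) : delay ρ T (place ρ T t) = t := by
  have h0 : 0 ≤ T - t := by linarith [ht.2]
  rw [delay, place, max_eq_left h0, max_eq_left (hρ.front_nonneg h0), hρ.eikonal_front h0]
  ring

theorem memLp_transportFun (hT : 0 < T) (f : Outer T) :
    MemLp (transportFun ρ T f) 2 (spaceMeasure ρ T) :=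
  ((exists_transportFun_bound hρ hT).choose_spec.2 f (Lp.memLp f)).1

/-- The singular part of the control operator as a bounded operator. -/
def transportL (hT : 0 < T) : Outer T →L[ℝ] Inner ρ T :=
  LinearMap.mkContinuousOfExistsBound
    { toFun := fun f => (memLp_transportFun hρ hT f).toLp _
      map_add' := fun f g => by
        rw [← MemLp.toLp_add]
        refine MemLp.toLp_congr _ _ ?_
        filter_upwards [ae_delay hρ hT (Lp.coeFn_add f g)] with x hx
        rw [Pi.add_apply, transportFun, hx, Pi.add_apply, mul_add]
        rfl
      map_smul' := fun c f => by
        rw [RingHom.id_apply, ← MemLp.toLp_const_smul]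
        refine MemLp.toLp_congr _ _ ?_
        filter_upwards [ae_delay hρ hT (Lp.coeFn_smul c f)] with x hx
        rw [Pi.smul_apply, transportFun, hx, Pi.smul_apply, smul_eq_mul, mul_left_comm]
        rfl } <| by
    obtain ⟨c, hc, h⟩ := exists_transportFun_bound hρ hT
    refine ⟨c.toReal, fun f => ?_⟩
    refine (Lp.norm_toLp _ (memLp_transportFun hρ hT f)).trans_le ?_
    rw [Lp.norm_def, ← ENNReal.toReal_mul]
    exact ENNReal.toReal_mono (ENNReal.mul_ne_top hc (Lp.eLpNorm_ne_top f)) (h f (Lp.memLp f)).2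

theorem transportL_ae (hT : 0 < T) (f : Outer T) :
    transportL hρ hT f =ᵐ[spaceMeasure ρ T] transportFun ρ T f :=
  (memLp_transportFun hρ hT f).coeFn_toLp

theorem bijective_transportL (hT : 0 < T) : Function.Bijective (transportL hρ hT) := by
  constructor
  · rw [injective_iff_map_eq_zero]
    intro f hf
    have h1 : transportFun ρ T f =ᵐ[spaceMeasure ρ T] 0 := by
      filter_upwards [transportL_ae hρ hT f, Lp.coeFn_zero ℝ 2 (spaceMeasure ρ T)] with x e1 e2
      rw [← e1, hf, e2]
    apply Lp.ext
    filter_upwards [ae_place hρ hT h1, Lp.coeFn_zero ℝ 2 (timeMeasure T),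
      ae_restrict_mem measurableSet_Ioo] with t e1 e2 ht
    rw [transportFun, delay_place hρ ht, max_eq_left (place_nonneg hρ T t), Pi.zero_apply] at e1
    rw [e2, Pi.zero_apply]
    exact (mul_eq_zero.1 e1).resolve_left (hρ.amp_pos (place_nonneg hρ T t)).ne'
  · intro g
    obtain ⟨c, hc, -, hle⟩ := exists_spaceMeasure_le hρ (T := T)
    have hm : MemLp (g ∘ place ρ T) 2 (timeMeasure T) :=
      ((Lp.memLp g).of_measure_le_smul hc hle).comp_measurePreserving
        (measurePreserving_place hρ hT)
    have hac : Continuous fun t => (amp ρ (max (place ρ T t) 0))⁻¹ :=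
      ((continuous_amp_max hρ).comp (continuous_place hρ T)).inv₀ fun t =>
        (hρ.amp_pos (le_max_right _ _)).ne'
    obtain ⟨A, hA⟩ := (isCompact_Icc (a := (0 : ℝ)) (b := T)).exists_bound_of_continuousOn
      hac.continuousOn
    have hm' : MemLp (fun t => (amp ρ (max (place ρ T t) 0))⁻¹ * (g ∘ place ρ T) t) 2
        (timeMeasure T) := by
      refine hm.of_le_mul (c := A) (hac.aestronglyMeasurable.mul hm.1) ?_
      filter_upwards [ae_restrict_mem measurableSet_Ioo] with t ht
      rw [norm_mul]
      exact mul_le_mul_of_nonneg_right (hA t (Ioo_subset_Icc_self ht)) (norm_nonneg _)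
    refine ⟨hm'.toLp _, Lp.ext ?_⟩
    filter_upwards [transportL_ae hρ hT (hm'.toLp _), ae_delay hρ hT hm'.coeFn_toLp,
      ae_mem_Ioo_spaceMeasure ρ T] with x e1 e2 hx
    rw [e1, transportFun, e2, place_delay hρ hx, Function.comp, place_delay hρ hx, ← mul_assoc,
      mul_inv_cancel₀ (hρ.amp_pos (le_max_right _ _)).ne', one_mul]

end

/-- Kernel of the Volterra operator `K` for which the control operator is the transport
operator composed with `1 + K`. -/
def controlKernel (ρ : ℝ → ℝ) (w : ℝ → ℝ → ℝ) (T t s : ℝ) : ℝ :=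
  clamp (straighten ρ w) (place ρ T t) (t - s) * (amp ρ (max (place ρ T t) 0))⁻¹

/-- The factorization of the control operator into transport and a perturbation of the identity. -/
theorem wave_eq_volt {ρ : ℝ → ℝ} (w : ℝ → ℝ → ℝ) (hρ : IsDensity ρ) {T : ℝ} (hT : 0 < T)
    (f : ℝ → ℝ) {x : ℝ} (hx : x ∈ Ioo 0 (front ρ T)) :
    wave ρ w f x T = amp ρ (max x 0) *
      (f (delay ρ T x) + volt (controlKernel ρ w T) f (delay ρ T x)) := by
  have hd := delay_mem_Ioo hρ hT hx
  have hpos := (hρ.amp_pos (le_max_right x 0)).ne'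
  have hde : delay ρ T x = T - eikonal ρ x := by rw [delay, max_eq_left hx.1.le]
  rw [wave, if_pos (by linarith [hd.1]), mul_add, volt, ← intervalIntegral.integral_const_mul, hde]
  congr 1
  · rw [amp, max_eq_left hx.1.le]
  · refine intervalIntegral.integral_congr fun s hs => ?_
    rw [← hde, uIcc_of_le hd.1.le] at hs
    simp only [controlKernel]
    rw [← hde, place_delay hρ hx, clamp_eq hx.1.le (by linarith [hs.2]), straighten, hde,
      show eikonal ρ x + (T - eikonal ρ x - s) = T - s by ring]
    field_simp

section
variable {ρ q : ℝ → ℝ} {w : ℝ → ℝ → ℝ} (hw : IsWaveKernel ρ q w) (hρ : IsDensity ρ) {T : ℝ}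
include hw hρ

theorem continuous_controlKernel (T : ℝ) :
    Continuous (Function.uncurry (controlKernel ρ w T)) := by
  have h1 := continuous_clamp (hw.contDiffOn_straighten hρ).continuousOn
  have h2 := continuous_place hρ T
  refine (h1.comp (f := fun p : ℝ × ℝ => (place ρ T p.1, p.1 - p.2)) (by fun_prop)).mul ?_
  exact (((continuous_amp_max hρ).comp h2).inv₀ fun t =>
        (hρ.amp_pos (le_max_right _ _)).ne').comp continuous_fst

/-- The control operator exists and is an isomorphism. -/
theorem exists_controlOperator (hT : 0 < T) :
    ∃ W : Outer T ≃L[ℝ] Inner ρ T, IsControlOperator ρ w T W := by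
  have hk := continuous_controlKernel hw hρ T
  have hb : Function.Bijective
      (transportL hρ hT ∘L (1 + voltL T (controlKernel ρ w T) hk : Outer T →L[ℝ] Outer T)) :=
    (bijective_transportL hρ hT).comp (bijective_one_add_voltL hT.le hk)
  refine ⟨ContinuousLinearEquiv.ofBijective _ (LinearMap.ker_eq_bot.2 hb.1)
    (LinearMap.range_eq_top.2 hb.2), fun f => ?_⟩
  have h1 : ∀ᵐ t ∂(timeMeasure T), (f + voltL T (controlKernel ρ w T) hk f : Outer T) t
      = f t + volt (controlKernel ρ w T) f t := by
    filter_upwards [Lp.coeFn_add f (voltL T (controlKernel ρ w T) hk f), voltL_ae hk f]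
      with t e1 e2
    rw [e1, Pi.add_apply, e2]
  filter_upwards [transportL_ae hρ hT (f + voltL T (controlKernel ρ w T) hk f),
    ae_delay hρ hT h1, ae_mem_Ioo_spaceMeasure ρ T] with x e1 e2 hx
  refine Eq.trans e1 ?_
  rw [transportFun, e2, wave_eq_volt w hρ hT f hx]

end
/-! ### The response operator -/

section L2
variable {T : ℝ}

theorem inner_outer (hT : 0 ≤ T) {f g : Outer T} {f₀ g₀ : ℝ → ℝ} (hf : f =ᵐ[timeMeasure T] f₀)
    (hg : g =ᵐ[timeMeasure T] g₀) : inner ℝ f g = ∫ t in (0 : ℝ)..T, f₀ t * g₀ t := by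
  rw [L2.inner_def, intervalIntegral.integral_of_le hT, integral_Ioc_eq_integral_Ioo]
  refine integral_congr_ae ?_
  filter_upwards [hf, hg] with t e1 e2
  rw [e1, e2]
  exact mul_comm _ _

/-- An element of `L₂(0, T)` that annihilates all test functions vanishes. -/
theorem outer_eq_zero_of_forall_test (hT : 0 ≤ T) (g : Outer T)
    (h : ∀ f : ℝ → ℝ, ContDiff ℝ ∞ f → tsupport f ⊆ Ioo 0 T →
      ∫ t in (0 : ℝ)..T, f t * g t = 0) : g = 0 := by
  have h1 := isOpen_Ioo.ae_eq_zero_of_integral_contDiff_smul_eq_zero (μ := timeMeasure T)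
    (U := Ioo 0 T) ((integrable_of_outer g).locallyIntegrable.locallyIntegrableOn _)
    fun f hf _ hfs => by
      have := h f hf hfs
      rwa [intervalIntegral.integral_of_le hT, integral_Ioc_eq_integral_Ioo] at this
  apply Lp.ext
  filter_upwards [h1, Lp.coeFn_zero ℝ 2 (timeMeasure T), ae_restrict_mem measurableSet_Ioo]
    with t e1 e2 ht
  rw [e1 ht, e2, Pi.zero_apply]

/-- Integration from `0`, as a bounded operator of `L₂(0, T)`; its range is `{f ∈ H¹[0, T] | f(0) =
0}`. -/
def primL (T : ℝ) : Outer T →L[ℝ] Outer T := voltL T (fun _ _ => 1) continuous_const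

theorem volt_one (v : ℝ → ℝ) : volt (fun _ _ => 1) v = primitive v := by
  ext t; simp [volt, primitive]

theorem primL_ae (v : Outer T) : primL T v =ᵐ[timeMeasure T] primitive v := by
  rw [← volt_one]
  exact voltL_ae continuous_const v

theorem continuousOn_primitive {v : ℝ → ℝ} (hv : Integrable v (timeMeasure T)) :
    ContinuousOn (primitive v) (Icc 0 T) := by
  rw [← volt_one]
  exact continuousOn_volt continuous_const hv

theorem ae_hasDerivAt_primitive (hT : 0 ≤ T) {v : ℝ → ℝ} (hv : Integrable v (timeMeasure T)) :
    ∀ᵐ t ∂(timeMeasure T), HasDerivAt (primitive v) (v t) t := by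
  have h1 : IntervalIntegrable v volume 0 T := intervalIntegrable_of_timeMeasure hv le_rfl hT le_rfl
  filter_upwards [ae_restrict_of_ae h1.ae_hasDerivAt_integral, ae_restrict_mem measurableSet_Ioo]
    with t h2 ht
  exact h2 (by rw [uIcc_of_le hT]; exact Ioo_subset_Icc_self ht) 0 left_mem_uIcc

/-- A function of `H¹` determines its derivative. -/
theorem injective_primL (hT : 0 ≤ T) : Function.Injective (primL T) := by
  rw [injective_iff_map_eq_zero]
  intro v hv
  have h1 : (primitive v) =ᵐ[timeMeasure T] fun _ => 0 := by
    filter_upwards [primL_ae v, Lp.coeFn_zero ℝ 2 (timeMeasure T)] with t e1 e2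
    rw [← e1, hv, e2, Pi.zero_apply]
  have h2 : EqOn (primitive v) (fun _ => 0) (Ioo 0 T) :=
    Measure.eqOn_open_of_ae_eq h1 isOpen_Ioo
      ((continuousOn_primitive (integrable_of_outer v)).mono Ioo_subset_Icc_self) continuousOn_const
  apply Lp.ext
  filter_upwards [ae_hasDerivAt_primitive hT (integrable_of_outer v),
    Lp.coeFn_zero ℝ 2 (timeMeasure T), ae_restrict_mem measurableSet_Ioo] with t h3 e2 ht
  rw [e2, Pi.zero_apply]
  refine h3.unique ((hasDerivAt_const t (0 : ℝ)).congr_of_eventuallyEq ?_)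
  filter_upwards [Ioo_mem_nhds ht.1 ht.2] with s hs using h2 hs

theorem primitive_deriv {f : ℝ → ℝ} (hf : ContDiff ℝ ∞ f) (h0 : f 0 = 0) (t : ℝ) :
    primitive (deriv f) t = f t := by
  rw [primitive, intervalIntegral.integral_deriv_eq_sub
    (fun x _ => (hf.differentiable (by simp)) x)
    ((hf.continuous_deriv (by simp)).intervalIntegrable _ _), h0, sub_zero]

theorem memLp_deriv {f : ℝ → ℝ} (hf : ContDiff ℝ ∞ f) : MemLp (deriv f) 2 (timeMeasure T) :=
  memLp_of_continuousOn (hf.continuous_deriv (by simp)).continuousOn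

theorem primitive_congr_ae {f g : ℝ → ℝ} (h : f =ᵐ[timeMeasure T] g) {t : ℝ} (ht : t ∈ Icc 0 T) :
    primitive f t = primitive g t := by
  rw [← volt_one, ← volt_one, volt_congr_ae h ht]

theorem primL_toLp_deriv {f : ℝ → ℝ} (hf : ContDiff ℝ ∞ f) (h0 : f 0 = 0) :
    primL T ((memLp_deriv hf).toLp _) =ᵐ[timeMeasure T] f := by
  filter_upwards [primL_ae ((memLp_deriv (T := T) hf).toLp _), ae_restrict_mem measurableSet_Ioo]
    with t e1 ht
  rw [e1, primitive_congr_ae (memLp_deriv hf).coeFn_toLp (Ioo_subset_Icc_self ht),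
    primitive_deriv hf h0]

/-- The domain of the response operator is dense, since it contains the test functions. -/
theorem dense_range_primL (hT : 0 ≤ T) :
    Dense ((LinearMap.range (primL T : Outer T →ₗ[ℝ] Outer T) : Submodule ℝ (Outer T)) :
      Set (Outer T)) := by
  rw [Submodule.dense_iff_topologicalClosure_eq_top, Submodule.topologicalClosure_eq_top_iff,
    Submodule.eq_bot_iff]
  intro g hg
  refine outer_eq_zero_of_forall_test hT g fun f hf hfs => ?_
  have h0 : f 0 = 0 := image_eq_zero_of_notMem_tsupport fun h => lt_irrefl _ (hfs h).1
  rw [← inner_outer hT (primL_toLp_deriv hf h0) (ae_eq_refl g)]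
  exact (Submodule.mem_orthogonal _ g).1 hg _ ⟨_, rfl⟩

/-- The function `ϰ` is the image of `1` under the adjoint of integration. -/
theorem inner_kappa (hT : 0 ≤ T) (v : Outer T) :
    inner ℝ (kappa T) v = inner ℝ ((memLp_of_continuousOn (continuousOn_const (c := (1 : ℝ)))).toLp
      (fun _ => (1 : ℝ)) : Outer T) (primL T v) := by
  rw [inner_outer hT (f := kappa T) (memLp_kappa T).coeFn_toLp (ae_eq_refl v),
    inner_outer hT (memLp_of_continuousOn (continuousOn_const (c := (1 : ℝ)))).coeFn_toLp
      (primL_ae v)]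
  have h1 : Integrable v (volume.restrict (Ioc 0 T)) := by
    rw [← restrict_Ioo_eq_restrict_Ioc]; exact integrable_of_outer v
  have h2 := integral_triangle_swap hT (f := fun _ s => v s) (h1.comp_snd _)
  simp only [one_mul, primitive, h2]
  refine intervalIntegral.integral_congr fun s _ => ?_
  simp

end L2

/-- The derivative of `x N(x)` at `0` needs no differentiability of `N`. -/
theorem hasDerivWithinAt_mul_of_continuous {N : ℝ → ℝ} (hN : Continuous N) :
    HasDerivWithinAt (fun x => x * N x) (N 0) (Ici 0) 0 := by
  refine HasDerivAt.hasDerivWithinAt ?_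
  rw [hasDerivAt_iff_tendsto_slope]
  refine (hN.tendsto 0 |>.mono_left nhdsWithin_le_nhds).congr' ?_
  filter_upwards [self_mem_nhdsWithin] with x hx
  rw [slope_def_field]
  have : x ≠ 0 := hx
  field_simp
  simp

/-- Hadamard's lemma: a smooth function that vanishes for `x = 0` is divisible by `x`. -/
theorem exists_eq_mul {k : ℝ → ℝ → ℝ} (hk : ContDiffOn ℝ ∞ (Function.uncurry k) quadrant)
    (h0 : ∀ y, 0 ≤ y → k 0 y = 0) : ∃ m : ℝ → ℝ → ℝ, Continuous (Function.uncurry m) ∧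
      (∀ x y, 0 ≤ x → 0 ≤ y → k x y = x * m x y) ∧ ∀ y, 0 ≤ y → m 0 y = dx k 0 y := by
  have hc := continuous_clamp (contDiffOn_dx hk).continuousOn
  refine ⟨fun x y => ∫ θ in (0 : ℝ)..1, clamp (dx k) (x * θ) y, ?_, fun x y hx hy => ?_,
    fun y hy => ?_⟩
  · exact intervalIntegral.continuous_parametric_intervalIntegral_of_continuous'
      (f := fun (p : ℝ × ℝ) θ => clamp (dx k) (p.1 * θ) p.2)
      (hc.comp (f := fun z : (ℝ × ℝ) × ℝ => (z.1.1 * z.2, z.1.2)) (by fun_prop)) 0 1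
  · have h1 : ∫ s in (0 : ℝ)..x, clamp (dx k) s y = k x y - k 0 y := by
      refine intervalIntegral.integral_eq_sub_of_hasDeriv_right_of_le hx
        (fun s hs => ((hasDerivWithinAt_dx hk hs.1 hy).mono
          Icc_subset_Ici_self).continuousWithinAt) (fun s hs => ?_)
        ((hc.comp (f := fun s => (s, y)) (by fun_prop)).intervalIntegrable _ _)
      rw [clamp_eq hs.1.le hy]
      exact (hasDerivAt_dx hk hs.1 hy).hasDerivWithinAt
    rw [h0 y hy, sub_zero] at h1
    have h2 := intervalIntegral.mul_integral_comp_mul_left (a := 0) (b := 1)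
      (f := fun s => clamp (dx k) s y) (c := x)
    rw [mul_zero, mul_one, h1] at h2
    exact h2.symm
  · simp [clamp_eq le_rfl hy]

section
variable {ρ : ℝ → ℝ} (w : ℝ → ℝ → ℝ) (hρ : IsDensity ρ)
include hρ

theorem wave_congr {f g : ℝ → ℝ} {T x t : ℝ} (hx : 0 ≤ x) (ht : t ≤ T)
    (hfg : EqOn f g (Icc 0 T)) : wave ρ w f x t = wave ρ w g x t := by
  by_cases h : eikonal ρ x ≤ t
  · have h0 := hρ.eikonal_nonneg hx
    have h2 : 0 ≤ t - eikonal ρ x := by linarith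
    rw [wave, wave, if_pos h, if_pos h, hfg ⟨h2, by linarith⟩]
    congr 1
    refine intervalIntegral.integral_congr fun s hs => ?_
    rw [uIcc_of_le h2] at hs
    rw [hfg ⟨hs.1, by linarith [hs.2]⟩]
  · rw [wave, wave, if_neg h, if_neg h]

end

section
variable {ρ q : ℝ → ℝ} {w : ℝ → ℝ → ℝ} (hw : IsWaveKernel ρ q w) (hρ : IsDensity ρ) {T : ℝ}
include hw hρ

/-- The trace `u_x(0, t)` of the wave excited by a control that is continuous, and differentiable
at the moment `t`. The derivative of the integral term needs no smoothness of the control, because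
the kernel is divisible by `x`. -/
theorem hasDerivWithinAt_wave_zero {g : ℝ → ℝ} (hg : Continuous g) (hg0 : ∀ t ≤ 0, g t = 0)
    {t g' : ℝ} (ht : 0 < t) (hgt : HasDerivAt g g' t) :
    HasDerivWithinAt (fun x => wave ρ w g x t)
      (derivWithin (amp ρ) (Ici 0) 0 * g t - √(ρ 0) * g'
        + ∫ s in (0 : ℝ)..t, dx (straighten ρ w) 0 (t - s) * g s) (Ici 0) 0 := by
  obtain ⟨m, hm, hkm, hm0⟩ := exists_eq_mul (hw.contDiffOn_straighten hρ)
    fun y hy => hw.straighten_zero hρ hy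
  set e : ℝ → ℝ := fun x => eikonal ρ (max x 0) with he
  have hec : Continuous e := hρ.contDiffOn_eikonal.continuousOn.comp_continuous
    (f := fun x => max x 0) (by fun_prop) fun x => mem_Ici.2 (le_max_right x 0)
  have hN : Continuous fun x => ∫ η in (0 : ℝ)..t, m x η * g (t - e x - η) :=
    intervalIntegral.continuous_parametric_intervalIntegral_of_continuous'
      (f := fun x η => m x η * g (t - e x - η))
      ((hm.comp (f := fun z : ℝ × ℝ => (z.1, z.2)) (by fun_prop)).mul
        (hg.comp (f := fun z : ℝ × ℝ => t - e z.1 - z.2) (by fun_prop))) 0 t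
  have h1 := hasDerivWithinAt_mul_of_continuous hN
  have hamp : HasDerivWithinAt (amp ρ) (derivWithin (amp ρ) (Ici 0) 0) (Ici 0) 0 :=
    (hρ.contDiffOn_amp.differentiableOn (by simp) 0 self_mem_Ici).hasDerivWithinAt
  have htau : HasDerivWithinAt (fun x => t - eikonal ρ x) (-√(ρ 0)) (Ici 0) 0 :=
    (hρ.hasDerivWithinAt_eikonal le_rfl).const_sub t
  have hg2 : HasDerivWithinAt (fun x => g (t - eikonal ρ x)) (g' * -√(ρ 0)) (Ici 0) 0 := by
    refine HasDerivAt.comp_hasDerivWithinAt (h₂ := g) (h := fun x => t - eikonal ρ x) 0 ?_ htau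
    simpa using hgt
  have h2 := (hamp.mul hg2).add h1
  refine (h2.congr (fun x hx => ?_) ?_).congr_deriv ?_
  · rw [hw.wave_eq hρ hg hg0 ht.le hx (by linarith [hρ.eikonal_nonneg hx])]
    simp only [Pi.add_apply, Pi.mul_apply, conv]
    rw [← intervalIntegral.integral_const_mul]
    congr 1
    refine intervalIntegral.integral_congr fun η hη => ?_
    rw [uIcc_of_le ht.le] at hη
    simp only [he]
    rw [hkm x η hx hη.1, max_eq_left (mem_Ici.1 hx), mul_assoc]
  · rw [hw.wave_eq hρ hg hg0 ht.le le_rfl (by simp)]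
    simp only [Pi.add_apply, Pi.mul_apply, conv, zero_mul, add_zero]
    rw [add_eq_left]
    refine intervalIntegral.integral_zero_ae (Eventually.of_forall fun η hη => ?_)
    rw [uIoc_of_le ht.le] at hη
    rw [hw.straighten_zero hρ hη.1.le, zero_mul]
  · rw [eikonal_zero, sub_zero, hρ.amp_zero]
    have h3 : ∫ η in (0 : ℝ)..t, m 0 η * g (t - e 0 - η)
        = ∫ s in (0 : ℝ)..t, dx (straighten ρ w) 0 (t - s) * g s := by
      have h4 := intervalIntegral.integral_comp_sub_left (a := 0) (b := t)
        (fun s => dx (straighten ρ w) 0 (t - s) * g s) t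
      rw [sub_self, sub_zero] at h4
      rw [← h4]
      refine intervalIntegral.integral_congr fun η hη => ?_
      rw [uIcc_of_le ht.le] at hη
      simp only [he]
      rw [hm0 η hη.1, max_self, eikonal_zero, sub_zero, sub_sub_cancel]
    rw [h3]; ring

end

/-- Kernel of the regular part of the response operator: the derivative `k_x(0, t - s)`, extended
continuously to `s > t`. -/
def responseKernel (ρ : ℝ → ℝ) (w : ℝ → ℝ → ℝ) (t s : ℝ) : ℝ :=
  clamp (dx (straighten ρ w)) 0 (t - s)

section
variable {ρ q : ℝ → ℝ} {w : ℝ → ℝ → ℝ} (hw : IsWaveKernel ρ q w) (hρ : IsDensity ρ) {T : ℝ}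
include hw hρ

theorem continuous_responseKernel : Continuous (Function.uncurry (responseKernel ρ w)) :=
  (continuous_clamp (contDiffOn_dx (hw.contDiffOn_straighten hρ)).continuousOn).comp
    (f := fun p : ℝ × ℝ => ((0 : ℝ), p.1 - p.2)) (by fun_prop)

/-- The response to the primitive `f` of `v`, as a bounded function of `v`: the sum of `a'(0) f -
√ρ(0) v` and a Volterra operator applied to `f`. -/
def responseL (T : ℝ) : Outer T →L[ℝ] Outer T :=
  derivWithin (amp ρ) (Ici 0) 0 • primL T - √(ρ 0) • 1
    + voltL T (responseKernel ρ w) (continuous_responseKernel hw hρ) ∘L primL T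

theorem responseL_ae (v : Outer T) : ∀ᵐ t ∂(timeMeasure T), responseL hw hρ T v t =
    derivWithin (amp ρ) (Ici 0) 0 * primitive v t - √(ρ 0) * v t
      + volt (responseKernel ρ w) (primitive v) t := by
  have h1 : responseL hw hρ T v = derivWithin (amp ρ) (Ici 0) 0 • primL T v - √(ρ 0) • v
    + voltL T (responseKernel ρ w) (continuous_responseKernel hw hρ) (primL T v) := rfl
  rw [h1]
  filter_upwards [Lp.coeFn_add (derivWithin (amp ρ) (Ici 0) 0 • primL T v - √(ρ 0) • v)
      (voltL T (responseKernel ρ w) (continuous_responseKernel hw hρ) (primL T v)),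
    Lp.coeFn_sub (derivWithin (amp ρ) (Ici 0) 0 • primL T v) (√(ρ 0) • v),
    Lp.coeFn_smul (derivWithin (amp ρ) (Ici 0) 0) (primL T v), Lp.coeFn_smul √(ρ 0) v,
    voltL_ae (continuous_responseKernel hw hρ) (primL T v), primL_ae v,
    ae_restrict_mem measurableSet_Ioo] with t e1 e2 e3 e4 e5 e6 ht
  rw [e1, Pi.add_apply, e2, Pi.sub_apply, e3, Pi.smul_apply, e4, Pi.smul_apply, e5, e6,
    volt_congr_ae (primL_ae v) (Ioo_subset_Icc_self ht)]
  rfl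

theorem ae_hasDerivWithinAt_wave_primitive (hT : 0 < T) (v : Outer T) : ∀ᵐ t ∂(timeMeasure T),
    HasDerivWithinAt (fun x => wave ρ w (primitive v) x t) (responseL hw hρ T v t) (Ici 0) 0 := by
  have hi := integrable_of_outer v
  have hgc := continuous_clampIcc hT.le (continuousOn_primitive hi)
  have hg0 : ∀ t ≤ 0, clampIcc T (primitive v) t = 0 := fun t ht => by
    rw [clampIcc, max_eq_left ((min_le_left _ _).trans ht), primitive,
      intervalIntegral.integral_same]
  filter_upwards [responseL_ae hw hρ v, ae_hasDerivAt_primitive hT.le hi,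
    ae_restrict_mem measurableSet_Ioo] with t e1 e2 ht
  have e3 : HasDerivAt (clampIcc T (primitive v)) (v t) t := by
    refine e2.congr_of_eventuallyEq ?_
    filter_upwards [Ioo_mem_nhds ht.1 ht.2] with s hs using clampIcc_eq (Ioo_subset_Icc_self hs)
  have h1 := hasDerivWithinAt_wave_zero hw hρ hgc hg0 ht.1 e3
  have h2 : ∀ x ∈ Ici (0 : ℝ), wave ρ w (primitive v) x t
      = wave ρ w (clampIcc T (primitive v)) x t := fun x hx =>
    wave_congr w hρ hx ht.2.le fun s hs => (clampIcc_eq hs).symm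
  refine (h1.congr h2 (h2 0 self_mem_Ici)).congr_deriv ?_
  rw [e1, clampIcc_eq (Ioo_subset_Icc_self ht)]
  congr 1
  refine intervalIntegral.integral_congr fun s hs => ?_
  rw [uIcc_of_le ht.1.le] at hs
  simp only [responseKernel]
  rw [clamp_eq le_rfl (by linarith [hs.2]), clampIcc_eq ⟨hs.1, hs.2.trans ht.2.le⟩]

/-- The response operator, with the range of integration as its domain. It is well defined since
integration is injective. -/
def responseOp (hT : 0 < T) : Outer T →ₗ.[ℝ] Outer T where
  domain := LinearMap.range (primL T : Outer T →ₗ[ℝ] Outer T)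
  toFun := (responseL hw hρ T : Outer T →ₗ[ℝ] Outer T) ∘ₗ
    ((LinearEquiv.ofInjective (primL T : Outer T →ₗ[ℝ] Outer T) (injective_primL hT.le)).symm :
      LinearMap.range (primL T : Outer T →ₗ[ℝ] Outer T) →ₗ[ℝ] Outer T)

theorem responseOp_apply (hT : 0 < T) (f : (responseOp hw hρ hT).domain) {v : Outer T}
    (h : (f : Outer T) = primL T v) : responseOp hw hρ hT f = responseL hw hρ T v := by
  have : f = LinearEquiv.ofInjective (primL T : Outer T →ₗ[ℝ] Outer T) (injective_primL hT.le) v :=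
    Subtype.ext h
  rw [this]
  change responseL hw hρ T ((LinearEquiv.ofInjective (primL T : Outer T →ₗ[ℝ] Outer T)
    (injective_primL hT.le)).symm _) = _
  rw [LinearEquiv.symm_apply_apply]

theorem isResponseOperator_responseOp (hT : 0 < T) :
    IsResponseOperator ρ w T (responseOp hw hρ hT) where
  mem_domain_iff f := by
    constructor
    · rintro ⟨v, rfl⟩
      exact ⟨v, primL_ae v⟩
    · rintro ⟨v, hv⟩
      exact ⟨v, Lp.ext ((primL_ae v).trans hv.symm)⟩
  apply_eq f v h := by
    rw [responseOp_apply hw hρ hT f (Lp.ext (h.trans (primL_ae v).symm))]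
    exact ae_hasDerivWithinAt_wave_primitive hw hρ hT v

/-- By `inner_kappa` the term with `v` in the response, paired with `ϰ`, is the pairing of `1` with
the primitive of `v`; so the whole pairing is bounded in the primitive. -/
theorem kappa_mem_adjoint_domain (hT : 0 < T) : kappa T ∈ (responseOp hw hρ hT).adjoint.domain := by
  set e : Outer T := (memLp_of_continuousOn (continuousOn_const (c := (1 : ℝ)))).toLp
    (fun _ => (1 : ℝ)) with he
  set K := voltL T (responseKernel ρ w) (continuous_responseKernel hw hρ) with hK
  refine LinearPMap.mem_adjoint_domain_of_exists _ ⟨derivWithin (amp ρ) (Ici 0) 0 • kappa T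
    - √(ρ 0) • e + ContinuousLinearMap.adjoint K (kappa T), fun f => ?_⟩
  obtain ⟨f, v, rfl⟩ := f
  rw [responseOp_apply hw hρ hT _ (v := v) rfl]
  have h1 : responseL hw hρ T v = derivWithin (amp ρ) (Ici 0) 0 • primL T v - √(ρ 0) • v
    + K (primL T v) := rfl
  rw [h1, inner_add_right, inner_sub_right, inner_add_left, inner_sub_left, inner_smul_right,
    inner_smul_right, inner_smul_left, inner_smul_left, inner_kappa hT.le v,
    ContinuousLinearMap.adjoint_inner_left]
  rfl

end
/-! ### Static solutions and the control equation -/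

namespace IsStaticSolution
variable {q : ℝ → ℝ} {X : ℝ} {y y' : ℝ → ℝ} (hy : IsStaticSolution q X y y')
include hy

theorem continuousOn : ContinuousOn y (Ico 0 X) := by
  intro x hx
  rcases hx.1.eq_or_lt with h | h
  · rw [← h]
    exact (continuousWithinAt_Ioi_iff_Ici.1 hy.tendsto_zero).mono Ico_subset_Ici_self
  · exact (hy.hasDerivAt x ⟨h, hx.2⟩).continuousAt.continuousWithinAt

theorem continuousOn_deriv : ContinuousOn y' (Ico 0 X) := by
  intro x hx
  rcases hx.1.eq_or_lt with h | h
  · rw [← h]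
    exact (continuousWithinAt_Ioi_iff_Ici.1 hy.tendsto_deriv_zero).mono Ico_subset_Ici_self
  · exact (hy.hasDerivAt_deriv x ⟨h, hx.2⟩).continuousAt.continuousWithinAt

theorem mono {X' : ℝ} (h : X' ≤ X) : IsStaticSolution q X' y y' where
  hasDerivAt x hx := hy.hasDerivAt x ⟨hx.1, hx.2.trans_le h⟩
  hasDerivAt_deriv x hx := hy.hasDerivAt_deriv x ⟨hx.1, hx.2.trans_le h⟩
  tendsto_zero := hy.tendsto_zero
  tendsto_deriv_zero := hy.tendsto_deriv_zero

/-- Grönwall's argument for `y² + y'²`, which bounds `y` up to the right end point. -/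
theorem exists_bound (hq : ContinuousOn q (Ici 0)) : ∃ B, ∀ x ∈ Ico 0 X, |y x| ≤ B := by
  obtain ⟨C, hC⟩ := (isCompact_Icc (a := (0 : ℝ)) (b := X)).exists_bound_of_continuousOn
    (hq.mono Icc_subset_Ici_self)
  set K := 1 + C with hK
  -- `K` bounds `|1 + q|`, so that `exp(-K x) (y² + y'²)` does not increase
  have hE : ∀ x ∈ Ioo 0 X, HasDerivAt (fun x => Real.exp (-(K * x)) * (y x ^ 2 + y' x ^ 2))
      (Real.exp (-(K * x)) * (2 * (1 + q x) * (y x * y' x) - K * (y x ^ 2 + y' x ^ 2))) x := by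
    intro x hx
    have h1 : HasDerivAt (fun x => Real.exp (-(K * x))) (Real.exp (-(K * x)) * -K) x := by
      have := (((hasDerivAt_id x).const_mul K).neg).exp
      simpa using this
    refine (h1.mul (((hy.hasDerivAt x hx).pow 2).add
      ((hy.hasDerivAt_deriv x hx).pow 2))).congr_deriv ?_
    simp only [Pi.add_apply, Pi.pow_apply]
    push_cast
    ring
  have hanti : AntitoneOn (fun x => Real.exp (-(K * x)) * (y x ^ 2 + y' x ^ 2)) (Ico 0 X) := by
    refine antitoneOn_of_deriv_nonpos (convex_Ico 0 X) ?_ ?_ ?_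
    · exact (by fun_prop : Continuous fun x => Real.exp (-(K * x))).continuousOn.mul
        ((hy.continuousOn.pow 2).add (hy.continuousOn_deriv.pow 2))
    · rw [interior_Ico]
      exact fun x hx => (hE x hx).differentiableAt.differentiableWithinAt
    · rw [interior_Ico]
      intro x hx
      rw [(hE x hx).deriv]
      refine mul_nonpos_of_nonneg_of_nonpos (Real.exp_pos _).le ?_
      have h1 : |q x| ≤ C := hC x (Ioo_subset_Icc_self hx)
      have h2 : |1 + q x| ≤ K := (abs_add_le _ _).trans (by rw [abs_one, hK]; linarith)
      have h3 : 2 * |y x * y' x| ≤ y x ^ 2 + y' x ^ 2 := by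
        rw [abs_mul, ← sq_abs (y x), ← sq_abs (y' x)]
        nlinarith [sq_nonneg (|y x| - |y' x|)]
      have h4 : (1 + q x) * (y x * y' x) ≤ K * |y x * y' x| := by
        refine (le_abs_self _).trans ?_
        rw [abs_mul]
        gcongr
      have h5 : 0 ≤ K := (abs_nonneg _).trans h2
      nlinarith
  refine ⟨√(Real.exp (|K| * X) * (y 0 ^ 2 + y' 0 ^ 2)), fun x hx => ?_⟩
  have h1 := hanti ⟨le_rfl, hx.1.trans_lt hx.2⟩ hx hx.1
  simp only [mul_zero, neg_zero, Real.exp_zero, one_mul] at h1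
  refine Real.le_sqrt_of_sq_le ?_
  rw [sq_abs]
  have h2 : Real.exp (K * x) ≤ Real.exp (|K| * X) := Real.exp_le_exp.2
    ((mul_le_mul_of_nonneg_right (le_abs_self K) hx.1).trans
      (mul_le_mul_of_nonneg_left hx.2.le (abs_nonneg K)))
  calc y x ^ 2 ≤ y x ^ 2 + y' x ^ 2 := le_add_of_nonneg_right (sq_nonneg _)
    _ = Real.exp (K * x) * (Real.exp (-(K * x)) * (y x ^ 2 + y' x ^ 2)) := by
        rw [← mul_assoc, ← Real.exp_add]; simp
    _ ≤ Real.exp (K * x) * (y 0 ^ 2 + y' 0 ^ 2) := by gcongr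
    _ ≤ _ := by gcongr

theorem memLp {ρ : ℝ → ℝ} (hρ : IsDensity ρ) (hq : ContinuousOn q (Ici 0)) {T : ℝ}
    (hX : X = front ρ T) : MemLp y 2 (spaceMeasure ρ T) := by
  obtain ⟨B, hB⟩ := hy.exists_bound hq
  have hi : IntegrableOn ρ (Ioo 0 (front ρ T)) :=
    ((hρ.smooth.continuousOn.mono Icc_subset_Ici_self).integrableOn_Icc).mono_set
      Ioo_subset_Icc_self
  have : IsFiniteMeasure (spaceMeasure ρ T) := isFiniteMeasure_withDensity_ofReal hi.2
  refine MemLp.of_bound ?_ B ?_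
  · refine AEStronglyMeasurable.mono_ac (withDensity_absolutelyContinuous _ _) ?_
    rw [← hX]
    exact (hy.continuousOn.mono Ioo_subset_Ico_self).aestronglyMeasurable measurableSet_Ioo
  · filter_upwards [ae_mem_Ioo_spaceMeasure ρ T] with x hx
    exact hB x (hX ▸ Ioo_subset_Ico_self hx)

end IsStaticSolution

namespace IsClassicalWave
variable {ρ q f : ℝ → ℝ} {u : ℝ → ℝ → ℝ} (hu : IsClassicalWave ρ q f u)
include hu

theorem smooth_quadrant : ContDiffOn ℝ ∞ (Function.uncurry u) quadrant := hu.smooth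

theorem wave_equation {x t : ℝ} (hx : 0 < x) (ht : 0 < t) :
    dx (dx u) x t = ρ x * dy (dy u) x t + q x * u x t := by
  have hs := hu.smooth_quadrant
  have h1 : iteratedDeriv 2 (fun s => u x s) t = dy (dy u) x t := by
    refine iteratedDeriv_two_eq (u₁ := fun s => dy u x s) ?_
      (hasDerivAt_dy (contDiffOn_dy hs) hx.le ht)
    filter_upwards [Ioi_mem_nhds ht] with s hs' using hasDerivAt_dy hs hx.le hs'
  have h2 : iteratedDeriv 2 (fun z => u z t) x = dx (dx u) x t := by
    refine iteratedDeriv_two_eq (u₁ := fun s => dx u s t) ?_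
      (hasDerivAt_dx (contDiffOn_dx hs) hx ht.le)
    filter_upwards [Ioi_mem_nhds hx] with s hs' using hasDerivAt_dx hs hs' ht.le
  have h3 := hu.pde x t hx ht
  rw [h1, h2] at h3
  linarith

/-- Taylor's formula in time with integral remainder, for zero initial data. -/
theorem integral_taylor {x T : ℝ} (hx : 0 ≤ x) (hT : 0 ≤ T) :
    ∫ t in (0 : ℝ)..T, (T - t) * dy (dy u) x t = u x T := by
  have hs := hu.smooth_quadrant
  have c0 := (continuousOn_section hs.continuousOn hx).mono
    (Icc_subset_Ici_self : Icc 0 T ⊆ Ici 0)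
  have c1 := (continuousOn_section (contDiffOn_dy hs).continuousOn hx).mono
    (Icc_subset_Ici_self : Icc 0 T ⊆ Ici 0)
  have c2 := (continuousOn_section (contDiffOn_dy (contDiffOn_dy hs)).continuousOn hx).mono
    (Icc_subset_Ici_self : Icc 0 T ⊆ Ici 0)
  have h0 : dy u x 0 = 0 := (hu.init_deriv x hx).derivWithin (uniqueDiffOn_Ici 0 0 self_mem_Ici)
  have h1 := intervalIntegral.integral_eq_sub_of_hasDerivAt_of_le hT
    (f := fun t => (T - t) * dy u x t + u x t) (f' := fun t => (T - t) * dy (dy u) x t)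
    (((by fun_prop : Continuous fun t => T - t).continuousOn.mul c1).add c0) (fun t ht => ?_)
    ((((by fun_prop : Continuous fun t => T - t).continuousOn.mul c2)).intervalIntegrable_of_Icc hT)
  · rw [h1, h0, hu.init x hx]; ring
  · have h2 := ((hasDerivAt_id t).const_sub T).mul (hasDerivAt_dy (contDiffOn_dy hs) hx ht.1)
    refine (h2.add (hasDerivAt_dy hs hx ht.1)).congr_deriv ?_
    simp

variable {X : ℝ} {y y' : ℝ → ℝ} (hy : IsStaticSolution q X y y')
include hy

/-- Green's formula for `u(·, t)` and a solution `y` of the static equation. Beyond `b` the wave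
vanishes, so that only the boundary terms at `x = 0` are left. -/
theorem integral_static (hρ : ContinuousOn ρ (Ici 0)) {b t : ℝ} (hb : 0 < b) (hbX : b < X)
    (ht : 0 < t) (hub : ∀ x, b ≤ x → u x t = 0) :
    ∫ x in (0 : ℝ)..b, ρ x * y x * dy (dy u) x t = y' 0 * f t - y 0 * dx u 0 t := by
  have hs := hu.smooth_quadrant
  have hsec : ∀ {g : ℝ → ℝ → ℝ}, ContinuousOn (Function.uncurry g) quadrant →
      ContinuousOn (fun x => g x t) (Icc 0 b) := fun hg =>
    hg.comp (f := fun s => (s, t)) (by fun_prop) fun s hs => ⟨hs.1, ht.le⟩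
  have hsub : Icc 0 b ⊆ Ico 0 X := fun x hx => ⟨hx.1, hx.2.trans_lt hbX⟩
  have cy := hy.continuousOn.mono hsub
  have cy' := hy.continuousOn_deriv.mono hsub
  have c0 := hsec hs.continuousOn
  have c1 := hsec (contDiffOn_dx hs).continuousOn
  -- the integrand is `y u_xx - y'' u`, whose primitive is the Wronskian `y u_x - y' u`
  have hd : ∀ x ∈ Ioo 0 b, HasDerivAt (fun x => y x * dx u x t - y' x * u x t)
      (ρ x * y x * dy (dy u) x t) x := by
    intro x hx
    have hx' : x ∈ Ioo 0 X := ⟨hx.1, hx.2.trans hbX⟩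
    refine (((hy.hasDerivAt x hx').mul (hasDerivAt_dx (contDiffOn_dx hs) hx.1 ht.le)).sub
      ((hy.hasDerivAt_deriv x hx').mul (hasDerivAt_dx hs hx.1 ht.le))).congr_deriv ?_
    rw [hu.wave_equation hx.1 ht]
    ring
  have hcont : ContinuousOn (fun x => y x * dx u x t - y' x * u x t) (Icc 0 b) :=
    (cy.mul c1).sub (cy'.mul c0)
  have hint : IntervalIntegrable (fun x => ρ x * y x * dy (dy u) x t) volume 0 b :=
    (((hρ.mono Icc_subset_Ici_self).mul cy).mul
      (hsec (contDiffOn_dy (contDiffOn_dy hs)).continuousOn)).intervalIntegrable_of_Icc hb.le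
  rw [intervalIntegral.integral_eq_sub_of_hasDerivAt_of_le hb.le hcont hd hint]
  have hdb : dx u b t = 0 := by
    have h1 := (hasDerivAt_dx hs hb ht.le).hasDerivWithinAt (s := Ici b)
    have h2 : HasDerivWithinAt (fun x => u x t) 0 (Ici b) b :=
      (hasDerivWithinAt_const b (Ici b) (0 : ℝ)).congr (fun x hx => hub x hx) (hub b le_rfl)
    exact (uniqueDiffOn_Ici b b self_mem_Ici).eq_deriv _ h1 h2
  rw [hub b le_rfl, hdb, hu.boundary t ht.le]
  ring

/-- The terminal state of a wave is tested against a static solution through boundary data, without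
knowledge of the wave inside. -/
theorem integral_terminal (hρ : ContinuousOn ρ (Ici 0)) {b T : ℝ} (hb : 0 < b) (hbX : b < X)
    (hT : 0 < T) (hub : ∀ x t, b ≤ x → t ≤ T → u x t = 0) :
    ∫ x in (0 : ℝ)..b, ρ x * y x * u x T
      = ∫ t in (0 : ℝ)..T, (T - t) * (y' 0 * f t - y 0 * dx u 0 t) := by
  have hs := hu.smooth_quadrant
  have hsub : Icc 0 b ⊆ Ico 0 X := fun x hx => ⟨hx.1, hx.2.trans_lt hbX⟩
  have hg : Continuous (clampIcc b fun x => ρ x * y x) := continuous_clampIcc hb.le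
    ((hρ.mono Icc_subset_Ici_self).mul (hy.continuousOn.mono hsub))
  have hc := continuous_clamp (contDiffOn_dy (contDiffOn_dy hs)).continuousOn
  have h1 := integral_rectangle_swap_of_continuous
    (f := fun x t => clampIcc b (fun x => ρ x * y x) x * ((T - t) * clamp (dy (dy u)) x t))
    ((hg.comp continuous_fst).mul (Continuous.mul (by fun_prop) hc)) hb.le hT.le
  have h2 : ∫ x in (0 : ℝ)..b, ρ x * y x * u x T = ∫ x in (0 : ℝ)..b, ∫ t in (0 : ℝ)..T,
      clampIcc b (fun x => ρ x * y x) x * ((T - t) * clamp (dy (dy u)) x t) := by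
    refine intervalIntegral.integral_congr fun x hx => ?_
    rw [uIcc_of_le hb.le] at hx
    rw [intervalIntegral.integral_const_mul, clampIcc_eq hx, ← hu.integral_taylor hx.1 hT.le]
    congr 1
    refine intervalIntegral.integral_congr fun t ht => ?_
    rw [uIcc_of_le hT.le] at ht
    rw [clamp_eq hx.1 ht.1]
  rw [h2, h1]
  refine intervalIntegral.integral_congr_ae (Eventually.of_forall fun t ht => ?_)
  rw [uIoc_of_le hT.le] at ht
  rw [← hu.integral_static hy hρ hb hbX ht.1 fun x hx => hub x t hx ht.2,
    ← intervalIntegral.integral_const_mul]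
  refine intervalIntegral.integral_congr fun x hx => ?_
  rw [uIcc_of_le hb.le] at hx
  rw [clamp_eq hx.1 ht.1.le, clampIcc_eq hx]
  ring

end IsClassicalWave

/-- Finite speed of propagation. -/
theorem wave_eq_zero {ρ : ℝ → ℝ} (w : ℝ → ℝ → ℝ) {f : ℝ → ℝ} {ε x t : ℝ}
    (hf : ∀ t ≤ ε, f t = 0) (h : t - eikonal ρ x ≤ ε) : wave ρ w f x t = 0 := by
  by_cases h' : eikonal ρ x ≤ t
  · rw [wave, if_pos h', hf _ h, mul_zero, zero_add]
    refine intervalIntegral.integral_zero_ae (Eventually.of_forall fun s hs => ?_)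
    rw [uIoc_of_le (by linarith)] at hs
    rw [hf s (hs.2.trans h), mul_zero]
  · rw [wave, if_neg h']

theorem wave_congr_ae {ρ : ℝ → ℝ} (w : ℝ → ℝ → ℝ) (hρ : IsDensity ρ) {T : ℝ} (hT : 0 < T)
    {f g : ℝ → ℝ} (hfg : f =ᵐ[timeMeasure T] g) :
    (fun x => wave ρ w f x T) =ᵐ[spaceMeasure ρ T] fun x => wave ρ w g x T := by
  filter_upwards [ae_delay hρ hT hfg, ae_mem_Ioo_spaceMeasure ρ T] with x e1 hx
  rw [wave_eq_volt w hρ hT f hx, wave_eq_volt w hρ hT g hx, e1,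
    volt_congr_ae hfg (Ioo_subset_Icc_self (delay_mem_Ioo hρ hT hx))]

theorem integral_spaceMeasure {ρ : ℝ → ℝ} (hρ : IsDensity ρ) (T : ℝ) (g : ℝ → ℝ) :
    ∫ x, g x ∂(spaceMeasure ρ T) = ∫ x in Ioo 0 (front ρ T), ρ x * g x := by
  have hm : AEMeasurable (fun x => ENNReal.ofReal (ρ x)) (volume.restrict (Ioo 0 (front ρ T))) :=
    ((hρ.smooth.continuousOn.mono (Ioo_subset_Icc_self.trans Icc_subset_Ici_self)).aemeasurable
      measurableSet_Ioo).ennreal_ofReal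
  rw [integral_withDensity_eq_integral_toReal_smul₀ hm (by simp)]
  refine setIntegral_congr_fun measurableSet_Ioo fun x hx => ?_
  simp only [smul_eq_mul]
  rw [ENNReal.toReal_ofReal (hρ.pos x hx.1.le).le]

section
variable {ρ q : ℝ → ℝ} {w : ℝ → ℝ → ℝ} (hw : IsWaveKernel ρ q w) (hρ : IsDensity ρ)
  (hq : ContinuousOn q (Ici 0)) {T : ℝ} (hT : 0 < T)
include hw hρ hq

/-- The adjoint of the control operator on solutions of the static equation. Both sides are tested
with smooth controls that vanish near `0` and `T`, whose waves are classical and stay away from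
`x(T)`. -/
theorem adjoint_control_static {W : Outer T →L[ℝ] Inner ρ T} (hW : IsControlOperator ρ w T W)
    {y y' : ℝ → ℝ} (hy : IsStaticSolution q (front ρ T) y y') :
    ContinuousLinearMap.adjoint W ((hy.memLp hρ hq rfl).toLp y)
      = y' 0 • kappa T - y 0 • (responseOp hw hρ hT).adjoint
          ⟨kappa T, kappa_mem_adjoint_domain hw hρ hT⟩ := by
  rw [← sub_eq_zero]
  refine outer_eq_zero_of_forall_test hT.le _ fun f hf hfs => ?_
  have h0 : f 0 = 0 := image_eq_zero_of_notMem_tsupport fun h => lt_irrefl _ (hfs h).1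
  obtain ⟨ε, hε, hfε⟩ := exists_pos_forall_le_eq_zero hfs
  set v : Outer T := (memLp_deriv hf).toLp _ with hv
  have hPv : primL T v =ᵐ[timeMeasure T] f := primL_toLp_deriv hf h0
  rw [← inner_outer hT.le hPv (ae_eq_refl _), inner_sub_right, sub_eq_zero, inner_sub_right,
    inner_smul_right, inner_smul_right, ContinuousLinearMap.adjoint_inner_right,
    real_inner_comm (kappa T)]
  have hdom : primL T v ∈ (responseOp hw hρ hT).domain := ⟨v, rfl⟩
  have hadj := LinearPMap.adjoint_isFormalAdjoint (dense_range_primL hT.le : Dense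
    ((responseOp hw hρ hT).domain : Set (Outer T)))
      ⟨kappa T, kappa_mem_adjoint_domain hw hρ hT⟩ ⟨primL T v, hdom⟩
  rw [responseOp_apply hw hρ hT _ (v := v) rfl] at hadj
  rw [real_inner_comm, real_inner_comm ((responseOp hw hρ hT).adjoint _), hadj]
  have hu := hw.duhamel f hf ⟨ε, hε, hfε⟩
  -- the wave vanishes to the right of `b`; the minimum with `T / 2` keeps `b` positive
  set δ := min ε (T / 2) with hδ
  have hδ0 : 0 < T - δ := by linarith [min_le_right ε (T / 2)]
  have hδT : T - δ < T := by linarith [lt_min hε (half_pos hT)]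
  set b := front ρ (T - δ) with hb
  have hb0 : 0 < b := hρ.front_pos hδ0
  have hbX : b < front ρ T := by
    rw [hb, ← hρ.eikonal_lt_iff (hρ.front_nonneg hδ0.le) hT.le, hρ.eikonal_front hδ0.le]
    exact hδT
  have hub : ∀ x t, b ≤ x → t ≤ T → wave ρ w f x t = 0 := by
    intro x t hx ht
    refine wave_eq_zero w hfε ?_
    have h1 := hρ.strictMonoOn_eikonal.monotoneOn (mem_Ici.2 hb0.le)
      (mem_Ici.2 (hb0.le.trans hx)) hx
    rw [hb, hρ.eikonal_front hδ0.le] at h1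
    linarith [min_le_left ε (T / 2)]
  have hmain := hu.integral_terminal hy hρ.smooth.continuousOn hb0 hbX hT hub
  have hl : inner ℝ ((hy.memLp hρ hq rfl).toLp y : Inner ρ T) (W (primL T v))
      = ∫ x in (0 : ℝ)..b, ρ x * y x * wave ρ w f x T := by
    have h1 : W (primL T v) =ᵐ[spaceMeasure ρ T] fun x => wave ρ w f x T := by
      filter_upwards [hW (primL T v), wave_congr_ae w hρ hT hPv] with x e1 e2
      rw [e1, e2]
    rw [L2.inner_def, integral_congr_ae (g := fun x => y x * wave ρ w f x T),
      integral_spaceMeasure hρ, intervalIntegral.integral_of_le hb0.le]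
    · rw [setIntegral_eq_of_subset_of_forall_sdiff_eq_zero measurableSet_Ioo
        (s := Ioc 0 b) (fun x hx => ⟨hx.1, hx.2.trans_lt hbX⟩)]
      · simp only [mul_assoc]
      · intro x hx
        rw [hub x T (le_of_lt (not_le.1 fun h => hx.2 ⟨hx.1.1, h⟩)) le_rfl, mul_zero, mul_zero]
    · filter_upwards [h1, (hy.memLp hρ hq rfl).coeFn_toLp] with x e1 e2
      rw [e1, e2]
      exact mul_comm _ _
  have hR : ∀ᵐ t ∂(timeMeasure T), responseL hw hρ T v t = dx (wave ρ w f) 0 t := by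
    filter_upwards [ae_hasDerivWithinAt_wave_primitive hw hρ hT v,
      ae_restrict_mem measurableSet_Ioo] with t e1 ht
    have h2 : ∀ x ∈ Ici (0 : ℝ), wave ρ w f x t = wave ρ w (primitive v) x t := fun x hx =>
      wave_congr w hρ hx ht.2.le fun s hs => by
        rw [hv, primitive_congr_ae (memLp_deriv hf).coeFn_toLp hs, primitive_deriv hf h0]
    exact ((e1.congr h2 (h2 0 self_mem_Ici)).derivWithin (uniqueDiffOn_Ici 0 0 self_mem_Ici)).symm
  rw [hl, hmain, inner_outer hT.le (f := kappa T) (memLp_kappa T).coeFn_toLp hPv,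
    inner_outer hT.le (f := kappa T) (memLp_kappa T).coeFn_toLp hR,
    ← intervalIntegral.integral_const_mul, ← intervalIntegral.integral_const_mul,
    ← intervalIntegral.integral_sub]
  · refine intervalIntegral.integral_congr fun t _ => ?_
    ring
  · exact (Continuous.mul (by fun_prop) hf.continuous).const_mul _ |>.intervalIntegrable _ _
  · refine (ContinuousOn.intervalIntegrable_of_Icc hT.le ?_).const_mul _
    refine ContinuousOn.mul (by fun_prop) ?_
    exact (contDiffOn_dx hu.smooth_quadrant).continuousOn.comp (f := fun t => ((0 : ℝ), t))
      (by fun_prop) fun s hs => ⟨le_refl (0 : ℝ), hs.1⟩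

/-- The control that steers the system to a static solution, for a control operator that is onto:
its adjoint then is injective. -/
theorem connectingOperator_eq_iff {W : Outer T →L[ℝ] Inner ρ T} (hW : IsControlOperator ρ w T W)
    (hWs : Function.Surjective W) {y y' : ℝ → ℝ} (hy : IsStaticSolution q (front ρ T) y y')
    (f : Outer T) :
    connectingOperator W f = y' 0 • kappa T - y 0 • (responseOp hw hρ hT).adjoint
          ⟨kappa T, kappa_mem_adjoint_domain hw hρ hT⟩ ↔ W f = (hy.memLp hρ hq rfl).toLp y := by
  rw [← adjoint_control_static hw hρ hq hT hW hy]
  refine ⟨fun h => ?_, fun h => by rw [← h]; rfl⟩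
  obtain ⟨g, hg⟩ := hWs (W f - (hy.memLp hρ hq rfl).toLp y)
  rw [← sub_eq_zero, ← inner_self_eq_zero (𝕜 := ℝ)]
  nth_rewrite 2 [← hg]
  rw [← ContinuousLinearMap.adjoint_inner_left, map_sub, ← h]
  simp [connectingOperator]

end
/-! ### Resolvent kernels and the Gelfand–Levitan equation -/

section Resolvent
variable {A Γ : ℝ → ℝ → ℝ}

/-- The resolvent equation in the coordinates `(x, η)`, `η = s - x`. -/
theorem isVolterra_resolvent (hA : Continuous (Function.uncurry A)) : IsVolterra fun u x η =>
    -∫ θ in (0 : ℝ)..η, A x (x + (η - θ)) * u (x + (η - θ)) θ where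
  continuous u hu :=
    (continuous_integral_endpoints (f := fun (p : ℝ × ℝ) θ =>
      A p.1 (p.1 + (p.2 - θ)) * u (p.1 + (p.2 - θ)) θ) (by unfold Function.uncurry; fun_prop)
      continuous_const continuous_snd).neg
  sub u v hu hv x y := by
    have hi : ∀ u : ℝ → ℝ → ℝ, Continuous (Function.uncurry u) →
        IntervalIntegrable (fun θ => A x (x + (y - θ)) * u (x + (y - θ)) θ) volume 0 y :=
      fun u hu => (by fun_prop : Continuous fun θ => A x (x + (y - θ)) * u (x + (y - θ)) θ
        ).intervalIntegrable _ _
    simp only [Pi.sub_apply, mul_sub]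
    rw [intervalIntegral.integral_sub (hi u hu) (hi v hv)]
    ring
  bound N := by
    obtain ⟨C, hC0, hC⟩ := exists_bound_square hA N
    refine ⟨C, hC0, fun u _ n c hc hb x y hx hy hxy => ?_⟩
    rw [abs_neg]
    refine abs_integral_le_of_le_pow hy fun θ hθ0 hθy => ?_
    rw [abs_mul, mul_assoc]
    gcongr
    · exact hC x _ hx (by linarith) (by linarith) (by linarith)
    · exact hb _ θ (by linarith) hθ0 (by linarith)

/-- `Γ` is the resolvent kernel of the Volterra kernel `A` on the triangle `0 ≤ x ≤ s`: the
operators `1 + A` and `1 - Γ`, integrating over `s ≥ x`, satisfy `(1 + A)(1 - Γ) = 1`. -/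
structure IsResolvent (A Γ : ℝ → ℝ → ℝ) : Prop where
  continuous : Continuous (Function.uncurry A)
  continuous_resolvent : Continuous (Function.uncurry Γ)
  eq : ∀ x s, 0 ≤ x → x ≤ s → ∫ σ in x..s, A x σ * Γ σ s = A x s - Γ x s

theorem exists_isResolvent (hA : Continuous (Function.uncurry A)) : ∃ Γ, IsResolvent A Γ := by
  obtain ⟨G, hG, hGe⟩ := (isVolterra_resolvent hA).exists_solution
    (u₀ := fun x η => A x (x + η)) (by unfold Function.uncurry; fun_prop)
  refine ⟨fun x s => G x (s - x), hA, by unfold Function.uncurry; fun_prop, fun x s hx hxs => ?_⟩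
  rw [hGe x (s - x) hx (by linarith), add_sub_cancel]
  have h := intervalIntegral.integral_comp_sub_left (a := 0) (b := s - x)
    (fun σ => A x σ * G σ (s - σ)) s
  rw [sub_sub_cancel, sub_zero] at h
  rw [← h, sub_add_cancel_left, neg_neg]
  refine intervalIntegral.integral_congr fun θ _ => ?_
  rw [show x + (s - x - θ) = s - θ by ring, sub_sub_cancel]

namespace IsResolvent
variable (h : IsResolvent A Γ)
include h

/-- The function `φ(ξ, x) = Y(x) - ∫ₓ^ξ Γ(x, s) Y(s) ds` solves `φ(ξ, x) + ∫ₓ^ξ A(x, s) φ(ξ, s) ds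
= Y(x)`. -/
theorem integral_solution {Y : ℝ → ℝ} (hY : Continuous Y) {x ξ : ℝ} (hx : 0 ≤ x) (hxξ : x ≤ ξ) :
    Y x - (∫ s in x..ξ, Γ x s * Y s)
      + ∫ s in x..ξ, A x s * (Y s - ∫ σ in s..ξ, Γ s σ * Y σ) = Y x := by
  have hA := h.continuous
  have hΓ := h.continuous_resolvent
  have hc : Continuous (Function.uncurry fun σ s => A x s * (Γ s σ * Y σ)) := by
    unfold Function.uncurry; fun_prop
  have hi : Continuous fun s => A x s * ∫ σ in s..ξ, Γ s σ * Y σ :=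
    Continuous.mul (by fun_prop) (continuous_integral_endpoints
      (f := fun s σ => Γ s σ * Y σ) (by unfold Function.uncurry; fun_prop)
      continuous_id continuous_const)
  have h1 : ∫ s in x..ξ, A x s * ∫ σ in s..ξ, Γ s σ * Y σ
      = ∫ σ in x..ξ, (A x σ - Γ x σ) * Y σ := by
    simp only [← intervalIntegral.integral_const_mul]
    rw [← integral_triangle_swap_of_continuous hc hxξ]
    refine intervalIntegral.integral_congr fun σ hσ => ?_
    rw [uIcc_of_le hxξ] at hσ
    rw [← h.eq x σ hx hσ.1, ← intervalIntegral.integral_mul_const]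
    simp only [mul_assoc]
  simp only [mul_sub]
  rw [intervalIntegral.integral_sub (Continuous.intervalIntegrable (by fun_prop) _ _)
    (hi.intervalIntegrable _ _), h1]
  simp only [sub_mul]
  rw [intervalIntegral.integral_sub (Continuous.intervalIntegrable (by fun_prop) _ _)
    (Continuous.intervalIntegrable (by fun_prop) _ _)]
  ring

omit h in
theorem continuous_solution (hΓ : Continuous (Function.uncurry Γ)) {Y : ℝ → ℝ} (hY : Continuous Y) :
    Continuous (Function.uncurry fun ξ x => Y x - ∫ s in x..ξ, Γ x s * Y s) :=
  (hY.comp continuous_snd).sub (continuous_integral_endpoints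
    (f := fun (p : ℝ × ℝ) s => Γ p.2 s * Y s) (by unfold Function.uncurry; fun_prop)
    continuous_snd continuous_fst)

omit h in
/-- The derivative of the solution in `ξ`. -/
theorem hasDerivAt_solution (hΓ : Continuous (Function.uncurry Γ)) {Y : ℝ → ℝ} (hY : Continuous Y)
    (x ξ : ℝ) : HasDerivAt (fun ξ => Y x - ∫ s in x..ξ, Γ x s * Y s) (-(Γ x ξ * Y ξ)) ξ := by
  have hc : Continuous fun s => Γ x s * Y s := by fun_prop
  exact (intervalIntegral.integral_hasDerivAt_right (hc.intervalIntegrable _ _)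
    hc.stronglyMeasurable.stronglyMeasurableAtFilter hc.continuousAt).const_sub (Y x)

/-- The derivative of the solution `φ(ξ, x)` in `x`. It is computed from the integral equation,
since `Γ` need not be differentiable; `A'` is the derivative of `A` in the first variable. -/
theorem hasDerivWithinAt_solution {Y Y' : ℝ → ℝ} (hY : ∀ x, HasDerivAt Y (Y' x) x)
    {A' : ℝ → ℝ → ℝ} (hA' : Continuous (Function.uncurry A'))
    (hAA' : ∀ x s, 0 ≤ x → x ≤ s → A s s = A x s + ∫ σ in x..s, A' σ s)
    {φ : ℝ → ℝ → ℝ} (hφ : φ = fun ξ x => Y x - ∫ s in x..ξ, Γ x s * Y s)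
    {x ξ : ℝ} (hx : 0 ≤ x) (hxξ : x ≤ ξ) :
    HasDerivWithinAt (φ ξ)
      (Y' x + A x x * φ ξ x - ∫ s in x..ξ, A' x s * φ ξ s) (Icc 0 ξ) x := by
  have hA := h.continuous
  have hYc : Continuous Y := continuous_iff_continuousAt.2 fun x => (hY x).continuousAt
  have hφc : Continuous (Function.uncurry φ) := by
    rw [hφ]; exact continuous_solution h.continuous_resolvent hYc
  have hg : Continuous fun σ => A σ σ * φ ξ σ - ∫ s in σ..ξ, A' σ s * φ ξ s :=
    Continuous.sub (by fun_prop) (continuous_integral_endpoints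
      (f := fun σ s => A' σ s * φ ξ s) (by unfold Function.uncurry; fun_prop)
      continuous_id continuous_const)
  -- Fubini's theorem turns the integral equation into an equation for a primitive in `x`
  have key : ∀ x ∈ Icc 0 ξ, φ ξ x
      = Y x - ∫ σ in x..ξ, (A σ σ * φ ξ σ - ∫ s in σ..ξ, A' σ s * φ ξ s) := by
    intro x hx
    have h1 := h.integral_solution hYc hx.1 hx.2
    have h2 : φ ξ x + ∫ s in x..ξ, A x s * φ ξ s = Y x := by rw [hφ]; exact h1
    have hc : Continuous (Function.uncurry fun s σ => A' σ s * φ ξ s) := by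
      unfold Function.uncurry; fun_prop
    have h3 : ∫ s in x..ξ, A x s * φ ξ s
        = ∫ s in x..ξ, (A s s * φ ξ s - ∫ σ in x..s, A' σ s * φ ξ s) := by
      refine intervalIntegral.integral_congr fun s hs => ?_
      rw [uIcc_of_le hx.2] at hs
      rw [intervalIntegral.integral_mul_const, hAA' x s hx.1 hs.1]
      ring
    have c1 : Continuous fun s => A s s * φ ξ s := by fun_prop
    have c2 : Continuous fun s => ∫ σ in x..s, A' σ s * φ ξ s :=
      continuous_integral_endpoints (f := fun s σ => A' σ s * φ ξ s)
        (by unfold Function.uncurry; fun_prop) continuous_const continuous_id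
    have c3 : Continuous fun σ => ∫ s in σ..ξ, A' σ s * φ ξ s :=
      continuous_integral_endpoints (f := fun σ s => A' σ s * φ ξ s)
        (by unfold Function.uncurry; fun_prop) continuous_id continuous_const
    rw [intervalIntegral.integral_sub (c1.intervalIntegrable _ _) (c2.intervalIntegrable _ _),
      integral_triangle_swap_of_continuous hc hx.2] at h3
    rw [intervalIntegral.integral_sub (c1.intervalIntegrable _ _) (c3.intervalIntegrable _ _), ← h3]
    linarith
  have hd := (hY x).sub (intervalIntegral.integral_hasDerivAt_left (hg.intervalIntegrable x ξ)
    hg.stronglyMeasurable.stronglyMeasurableAtFilter hg.continuousAt)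
  refine (hd.hasDerivWithinAt.congr (fun x hx => key x hx) (key x ⟨hx, hxξ⟩)).congr_deriv ?_
  ring

/-- The Gelfand–Levitan equation for a kernel `F` that on `t ≤ s` equals `A(t, s) + ∫₀ᵗ A(x, s)
A(x, t) dx`, the kernel of `(1 + A)*(1 + A) - 1`. -/
theorem gelfandLevitan {F : ℝ → ℝ → ℝ}
    (hF : ∀ s t, 0 ≤ t → t ≤ s → F s t = A t s + ∫ x in (0 : ℝ)..t, A x s * A x t)
    (hsymm : ∀ s t, F s t = F t s) {t ξ : ℝ} (ht : 0 ≤ t) (htξ : t ≤ ξ) :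
    F ξ t - Γ t ξ - ∫ s in (0 : ℝ)..ξ, F s t * Γ s ξ = 0 := by
  have hA := h.continuous
  have hΓ := h.continuous_resolvent
  have c1 : Continuous fun s => A s t * Γ s ξ := by fun_prop
  have c2 : Continuous fun s => A t s * Γ s ξ := by fun_prop
  have c3 : Continuous fun s => ∫ x in (0 : ℝ)..s, A x t * A x s * Γ s ξ :=
    continuous_integral_endpoints (f := fun s x => A x t * A x s * Γ s ξ)
      (by unfold Function.uncurry; fun_prop) continuous_const continuous_id
  have c4 : Continuous fun s => ∫ x in (0 : ℝ)..t, A x s * A x t * Γ s ξ :=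
    continuous_integral_endpoints (f := fun s x => A x s * A x t * Γ s ξ)
      (by unfold Function.uncurry; fun_prop) continuous_const continuous_const
  -- the factorization of `F s t` depends on the order of `s` and `t`
  have e1 : EqOn (fun s => F s t * Γ s ξ)
      (fun s => A s t * Γ s ξ + ∫ x in (0 : ℝ)..s, A x t * A x s * Γ s ξ) (Icc 0 t) := by
    intro s hs
    simp only
    rw [hsymm, hF t s hs.1 hs.2, add_mul, intervalIntegral.integral_mul_const]
  have e2 : EqOn (fun s => F s t * Γ s ξ)
      (fun s => A t s * Γ s ξ + ∫ x in (0 : ℝ)..t, A x s * A x t * Γ s ξ) (Icc t ξ) := by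
    intro s hs
    simp only
    rw [hF s t ht hs.1, add_mul, intervalIntegral.integral_mul_const]
  have i1 : ∫ s in (0 : ℝ)..t, F s t * Γ s ξ = (∫ s in (0 : ℝ)..t, A s t * Γ s ξ)
      + ∫ x in (0 : ℝ)..t, ∫ s in x..t, A x t * A x s * Γ s ξ := by
    rw [intervalIntegral.integral_congr (g := fun s => A s t * Γ s ξ
      + ∫ x in (0 : ℝ)..s, A x t * A x s * Γ s ξ) (by rwa [uIcc_of_le ht]),
      intervalIntegral.integral_add (c1.intervalIntegrable _ _) (c3.intervalIntegrable _ _),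
      integral_triangle_swap_of_continuous (f := fun s x => A x t * A x s * Γ s ξ)
        (by unfold Function.uncurry; fun_prop) ht]
  have i2 : ∫ s in t..ξ, F s t * Γ s ξ = (A t ξ - Γ t ξ)
      + ∫ x in (0 : ℝ)..t, ∫ s in t..ξ, A x t * A x s * Γ s ξ := by
    rw [intervalIntegral.integral_congr (g := fun s => A t s * Γ s ξ
      + ∫ x in (0 : ℝ)..t, A x s * A x t * Γ s ξ) (by rwa [uIcc_of_le htξ]),
      intervalIntegral.integral_add (c2.intervalIntegrable _ _) (c4.intervalIntegrable _ _),
      integral_rectangle_swap_of_continuous (f := fun s x => A x s * A x t * Γ s ξ)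
        (by unfold Function.uncurry; fun_prop) htξ ht, h.eq t ξ ht htξ]
    simp only [mul_comm (A _ t)]
  have c5 : ∀ x, Continuous fun s => A x t * A x s * Γ s ξ := fun x => by fun_prop
  have i3 : (∫ x in (0 : ℝ)..t, ∫ s in x..t, A x t * A x s * Γ s ξ)
      + ∫ x in (0 : ℝ)..t, ∫ s in t..ξ, A x t * A x s * Γ s ξ
      = (∫ x in (0 : ℝ)..t, A x ξ * A x t) - ∫ x in (0 : ℝ)..t, A x t * Γ x ξ := by
    rw [← intervalIntegral.integral_add, ← intervalIntegral.integral_sub]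
    · refine intervalIntegral.integral_congr fun x hx => ?_
      rw [uIcc_of_le ht] at hx
      rw [intervalIntegral.integral_add_adjacent_intervals ((c5 x).intervalIntegrable _ _)
        ((c5 x).intervalIntegrable _ _)]
      simp only [mul_assoc]
      rw [intervalIntegral.integral_const_mul, h.eq x ξ hx.1 (hx.2.trans htξ)]
      ring
    · exact Continuous.intervalIntegrable (by fun_prop) _ _
    · exact Continuous.intervalIntegrable (by fun_prop) _ _
    · exact (continuous_integral_endpoints (f := fun x s => A x t * A x s * Γ s ξ)
        (by unfold Function.uncurry; fun_prop) continuous_id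
          continuous_const).intervalIntegrable _ _
    · exact (continuous_integral_endpoints (f := fun x s => A x t * A x s * Γ s ξ)
        (by unfold Function.uncurry; fun_prop) continuous_const
        continuous_const).intervalIntegrable _ _
  have ii1 : IntervalIntegrable (fun s => F s t * Γ s ξ) volume 0 t :=
    ((c1.add c3).continuousOn.congr e1).intervalIntegrable_of_Icc ht
  have ii2 : IntervalIntegrable (fun s => F s t * Γ s ξ) volume t ξ :=
    ((c2.add c4).continuousOn.congr e2).intervalIntegrable_of_Icc htξ
  rw [← intervalIntegral.integral_add_adjacent_intervals ii1 ii2, i1, i2, hF ξ t ht htξ]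
  linarith

end IsResolvent
end Resolvent
/-! ### The response function and the kernel of the connecting operator -/

section Clamp
variable {f : ℝ → ℝ → ℝ} (hf : ContDiffOn ℝ ∞ (Function.uncurry f) quadrant)
include hf

theorem hasDerivAt_clamp_fst {x y : ℝ} (hx : 0 < x) (hy : 0 ≤ y) :
    HasDerivAt (fun z => clamp f z y) (clamp (dx f) x y) x := by
  rw [clamp_eq hx.le hy]
  refine (hasDerivAt_dx hf hx hy).congr_of_eventuallyEq ?_
  filter_upwards [Ioi_mem_nhds hx] with z hz using clamp_eq (le_of_lt hz) hy

theorem hasDerivAt_clamp_snd {x y : ℝ} (hx : 0 ≤ x) (hy : 0 < y) :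
    HasDerivAt (fun z => clamp f x z) (clamp (dy f) x y) y := by
  rw [clamp_eq hx hy.le]
  refine (hasDerivAt_dy hf hx hy).congr_of_eventuallyEq ?_
  filter_upwards [Ioi_mem_nhds hy] with z hz using clamp_eq hx (le_of_lt hz)

theorem hasDerivAt_clamp_curve {α β : ℝ → ℝ} {α' β' s : ℝ} (hα : HasDerivAt α α' s)
    (hβ : HasDerivAt β β' s) (hα0 : 0 < α s) (hβ0 : 0 < β s) :
    HasDerivAt (fun s => clamp f (α s) (β s))
      (clamp (dx f) (α s) (β s) * α' + clamp (dy f) (α s) (β s) * β') s := by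
  rw [clamp_eq hα0.le hβ0.le, clamp_eq hα0.le hβ0.le]
  refine (hasDerivAt_comp_curve hf hα hβ hα0 hβ0).congr_of_eventuallyEq ?_
  filter_upwards [hα.continuousAt.eventually (Ioi_mem_nhds hα0),
    hβ.continuousAt.eventually (Ioi_mem_nhds hβ0)] with z h1 h2
    using clamp_eq (le_of_lt h1) (le_of_lt h2)

end Clamp

namespace IsGoursat
variable {Q : ℝ → ℝ} {k : ℝ → ℝ → ℝ} (hk : IsGoursat Q k)
include hk

/-- The derivative of `integral_response` along the line `s - t = const`, with `c = s + t`: the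
left-hand side does not depend on `t`. Its derivative in `t` vanishes by the equation for `k`. -/
theorem characteristic_invariant {c t : ℝ} (ht : 0 ≤ t) (htc : 2 * t ≤ c) :
    clamp (dx k) t (c - 2 * t)
      + ∫ x in (0 : ℝ)..t, (clamp (dx k) x (c - t - x) * clamp k x (t - x)
        + clamp k x (c - t - x) * clamp (dx k) x (t - x)) = clamp (dx k) 0 c := by
  have sk := hk.smooth
  have sg := contDiffOn_dx sk
  obtain ⟨K, hK⟩ : ∃ K, K = clamp k := ⟨_, rfl⟩
  obtain ⟨G, hG⟩ : ∃ G, G = clamp (dx k) := ⟨_, rfl⟩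
  obtain ⟨Ky, hKy⟩ : ∃ K, K = clamp (dy k) := ⟨_, rfl⟩
  obtain ⟨Gy, hGy⟩ : ∃ K, K = clamp (dy (dx k)) := ⟨_, rfl⟩
  obtain ⟨Gx, hGx⟩ : ∃ K, K = clamp (dx (dx k)) := ⟨_, rfl⟩
  have cK : Continuous (Function.uncurry K) := hK ▸ continuous_clamp sk.continuousOn
  have cG : Continuous (Function.uncurry G) := hG ▸ continuous_clamp sg.continuousOn
  have cKy : Continuous (Function.uncurry Ky) :=
    hKy ▸ continuous_clamp (contDiffOn_dy sk).continuousOn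
  have cGy : Continuous (Function.uncurry Gy) :=
    hGy ▸ continuous_clamp (contDiffOn_dy sg).continuousOn
  have cGx : Continuous (Function.uncurry Gx) :=
    hGx ▸ continuous_clamp (contDiffOn_dx sg).continuousOn
  have pde : ∀ x y, 0 < x → 0 < y → Gx x y = 2 * Gy x y + Q x * K x y := fun x y hx hy => by
    rw [hGx, hGy, hK, clamp_eq hx.le hy.le, clamp_eq hx.le hy.le, clamp_eq hx.le hy.le]
    linarith [hk.pde x y hx hy]
  have hin : ∀ x, 0 < x → 2 * G x 0 = -Q x := fun x hx => by
    rw [hG, clamp_eq hx.le le_rfl]; exact hk.initial x hx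
  have hbd : ∀ y, 0 ≤ y → K 0 y = 0 := fun y hy => by
    rw [hK, clamp_eq le_rfl hy]; exact hk.boundary y hy
  rw [← hG, ← hK]
  -- derivative of the first term along the line
  have h1 : G t (c - 2 * t) = G 0 (c - 2 * 0)
      + ∫ σ in (0 : ℝ)..t, (Gx σ (c - 2 * σ) - 2 * Gy σ (c - 2 * σ)) := by
    refine eq_add_integral_of_hasDerivAt (f := fun σ => G σ (c - 2 * σ)) ht (by fun_prop)
      (fun σ hσ => ?_) (by fun_prop)
    have := hasDerivAt_clamp_curve sg (hasDerivAt_id σ)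
      (((hasDerivAt_id σ).const_mul 2).const_sub c) hσ.1
      (by simp only [id]; linarith [hσ.2])
    rw [hG, hGx, hGy]
    exact this.congr_deriv (by simp; ring)
  -- derivative of the integrand in `t`
  obtain ⟨M', hM'⟩ : ∃ M' : ℝ → ℝ → ℝ, M' = fun x σ => -Gy x (c - σ - x) * K x (σ - x)
      + G x (c - σ - x) * Ky x (σ - x) - Ky x (c - σ - x) * G x (σ - x)
      + K x (c - σ - x) * Gy x (σ - x) := ⟨_, rfl⟩
  have cM' : Continuous (Function.uncurry M') := by
    rw [hM']; unfold Function.uncurry; fun_prop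
  have h2 : ∀ x, 0 ≤ x → x ≤ t → G x (c - t - x) * K x (t - x) + K x (c - t - x) * G x (t - x)
      = (G x (c - 2 * x) * K x 0 + K x (c - 2 * x) * G x 0) + ∫ σ in x..t, M' x σ := by
    intro x hx hxt
    have h3 := eq_add_integral_of_hasDerivAt (f := fun σ => G x (c - σ - x) * K x (σ - x)
      + K x (c - σ - x) * G x (σ - x)) (f' := M' x) hxt (by fun_prop) (fun σ hσ => ?_)
      (by fun_prop)
    · simp only [sub_self] at h3
      rw [h3, show c - x - x = c - 2 * x by ring]
    · have ha : HasDerivAt (fun σ => c - σ - x) (-1) σ :=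
        ((hasDerivAt_id σ).const_sub c).sub_const x
      have hb : HasDerivAt (fun σ => σ - x) 1 σ := (hasDerivAt_id σ).sub_const x
      have ha0 : 0 < c - σ - x := by linarith [hσ.1, hσ.2]
      have hb0 : 0 < σ - x := by linarith [hσ.1]
      have d1 : HasDerivAt (fun σ => G x (c - σ - x)) (Gy x (c - σ - x) * -1) σ := by
        rw [hG, hGy]
        exact HasDerivAt.comp (h₂ := clamp (dx k) x) (h := fun σ => c - σ - x) σ
          (hasDerivAt_clamp_snd sg hx ha0) ha
      have d2 : HasDerivAt (fun σ => K x (c - σ - x)) (Ky x (c - σ - x) * -1) σ := by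
        rw [hK, hKy]
        exact HasDerivAt.comp (h₂ := clamp k x) (h := fun σ => c - σ - x) σ
          (hasDerivAt_clamp_snd sk hx ha0) ha
      have d3 : HasDerivAt (fun σ => G x (σ - x)) (Gy x (σ - x) * 1) σ := by
        rw [hG, hGy]
        exact HasDerivAt.comp (h₂ := clamp (dx k) x) (h := fun σ => σ - x) σ
          (hasDerivAt_clamp_snd sg hx hb0) hb
      have d4 : HasDerivAt (fun σ => K x (σ - x)) (Ky x (σ - x) * 1) σ := by
        rw [hK, hKy]
        exact HasDerivAt.comp (h₂ := clamp k x) (h := fun σ => σ - x) σ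
          (hasDerivAt_clamp_snd sk hx hb0) hb
      refine ((d1.mul d4).add (d2.mul d3)).congr_deriv ?_
      rw [hM']; ring
  have h4 := integral_leibniz (H := fun x t => G x (c - t - x) * K x (t - x)
    + K x (c - t - x) * G x (t - x)) ht
    (d := fun σ => G σ (c - 2 * σ) * K σ 0 + K σ (c - 2 * σ) * G σ 0) (by fun_prop) cM' h2
  rw [h4, h1, mul_zero, sub_zero, add_assoc, add_eq_left, ← intervalIntegral.integral_add]
  -- for `σ = t` the point `(σ, c - 2 * σ)` may lie on the boundary of the quadrant
  · have hne : ∀ᵐ σ ∂(volume : Measure ℝ), σ ≠ t := by simp [ae_iff]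
    refine intervalIntegral.integral_zero_ae (hne.mono fun σ hσt hσ => ?_)
    rw [uIoc_of_le ht] at hσ
    have hσc : 0 < c - 2 * σ := by linarith [lt_of_le_of_ne hσ.2 hσt]
    -- by the equation, `M' x σ` is the derivative in `x` of `k₁ (k_x)₂ - (k_x)₁ k₂`, the indices
    -- standing for the arguments `(x, c - σ - x)` and `(x, σ - x)`; this expression vanishes at
    -- `x = 0` by the boundary condition
    have h5 := eq_add_integral_of_hasDerivAt (f := fun x => K x (c - σ - x) * G x (σ - x)
      - G x (c - σ - x) * K x (σ - x)) (f' := fun x => M' x σ) hσ.1.le (by fun_prop)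
      (fun x hx => ?_) (by fun_prop)
    · simp only [sub_self, sub_zero] at h5
      rw [hbd (c - σ) (by linarith [hσ.1]), hbd σ hσ.1.le, show c - σ - σ = c - 2 * σ by ring] at h5
      have e1 := pde σ (c - 2 * σ) hσ.1 hσc
      have e2 := hin σ hσ.1
      linear_combination e1 - h5 + K σ (c - 2 * σ) * e2
    · have ha : HasDerivAt (fun x => c - σ - x) (-1) x := (hasDerivAt_id x).const_sub (c - σ)
      have hb : HasDerivAt (fun x => σ - x) (-1) x := (hasDerivAt_id x).const_sub σ
      have ha0 : 0 < c - σ - x := by linarith [hx.2]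
      have hb0 : 0 < σ - x := by linarith [hx.2]
      have hi := hasDerivAt_id x
      have d1 : HasDerivAt (fun x => G x (c - σ - x))
          (Gx x (c - σ - x) * 1 + Gy x (c - σ - x) * -1) x := by
        rw [hG, hGx, hGy]; exact hasDerivAt_clamp_curve sg hi ha hx.1 ha0
      have d2 : HasDerivAt (fun x => K x (c - σ - x))
          (G x (c - σ - x) * 1 + Ky x (c - σ - x) * -1) x := by
        rw [hG, hK, hKy]; exact hasDerivAt_clamp_curve sk hi ha hx.1 ha0
      have d3 : HasDerivAt (fun x => G x (σ - x)) (Gx x (σ - x) * 1 + Gy x (σ - x) * -1) x := by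
        rw [hG, hGx, hGy]; exact hasDerivAt_clamp_curve sg hi hb hx.1 hb0
      have d4 : HasDerivAt (fun x => K x (σ - x)) (G x (σ - x) * 1 + Ky x (σ - x) * -1) x := by
        rw [hG, hK, hKy]; exact hasDerivAt_clamp_curve sk hi hb hx.1 hb0
      refine ((d2.mul d3).sub (d1.mul d4)).congr_deriv ?_
      rw [hM']
      simp only
      rw [pde x _ hx.1 ha0, pde x _ hx.1 hb0]
      ring
  · exact Continuous.intervalIntegrable (by fun_prop) _ _
  · exact ((Continuous.add (by fun_prop) (continuous_integral_endpoints
      (f := fun σ y => M' y σ) (by unfold Function.uncurry; fun_prop) continuous_const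
      continuous_id))).intervalIntegrable _ _

/-- Factorization of the kernel of `C - 1` for unit density, in terms of the response function
`k_x(0, ·)`. -/
theorem integral_response {s t : ℝ} (ht : 0 ≤ t) (hts : t ≤ s) :
    clamp k t (s - t) + ∫ x in (0 : ℝ)..t, clamp k x (s - x) * clamp k x (t - x)
      = (1 / 2) * ∫ η in (s - t)..(s + t), clamp (dx k) 0 η := by
  have sk := hk.smooth
  have sg := contDiffOn_dx sk
  obtain ⟨K, hK⟩ : ∃ K, K = clamp k := ⟨_, rfl⟩
  obtain ⟨G, hG⟩ : ∃ G, G = clamp (dx k) := ⟨_, rfl⟩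
  have cK : Continuous (Function.uncurry K) := hK ▸ continuous_clamp sk.continuousOn
  have cG : Continuous (Function.uncurry G) := hG ▸ continuous_clamp sg.continuousOn
  have hbd : ∀ y, 0 ≤ y → K 0 y = 0 := fun y hy => by
    rw [hK, clamp_eq le_rfl hy]; exact hk.boundary y hy
  have hinv : ∀ c t, 0 ≤ t → 2 * t ≤ c → G t (c - 2 * t)
      + ∫ x in (0 : ℝ)..t, (G x (c - t - x) * K x (t - x) + K x (c - t - x) * G x (t - x))
      = G 0 c := by
    rw [hG, hK]
    exact fun c t ht htc => hk.characteristic_invariant ht htc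
  rw [← hG, ← hK]
  obtain ⟨δ, hδ⟩ : ∃ δ, δ = s - t := ⟨_, rfl⟩
  have hδ0 : 0 ≤ δ := by linarith
  obtain ⟨N', hN'⟩ : ∃ N' : ℝ → ℝ → ℝ, N' = fun y σ => G (σ - y) (δ + y) * K (σ - y) y
    + K (σ - y) (δ + y) * G (σ - y) y := ⟨_, rfl⟩
  have cN' : Continuous (Function.uncurry N') := by
    rw [hN']; unfold Function.uncurry; fun_prop
  have d0 : ∀ {x y : ℝ}, 0 < x → 0 ≤ y → HasDerivAt (fun z => K z y) (G x y) x := fun hx hy => by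
    rw [hK, hG]; exact hasDerivAt_clamp_fst sk hx hy
  have h1 : K t δ = ∫ σ in (0 : ℝ)..t, G σ δ := by
    rw [eq_add_integral_of_hasDerivAt (f := fun σ => K σ δ) (f' := fun σ => G σ δ) ht (by fun_prop)
      (fun σ hσ => d0 hσ.1 hδ0) (by fun_prop), hbd δ hδ0, zero_add]
  have h2 : ∫ y in (0 : ℝ)..t, K (t - y) (δ + y) * K (t - y) y
      = ∫ σ in (0 : ℝ)..t, (0 + ∫ y in (0 : ℝ)..σ, N' y σ) := by
    refine integral_leibniz (H := fun y t => K (t - y) (δ + y) * K (t - y) y) ht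
      (d := fun _ => 0) continuous_const cN' fun y hy hyt => ?_
    have h3 := eq_add_integral_of_hasDerivAt (f := fun σ => K (σ - y) (δ + y) * K (σ - y) y)
      (f' := N' y) hyt (by fun_prop) (fun σ hσ => ?_) (by fun_prop)
    · simp only [sub_self] at h3
      rw [h3, hbd y hy, mul_zero]
    · have hb : HasDerivAt (fun σ => σ - y) 1 σ := (hasDerivAt_id σ).sub_const y
      have hb0 : 0 < σ - y := by linarith [hσ.1]
      have d1 := HasDerivAt.comp (h₂ := fun z => K z (δ + y)) (h := fun σ => σ - y) σ
        (d0 hb0 (by linarith)) hb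
      have d2 := HasDerivAt.comp (h₂ := fun z => K z y) (h := fun σ => σ - y) σ (d0 hb0 hy) hb
      refine (d1.mul d2).congr_deriv ?_
      rw [hN']
      simp [Function.comp]
  have h3 : ∫ x in (0 : ℝ)..t, K x (s - x) * K x (t - x)
      = ∫ y in (0 : ℝ)..t, K (t - y) (δ + y) * K (t - y) y := by
    have h4 := intervalIntegral.integral_comp_sub_left (a := 0) (b := t)
      (fun x => K x (s - x) * K x (t - x)) t
    rw [sub_self, sub_zero] at h4
    rw [← h4]
    refine intervalIntegral.integral_congr fun y _ => ?_
    rw [show s - (t - y) = δ + y by rw [hδ]; ring, sub_sub_cancel]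
  have h5 : ∀ σ, 0 ≤ σ → G σ δ + ∫ y in (0 : ℝ)..σ, N' y σ = G 0 (2 * σ + δ) := by
    intro σ hσ
    rw [← hinv (2 * σ + δ) σ hσ (by linarith), add_sub_cancel_left, hN']
    congr 1
    have h4 := intervalIntegral.integral_comp_sub_left (a := 0) (b := σ)
      (fun x => G x (2 * σ + δ - σ - x) * K x (σ - x) + K x (2 * σ + δ - σ - x) * G x (σ - x)) σ
    rw [sub_self, sub_zero] at h4
    rw [← h4]
    refine intervalIntegral.integral_congr fun y _ => ?_
    simp only
    rw [show 2 * σ + δ - σ - (σ - y) = δ + y by ring, sub_sub_cancel]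
  rw [← hδ, h3, h1, h2, ← intervalIntegral.integral_add]
  · have h6 := intervalIntegral.integral_comp_mul_add (a := 0) (b := t) (f := fun η => G 0 η)
      (c := 2) two_ne_zero δ
    rw [mul_zero, zero_add, show 2 * t + δ = s + t by rw [hδ]; ring] at h6
    rw [one_div, ← smul_eq_mul, ← h6]
    refine intervalIntegral.integral_congr fun σ hσ => ?_
    rw [uIcc_of_le ht] at hσ
    simp only [zero_add]
    exact h5 σ hσ.1
  · exact Continuous.intervalIntegrable (by fun_prop) _ _
  · exact (continuous_const.add (continuous_integral_endpoints (f := fun σ y => N' y σ)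
      (by unfold Function.uncurry; fun_prop) continuous_const continuous_id)).intervalIntegrable _ _

end IsGoursat
/-! ### Controls for static solutions at unit density -/

/-- A static solution on `(0, X)` extends to a continuously differentiable function on the line:
its second derivative `q y` is bounded, and is continued by zero. -/
theorem IsStaticSolution.exists_extension {q : ℝ → ℝ} {X : ℝ} {y y' : ℝ → ℝ}
    (hy : IsStaticSolution q X y y') (hq : ContinuousOn q (Ici 0)) :
    ∃ Y Y' : ℝ → ℝ, Continuous Y' ∧ (∀ x, HasDerivAt Y (Y' x) x) ∧ EqOn Y y (Ico 0 X) := by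
  obtain ⟨B, hB⟩ := hy.exists_bound hq
  obtain ⟨C, hC⟩ := (isCompact_Icc (a := (0 : ℝ)) (b := X)).exists_bound_of_continuousOn
    (hq.mono Icc_subset_Ici_self)
  have hc : ContinuousOn (fun x => q x * y x) (Ico 0 X) :=
    (hq.mono (Ico_subset_Icc_self.trans Icc_subset_Ici_self)).mul hy.continuousOn
  have hi : Integrable ((Ico 0 X).indicator fun x => q x * y x) := by
    rw [integrable_indicator_iff measurableSet_Ico]
    refine (integrable_const (C * B)).mono' (hc.aestronglyMeasurable measurableSet_Ico) ?_
    filter_upwards [ae_restrict_mem measurableSet_Ico] with x hx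
    rw [norm_mul]
    have h1 := hC x (Ico_subset_Icc_self hx)
    exact mul_le_mul h1 (hB x hx) (norm_nonneg _) ((norm_nonneg _).trans h1)
  set Y' : ℝ → ℝ := fun x => y' 0 + ∫ s in (0 : ℝ)..x, (Ico 0 X).indicator (fun x => q x * y x) s
    with hY'
  have hcY' : Continuous Y' := continuous_const.add
    (intervalIntegral.continuous_primitive (fun _ _ => hi.intervalIntegrable) 0)
  have e1 : ∀ x ∈ Ico 0 X, Y' x = y' x := by
    intro x hx
    have hsub : Icc 0 x ⊆ Ico 0 X := fun s hs => ⟨hs.1, hs.2.trans_lt hx.2⟩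
    rw [eq_add_integral_of_hasDerivAt hx.1 (hy.continuousOn_deriv.mono hsub)
      (fun s hs => hy.hasDerivAt_deriv s ⟨hs.1, hs.2.trans hx.2⟩) (hc.mono hsub), hY']
    simp only [add_right_inj]
    refine intervalIntegral.integral_congr fun s hs => ?_
    rw [uIcc_of_le hx.1] at hs
    exact indicator_of_mem (hsub hs) _
  refine ⟨fun x => y 0 + ∫ s in (0 : ℝ)..x, Y' s, Y', hcY', fun x => ?_, fun x hx => ?_⟩
  · exact (intervalIntegral.integral_hasDerivAt_right (hcY'.intervalIntegrable _ _)
      hcY'.stronglyMeasurable.stronglyMeasurableAtFilter hcY'.continuousAt).const_add (y 0)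
  · have hsub : Icc 0 x ⊆ Ico 0 X := fun s hs => ⟨hs.1, hs.2.trans_lt hx.2⟩
    rw [eq_add_integral_of_hasDerivAt hx.1 (hy.continuousOn.mono hsub)
      (fun s hs => hy.hasDerivAt s ⟨hs.1, hs.2.trans hx.2⟩) (hy.continuousOn_deriv.mono hsub)]
    simp only [add_right_inj]
    refine intervalIntegral.integral_congr fun s hs => ?_
    rw [uIcc_of_le hx.1] at hs
    exact e1 s (hsub hs)

section Triangle
variable {T : ℝ}

theorem convex_triangle (T : ℝ) : Convex ℝ (triangle T) := by
  rintro ⟨a, b⟩ ⟨h1, h2, h3⟩ ⟨c, d⟩ ⟨h4, h5, h6⟩ s t hs ht hst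
  simp only [triangle, mem_ofPred_eq, Prod.smul_mk, Prod.mk_add_mk, smul_eq_mul] at *
  refine ⟨by positivity, by gcongr, ?_⟩
  calc s * a + t * c ≤ s * T + t * T := by gcongr
    _ = T := by rw [← add_mul, hst, one_mul]

theorem uniqueDiffOn_triangle (hT : 0 < T) : UniqueDiffOn ℝ (triangle T) := by
  refine uniqueDiffOn_convex (convex_triangle T) ⟨(T / 2, T / 4), ?_⟩
  rw [mem_interior]
  refine ⟨{p | 0 < p.2} ∩ ({p | p.2 < p.1} ∩ {p | p.1 < T}),
    fun p hp => ⟨le_of_lt hp.1, le_of_lt hp.2.1, le_of_lt hp.2.2⟩, ?_, ?_⟩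
  · exact (isOpen_lt continuous_const continuous_snd).inter
      ((isOpen_lt continuous_snd continuous_fst).inter (isOpen_lt continuous_fst continuous_const))
  · simp only [mem_inter_iff, mem_ofPred_eq]
    exact ⟨by linarith, by linarith, by linarith⟩

/-- Within the triangle, continuous partial derivatives give a total derivative. -/
theorem hasFDerivWithinAt_triangle {φ φξ φt : ℝ → ℝ → ℝ} (hξ : Continuous (Function.uncurry φξ))
    (ht : Continuous (Function.uncurry φt)) (h1 : ∀ ξ t, HasDerivAt (fun ξ => φ ξ t) (φξ ξ t) ξ)
    (h2 : ∀ ξ t, 0 ≤ t → t ≤ ξ → HasDerivWithinAt (φ ξ) (φt ξ t) (Icc 0 ξ) t) {p : ℝ × ℝ}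
    (hp : p ∈ triangle T) : HasFDerivWithinAt (Function.uncurry φ)
      (Function.uncurry φξ p • ContinuousLinearMap.fst ℝ ℝ ℝ
        + Function.uncurry φt p • ContinuousLinearMap.snd ℝ ℝ ℝ) (triangle T) p := by
  refine hasFDerivWithinAt_of_partial (convex_triangle T) ?_ hξ.continuousOn ht.continuousOn
    (fun p _ => (h1 p.1 p.2).hasDerivWithinAt)
    (fun p hp => (h2 p.1 p.2 hp.1 hp.2.1).mono fun t ht => ⟨ht.1, ht.2.1⟩) hp
  rintro ⟨a, b⟩ ⟨h1, h2, h3⟩ ⟨c, d⟩ ⟨h4, h5, h6⟩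
  rcases le_total b c with h | h
  · exact Or.inl ⟨h1, h, h6⟩
  · exact Or.inr ⟨h4, h5.trans (h.trans h2), h3⟩

end Triangle

section UnitDensity
variable {ρ q : ℝ → ℝ} {w : ℝ → ℝ → ℝ} (hw : IsWaveKernel ρ q w) (hρ : IsDensity ρ)
  (h1 : ∀ x, 0 ≤ x → ρ x = 1)
include hw hρ h1

/-- The partial derivatives in the coordinates `(x, t)` and `(x, t - x)` agree at `x = 0`, because
the kernel vanishes there. -/
theorem responseFunction_eq {t : ℝ} (ht : 0 < t) :
    responseFunction w t = dx (straighten ρ w) 0 t := by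
  obtain ⟨m, hm, hkm, hm0⟩ := exists_eq_mul (hw.contDiffOn_straighten hρ)
    fun y hy => hw.straighten_zero hρ hy
  have hN : Continuous fun x => m x (t - x) := by fun_prop
  have hd := hasDerivWithinAt_mul_of_continuous hN
  rw [sub_zero, hm0 t ht.le] at hd
  have he : ∀ x, 0 ≤ x → x < t → w x t = x * m x (t - x) := fun x hx hxt => by
    rw [← hkm x (t - x) hx (by linarith), straighten, eikonal_of_one h1 hx, add_sub_cancel]
  refine (hd.congr_of_eventuallyEq ?_ (he 0 le_rfl ht)).derivWithin
    (uniqueDiffOn_Ici 0 0 self_mem_Ici)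
  filter_upwards [self_mem_nhdsWithin, nhdsWithin_le_nhds (Iio_mem_nhds ht)] with x hx hxt
  exact he x hx hxt

theorem responsePrimitive_eq {t : ℝ} (ht : 0 ≤ t) : responsePrimitive w t
    = (1 / 2) * ∫ η in (0 : ℝ)..t, clamp (dx (straighten ρ w)) 0 η := by
  rw [responsePrimitive]
  congr 1
  refine intervalIntegral.integral_congr_ae (Eventually.of_forall fun η hη => ?_)
  rw [uIoc_of_le ht] at hη
  rw [responseFunction_eq hw hρ h1 hη.1, clamp_eq le_rfl hη.1.le]

/-- The Gelfand–Levitan kernel factors through the kernel of the control operator. -/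
theorem glKernel_eq {s t : ℝ} (ht : 0 ≤ t) (hts : t ≤ s) :
    glKernel w s t = clamp (straighten ρ w) t (s - t)
      + ∫ x in (0 : ℝ)..t, clamp (straighten ρ w) x (s - x) * clamp (straighten ρ w) x (t - x) := by
  rw [(isGoursat_straighten hw hρ h1).integral_response ht hts, glKernel,
    abs_of_nonpos (by linarith), neg_sub, responsePrimitive_eq hw hρ h1 (by linarith),
    responsePrimitive_eq hw hρ h1 (by linarith), ← mul_sub, add_comm t s]
  have hc : Continuous fun η => clamp (dx (straighten ρ w)) 0 η :=
    (continuous_clamp (contDiffOn_dx (hw.contDiffOn_straighten hρ)).continuousOn).comp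
      (f := fun η => ((0 : ℝ), η)) (by fun_prop)
  rw [intervalIntegral.integral_interval_sub_left (hc.intervalIntegrable _ _)
    (hc.intervalIntegrable _ _)]

omit hw hρ in
/-- Duhamel's formula for unit density, with the control run backwards in time. -/
theorem wave_reverse {φ : ℝ → ℝ} {x ξ : ℝ} (hx : 0 ≤ x) (hxξ : x ≤ ξ) :
    wave ρ w (fun t => φ (ξ - t)) x ξ
      = φ x + ∫ s in x..ξ, clamp (straighten ρ w) x (s - x) * φ s := by
  have he := eikonal_of_one h1 hx
  have ha := amp_of_one h1 hx
  rw [amp] at ha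
  rw [wave, he, if_pos hxξ, ha, one_mul, sub_sub_cancel]
  congr 1
  have h := intervalIntegral.integral_comp_sub_left (a := 0) (b := ξ - x)
    (fun s => clamp (straighten ρ w) x (s - x) * φ s) ξ
  rw [sub_sub_cancel, sub_zero] at h
  rw [← h]
  refine intervalIntegral.integral_congr fun s hs => ?_
  rw [uIcc_of_le (by linarith)] at hs
  rw [clamp_eq hx (by linarith [hs.2]), straighten, he, add_sub_cancel]

/-- The family of controls that steer to the restrictions of a static solution, and the
Gelfand–Levitan equation. -/
theorem exists_control_gelfandLevitan (hq : ContinuousOn q (Ici 0)) {T : ℝ} (hT : 0 < T)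
    {y y' : ℝ → ℝ} (hy : IsStaticSolution q (front ρ T) y y') (hy0 : y 0 = 0) (hy1 : y' 0 = 1) :
    ∃ φ : ℝ → ℝ → ℝ, ContDiffOn ℝ 1 (Function.uncurry φ) (triangle T) ∧
      ∀ ξ : ℝ, 0 < ξ → ξ ≤ T →
        (∃ (W : Outer ξ →L[ℝ] Inner ρ ξ) (f : Outer ξ), IsControlOperator ρ w ξ W ∧
          f =ᵐ[timeMeasure ξ] (fun t => φ ξ (ξ - t)) ∧ W f =ᵐ[spaceMeasure ρ ξ] y ∧
          connectingOperator W f = kappa ξ) ∧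
        (φ ξ ξ ≠ 0 → ∀ t : ℝ, 0 ≤ t → t ≤ ξ → glKernel w ξ t + glSolution T φ ξ t
          + ∫ s in (0 : ℝ)..ξ, glKernel w s t * glSolution T φ ξ s = 0) := by
  have sk := hw.contDiffOn_straighten hρ
  have cK := continuous_clamp sk.continuousOn
  have cKx := continuous_clamp (contDiffOn_dx sk).continuousOn
  have cKy := continuous_clamp (contDiffOn_dy sk).continuousOn
  obtain ⟨A, hA⟩ : ∃ A : ℝ → ℝ → ℝ, A = fun x s => clamp (straighten ρ w) x (s - x) := ⟨_, rfl⟩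
  obtain ⟨A', hA'⟩ : ∃ A' : ℝ → ℝ → ℝ, A' = fun x s => clamp (dx (straighten ρ w)) x (s - x)
    - clamp (dy (straighten ρ w)) x (s - x) := ⟨_, rfl⟩
  have cA : Continuous (Function.uncurry A) := by rw [hA]; unfold Function.uncurry; fun_prop
  have cA' : Continuous (Function.uncurry A') := by rw [hA']; unfold Function.uncurry; fun_prop
  have hAA' : ∀ x s, 0 ≤ x → x ≤ s → A s s = A x s + ∫ σ in x..s, A' σ s := by
    intro x s hx hxs
    refine eq_add_integral_of_hasDerivAt (f := fun σ => A σ s) (f' := fun σ => A' σ s) hxs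
      (by fun_prop) (fun σ hσ => ?_) (by fun_prop)
    rw [hA, hA']
    refine (hasDerivAt_clamp_curve sk (hasDerivAt_id σ) ((hasDerivAt_id σ).const_sub s)
      (hx.trans_lt hσ.1) (by simp only [id]; linarith [hσ.2])).congr_deriv ?_
    simp [sub_eq_add_neg]
  obtain ⟨Γ, hΓ⟩ := exists_isResolvent cA
  have cΓ := hΓ.continuous_resolvent
  obtain ⟨Y, Y', cY', hY, hYy⟩ := hy.exists_extension hq
  have cY : Continuous Y := continuous_iff_continuousAt.2 fun x => (hY x).continuousAt
  obtain ⟨φ, hφ⟩ : ∃ φ : ℝ → ℝ → ℝ, φ = fun ξ x => Y x - ∫ s in x..ξ, Γ x s * Y s := ⟨_, rfl⟩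
  have cφ : Continuous (Function.uncurry φ) := hφ ▸ IsResolvent.continuous_solution cΓ cY
  have hd : ∀ p ∈ triangle T, HasFDerivWithinAt (Function.uncurry φ)
      (-(Γ p.2 p.1 * Y p.1) • ContinuousLinearMap.fst ℝ ℝ ℝ
        + (Y' p.2 + A p.2 p.2 * φ p.1 p.2 - ∫ s in p.2..p.1, A' p.2 s * φ p.1 s)
          • ContinuousLinearMap.snd ℝ ℝ ℝ) (triangle T) p := fun p hp =>
    hasFDerivWithinAt_triangle (φξ := fun ξ t => -(Γ t ξ * Y ξ))
      (φt := fun ξ t => Y' t + A t t * φ ξ t - ∫ s in t..ξ, A' t s * φ ξ s)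
      (by unfold Function.uncurry; fun_prop)
      (Continuous.sub (by fun_prop) (continuous_integral_endpoints
        (f := fun (p : ℝ × ℝ) s => A' p.2 s * φ p.1 s) (by unfold Function.uncurry; fun_prop)
        continuous_snd continuous_fst))
      (fun ξ t => by rw [hφ]; exact IsResolvent.hasDerivAt_solution cΓ cY t ξ)
      (fun ξ t ht htξ => hΓ.hasDerivWithinAt_solution hY cA' hAA' hφ ht htξ) hp
  have hfd : ∀ p ∈ triangle T, _ := fun p hp =>
    (hd p hp).fderivWithin (uniqueDiffOn_triangle hT p hp)
  refine ⟨φ, ?_, fun ξ hξ hξT => ⟨?_, fun hne t ht htξ => ?_⟩⟩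
  · rw [show (1 : WithTop ℕ∞) = 0 + 1 from rfl,
      contDiffOn_succ_iff_hasFDerivWithinAt_of_uniqueDiffOn (uniqueDiffOn_triangle hT)]
    refine ⟨by simp, _, contDiffOn_zero.2 ?_, hd⟩
    have c1 : Continuous fun p : ℝ × ℝ => -(Γ p.2 p.1 * Y p.1) := by fun_prop
    have c2 : Continuous fun p : ℝ × ℝ =>
        Y' p.2 + A p.2 p.2 * φ p.1 p.2 - ∫ s in p.2..p.1, A' p.2 s * φ p.1 s :=
      Continuous.sub (by fun_prop) (continuous_integral_endpoints
        (f := fun (p : ℝ × ℝ) s => A' p.2 s * φ p.1 s) (by unfold Function.uncurry; fun_prop)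
        continuous_snd continuous_fst)
    exact ((c1.smul continuous_const).add (c2.smul continuous_const)).continuousOn
  · obtain ⟨W, hW⟩ := exists_controlOperator hw hρ hξ
    have hm : MemLp (fun t => φ ξ (ξ - t)) 2 (timeMeasure ξ) :=
      memLp_of_continuousOn (by fun_prop)
    have hyξ := hy.mono (hρ.front_le_front hξ.le hξT)
    have hWf : W (hm.toLp _) =ᵐ[spaceMeasure ρ ξ] y := by
      filter_upwards [hW (hm.toLp _), wave_congr_ae w hρ hξ hm.coeFn_toLp,
        ae_mem_Ioo_spaceMeasure ρ ξ] with x e1 e2 hx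
      have hxξ : x < ξ := by rw [← front_of_one hρ h1 hξ.le]; exact hx.2
      have hxT : x ∈ Ico 0 (front ρ T) := by
        rw [front_of_one hρ h1 hT.le]; exact ⟨hx.1.le, hxξ.trans_le hξT⟩
      have h3 := hΓ.integral_solution cY hx.1.le hxξ.le
      refine (e1.trans e2).trans ?_
      rw [wave_reverse h1 hx.1.le hxξ.le, ← hYy hxT, ← h3, hφ, hA]
    refine ⟨W, hm.toLp _, hW, hm.coeFn_toLp, hWf, ?_⟩
    have h2 := (connectingOperator_eq_iff hw hρ hq hξ hW W.surjective hyξ (hm.toLp _)).2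
      (Lp.ext (hWf.trans (MemLp.coeFn_toLp _).symm))
    rw [h2, hy0, hy1, one_smul, zero_smul, sub_zero]
  · have hφξ : φ ξ ξ = Y ξ := by rw [hφ]; simp
    have hL : ∀ s ∈ Icc 0 ξ, glSolution T φ ξ s = -Γ s ξ := by
      intro s hs
      rw [glSolution, hfd (ξ, s) ⟨hs.1, hs.2, hξT⟩]
      rw [hφξ] at hne ⊢
      simp
      field_simp
    have hmain := hΓ.gelfandLevitan (F := glKernel w) (fun s t ht hts => by
        rw [hA]; exact glKernel_eq hw hρ h1 ht hts)
      (fun s t => by rw [glKernel, glKernel, add_comm, abs_sub_comm]) ht htξ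
    rw [hL t ⟨ht, htξ⟩, intervalIntegral.integral_congr
      (g := fun s => -(glKernel w s t * Γ s ξ)), intervalIntegral.integral_neg]
    · linarith
    · intro s hs
      rw [uIcc_of_le hξ.le] at hs
      simp only
      rw [hL s hs, mul_neg]

end UnitDensity
end
end WaveControl

theorem theorem2 (ρ q : ℝ → ℝ)
    (hρ : ContDiffOn ℝ ∞ ρ (Set.Ici 0)) (hρ_pos : ∀ x : ℝ, 0 ≤ x → 0 < ρ x)
    (hq : ContDiffOn ℝ ∞ q (Set.Ici 0))
    (hτ : Filter.Tendsto (WaveControl.eikonal ρ) Filter.atTop Filter.atTop) :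
    -- the fundamental solution exists
    (∃ w : ℝ → ℝ → ℝ, WaveControl.IsWaveKernel ρ q w) ∧
    ∀ w : ℝ → ℝ → ℝ, WaveControl.IsWaveKernel ρ q w → ∀ T : ℝ, 0 < T →
      -- the control operator is an isomorphism, the response operator is well defined
      ∃ (W : WaveControl.Outer T ≃L[ℝ] WaveControl.Inner ρ T)
        (R : WaveControl.Outer T →ₗ.[ℝ] WaveControl.Outer T),
        WaveControl.IsControlOperator ρ w T W ∧
        WaveControl.IsResponseOperator ρ w T R ∧
        Dense (R.domain : Set (WaveControl.Outer T)) ∧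
        ∃ hκ : WaveControl.kappa T ∈ R.adjoint.domain,
          ∀ y y' : ℝ → ℝ,
            WaveControl.IsStaticSolution q (WaveControl.front ρ T) y y' →
            -- the control that steers the system to `y` is the unique solution of the equation
            (∃ hy : MeasureTheory.MemLp y 2 (WaveControl.spaceMeasure ρ T),
              ∀ f : WaveControl.Outer T,
                WaveControl.connectingOperator (W : WaveControl.Outer T →L[ℝ] WaveControl.Inner ρ T) f
                    = y' 0 • WaveControl.kappa T
                      - y 0 • R.adjoint ⟨WaveControl.kappa T, hκ⟩
                  ↔ f = W.symm (hy.toLp y)) ∧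
            -- the Gelfand-Levitan equation for `ρ = 1`, `y(0) = 0`, `y'(0) = 1`
            ((∀ x : ℝ, 0 ≤ x → ρ x = 1) → y 0 = 0 → y' 0 = 1 →
              ∃ φ : ℝ → ℝ → ℝ,
                ContDiffOn ℝ 1 (Function.uncurry φ) (WaveControl.triangle T) ∧
                ∀ ξ : ℝ, 0 < ξ → ξ ≤ T →
                  (∃ (Wξ : WaveControl.Outer ξ →L[ℝ] WaveControl.Inner ρ ξ)
                      (f : WaveControl.Outer ξ),
                    WaveControl.IsControlOperator ρ w ξ Wξ ∧
                    f =ᵐ[WaveControl.timeMeasure ξ] (fun t => φ ξ (ξ - t)) ∧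
                    Wξ f =ᵐ[WaveControl.spaceMeasure ρ ξ] y ∧
                    WaveControl.connectingOperator Wξ f = WaveControl.kappa ξ) ∧
                  (φ ξ ξ ≠ 0 → ∀ t : ℝ, 0 ≤ t → t ≤ ξ →
                    WaveControl.glKernel w ξ t + WaveControl.glSolution T φ ξ t
                      + ∫ s in (0 : ℝ)..ξ,
                          WaveControl.glKernel w s t * WaveControl.glSolution T φ ξ s = 0)) := by
  have hd : WaveControl.IsDensity ρ := ⟨hρ, hρ_pos, hτ⟩
  refine ⟨WaveControl.exists_isWaveKernel hd hq, fun w hw T hT => ?_⟩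
  obtain ⟨W, hW⟩ := WaveControl.exists_controlOperator hw hd hT
  refine ⟨W, WaveControl.responseOp hw hd hT, hW,
    WaveControl.isResponseOperator_responseOp hw hd hT, WaveControl.dense_range_primL hT.le,
    WaveControl.kappa_mem_adjoint_domain hw hd hT, fun y y' hy =>
      ⟨⟨hy.memLp hd hq.continuousOn rfl, fun f => ?_⟩, fun h1 hy0 hy1 =>
        WaveControl.exists_control_gelfandLevitan hw hd h1 hq.continuousOn hT hy hy0 hy1⟩⟩
  rw [WaveControl.connectingOperator_eq_iff hw hd hq.continuousOn hT hW W.surjective hy]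
  exact ⟨fun h => by rw [← h]; exact (W.symm_apply_apply f).symm,
    fun h => by rw [h]; exact W.apply_symm_apply _⟩
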